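/- **Setting.** Let $m\ge 2$ and let $G\le SU(m-1)$ be a compact connected subgroup, acting on $\mathbb C^{m-1}$ in the standard way and on $\mathbb C^m=\mathbb C^{m-1}\times\mathbb C$ trivially on the last coordinate $z_m$. Let $\mathfrak g$ be its Lie algebra, $\mu(z)=-\tfrac12\pi_{\mathfrak g}(iz\bar z^{T})$ its standard moment map on $\mathbb C^{m-1}$ ($\pi_{\mathfrak g}$ the orthogonal projection onto $\mathfrak g$ for $\mathrm{Re}\,\mathrm{tr}(X^*Y)$), and let $Z$ be a connected component of $\mu^{-1}(0)$ which contains a nonempty $G$-invariant cohomogeneity-one Lagrangian submanifold of $\mathbb C^{m-1}$. A $d$-dimensional invariant set has cohomogeneity $k$ if all its points have one isotropy type $(H)$ and $\dim (G/H)=d-k$. Let $z'\in Z\setminus\{0\}$, let $P=\mathbb C z'$ and let $C_k=\mathrm{Stab}(P)/\mathrm{Stab}(z')$, which acts on $P$, and on $P\times\mathbb C$ trivially on the second factor. The Lagrangian angle $\theta$ of an oriented Lagrangian $L\subset\mathbb C^N$ is given by $dz_1\wedge\dots\wedge dz_N|_L=e^{i\theta}\mathrm{vol}_L$; without an orientation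 it is defined mod $\pi$. A Lagrangian translator is a Lagrangian $L\subset\mathbb C^m$ with mean curvature $\vec H=e_m^{\perp}$, normalised so that $\theta_L+\mathrm{Im}\,z_m\equiv 0 \pmod \pi$. A special Lagrangian (with angle $0$) is a Lagrangian $L\subset\mathbb C^m$ with $\vec H=0$ and $\theta_L=0$ for a suitable orientation. **Statement.** There is a complex linear isometry $\Phi:P\to\mathbb C$ such that, identifying $P\times\mathbb C$ with $\mathbb C^2$ through $\Phi\oplus\mathrm{Id}$ (which carries the $C_k$-action to $\mathbb C^2$), the maps $$L\longmapsto \check L:=L\cap(P\times\mathbb C),\qquad \check L\longmapsto L:=G\cdot\check L$$ are mutually inverse 1-1 correspondences 1. between the $G$-invariant cohomogeneity-two Lagrangian translators $L\subset Z\times\mathbb C\subset\mathbb C^m$ and the $C_k$-invariant Lagrangian surfaces $\check L\subset\mathbb C^2$ with $$\theta_{\check L}(z_1,z_2)+(m-2)\arg z_1+\mathrm{Im}\,z_2\equiv 0\pmod\pi ;$$ 2. between the $G$-invariant cohomogeneity-two special Lagrangians $L\subset Z\times\mathbb C\subset\mathbb C^m$ with angle $0$ and the $C_k$-invariant Lagrangian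 surfaces $\check L\subset\mathbb C^2$ with, for a suitable orientation, $$\theta_{\check L}(z_1,z_2)+(m-2)\arg z_1=0 .$$ If $m\ge 3$, these equations include the requirement that $z_1\ne0$ on $\check L$; if $m=2$, the term $(m-2)\arg z_1$ is $0$. Both correspondences hold * for embedded submanifolds; * for immersed submanifolds regarded as subsets (images of immersions); * for immersed submanifolds regarded as equivariant immersions up to equivariant reparametrisation. Here $L$ is a $G$-equivariant immersion $F:\hat L\to\mathbb C^m$ with $G$ acting continuously on $\hat L$ and $\mathrm{Stab}(p)=\mathrm{Stab}(F(p))$ for all $p$, $\check L$ is a $C_k$-equivariant immersion of a surface, intersecting with $P\times\mathbb C$ means restricting $F$ to the submanifold $F^{-1}(P\times\mathbb C)$, and the images are related by $\check L=L\cap(P\times\mathbb C)$ and $L=G\cdot\check L$. -/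

import Mathlib

open scoped Manifold ContDiff
open Complex (I)

noncomputable section

namespace CohomTwo

/-! ### Flat complex space, its Kähler form and its holomorphic volume form -/

/-- The Hermitian space `ℂ^N`; as a real inner product space it carries the Euclidean metric. -/
abbrev C (N : ℕ) : Type := EuclideanSpace ℂ (Fin N)

/-- The Kähler form `ω₀ = ∑ dxᵢ ∧ dyᵢ`. -/
def kahlerForm {N : ℕ} (v w : C N) : ℝ :=
  ∑ i, ((v i).re * (w i).im - (v i).im * (w i).re)

/-- The holomorphic volume form `Ω₀ = dz₁ ∧ ⋯ ∧ dz_N`. -/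
def holVol {N : ℕ} (e : Fin N → C N) : ℂ :=
  Matrix.det (Matrix.of fun i j => e j i)

/-- `θ` is a Lagrangian angle of the Lagrangian plane `T ⊂ ℂ^N`: for one of the two orientations
of `T`, the unit volume form `vol_T` satisfies `Ω₀|_T = e^{iθ} vol_T`. (The orientation is given
by an orthonormal basis `e` of `T`, for which `vol_T(e) = 1`.) -/
def IsLagrangianAngle {N : ℕ} (T : Submodule ℝ (C N)) (θ : ℝ) : Prop :=
  ∃ e : Fin N → C N, (∀ i, e i ∈ T) ∧ Orthonormal ℝ e ∧ holVol e = Complex.exp (θ * I)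

/-! ### Immersed Lagrangian submanifolds -/

/-- An immersed Lagrangian submanifold of `ℂ^N`: a smooth immersion `F` of a smooth (Hausdorff,
second countable) real `N`-dimensional manifold with `F^* ω₀ = 0`. -/
structure LagrangianImmersion (N : ℕ) : Type 1 where
  carrier : Type
  [top : TopologicalSpace carrier]
  [t2 : T2Space carrier]
  [secondCountable : SecondCountableTopology carrier]
  [charted : ChartedSpace (EuclideanSpace ℝ (Fin N)) carrier]
  [smoothManifold : IsManifold (𝓡 N) ∞ carrier]
  toFun : carrier → C N
  smooth : ContMDiff (𝓡 N) 𝓘(ℝ, C N) ∞ toFun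
  immersive : ∀ p, Function.Injective (mfderiv (𝓡 N) 𝓘(ℝ, C N) toFun p)
  lagrangian : ∀ p (u v : TangentSpace (𝓡 N) p),
    kahlerForm (N := N) (mfderiv (𝓡 N) 𝓘(ℝ, C N) toFun p u)
      (mfderiv (𝓡 N) 𝓘(ℝ, C N) toFun p v) = 0

attribute [instance] LagrangianImmersion.top LagrangianImmersion.t2
  LagrangianImmersion.secondCountable LagrangianImmersion.charted
  LagrangianImmersion.smoothManifold

namespace LagrangianImmersion

variable {N : ℕ} (F : LagrangianImmersion N)

/-- The tangent plane of the immersion at `p`, as a real subspace of `ℂ^N`. -/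
def tangentPlane (p : F.carrier) : Submodule ℝ (C N) :=
  LinearMap.range (mfderiv (𝓡 N) 𝓘(ℝ, C N) F.toFun p).toLinearMap

/-- The component of an ambient vector normal to the immersion at `p`. -/
def normalPart (p : F.carrier) (v : C N) : C N :=
  (F.tangentPlane p)ᗮ.starProjection v

/-- The immersion read in the preferred chart at `p`. -/
def localRep (p : F.carrier) : EuclideanSpace ℝ (Fin N) → C N :=
  F.toFun ∘ (chartAt (EuclideanSpace ℝ (Fin N)) p).symm

/-- The coordinate derivative `∂ᵢ F` in the preferred chart at `p`. -/
def partialDeriv (p : F.carrier) (i : Fin N) (x : EuclideanSpace ℝ (Fin N)) : C N :=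
  fderiv ℝ (F.localRep p) x (EuclideanSpace.single i 1)

/-- The second coordinate derivative `∂ᵢ∂ⱼ F` at `p`, in the preferred chart at `p`. -/
def secondPartial (p : F.carrier) (i j : Fin N) : C N :=
  fderiv ℝ (F.partialDeriv p j) (chartAt (EuclideanSpace ℝ (Fin N)) p p)
    (EuclideanSpace.single i 1)

/-- The induced metric `gᵢⱼ = ⟨∂ᵢ F, ∂ⱼ F⟩` at `p`, in the preferred chart at `p`. -/
def inducedMetric (p : F.carrier) : Matrix (Fin N) (Fin N) ℝ :=
  Matrix.of fun i j =>
    inner ℝ (F.partialDeriv p i (chartAt (EuclideanSpace ℝ (Fin N)) p p))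
      (F.partialDeriv p j (chartAt (EuclideanSpace ℝ (Fin N)) p p))

/-- The mean curvature vector `H = gⁱʲ (∂ᵢ∂ⱼ F)^⊥`. -/
def meanCurvature (p : F.carrier) : C N :=
  ∑ i, ∑ j, ((F.inducedMetric p)⁻¹ i j) • F.normalPart p (F.secondPartial p i j)

end LagrangianImmersion

/-- A Lagrangian translating soliton in `ℂ^{n+1}`, in the direction `e_m` of the last coordinate
(`m = n + 1`): `H = e_m^⊥`, where the constant of the integrated equation `θ + Im z_m = c` is
normalised to `0` (mod `π`, as the Lagrangian angle of an unoriented plane is defined mod `π`). -/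
def IsTranslator {n : ℕ} (F : LagrangianImmersion (n + 1)) : Prop :=
  (∀ p, F.meanCurvature p = F.normalPart p (EuclideanSpace.single (Fin.last n) 1)) ∧
  ∀ p θ, IsLagrangianAngle (F.tangentPlane p) θ →
    θ + (F.toFun p (Fin.last n)).im ≡ 0 [PMOD Real.pi]

/-- A special Lagrangian with Lagrangian angle `0` (with respect to one of its orientations; the
pointwise choice is automatically continuous, being the orientation on which `Re Ω₀ > 0`). -/
def IsSpecialLagrangian {n : ℕ} (F : LagrangianImmersion (n + 1)) : Prop :=
  (∀ p, F.meanCurvature p = 0) ∧ ∀ p, IsLagrangianAngle (F.tangentPlane p) 0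

/-- The equation `θ(z₁, z₂) + (m - 2) arg z₁ + Im z₂ ≡ 0 (mod π)` for a Lagrangian surface in
`ℂ²`, with `m = n + 1`. The term `(m - 2) arg z₁` is only defined where `z₁ ≠ 0`, except that it
is identically zero if `m = 2`. -/
def IsWeightedTranslator (n : ℕ) (f : LagrangianImmersion 2) : Prop :=
  ∀ p, (n = 1 ∨ f.toFun p 0 ≠ 0) ∧
    ∀ θ, IsLagrangianAngle (f.tangentPlane p) θ →
      θ + ((n : ℝ) - 1) * Complex.arg (f.toFun p 0) + (f.toFun p 1).im ≡ 0 [PMOD Real.pi]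

/-- The equation `θ(z₁, z₂) + (m - 2) arg z₁ = 0` for a Lagrangian surface in `ℂ²`, with
`m = n + 1`, for one of its orientations (again the pointwise choice is automatically
continuous). -/
def IsWeightedSpecialLagrangian (n : ℕ) (f : LagrangianImmersion 2) : Prop :=
  ∀ p, (n = 1 ∨ f.toFun p 0 ≠ 0) ∧
    ∃ θ, IsLagrangianAngle (f.tangentPlane p) θ ∧
      θ + ((n : ℝ) - 1) * Complex.arg (f.toFun p 0) = 0

/-! ### The actions of `SU(n)` on `ℂ^n` and on `ℂ^{n+1}` -/

abbrev SU (n : ℕ) : Type := Matrix.specialUnitaryGroup (Fin n) ℂ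

/-- The standard representation of `SU(n)` on `ℂ^n`. -/
def std (n : ℕ) : SU n →* Module.End ℂ (C n) where
  toFun g :=
    { toFun := fun z => WithLp.toLp 2 (g.1.mulVec z.ofLp)
      map_add' := fun z w => by ext i; simp [Matrix.mulVec_add]
      map_smul' := fun c z => by ext i; simp [Matrix.mulVec_smul] }
  map_one' := by ext z i; simp
  map_mul' g h := by ext z i; simp

/-- The point `(z, s) ∈ ℂ^n × ℂ = ℂ^{n+1}`. -/
def pair {n : ℕ} (z : C n) (s : ℂ) : C (n + 1) :=
  WithLp.toLp 2 (Fin.snoc (α := fun _ => ℂ) z.ofLp s)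

/-- The first component of a point of `ℂ^{n+1} = ℂ^n × ℂ`. -/
def head {n : ℕ} (w : C (n + 1)) : C n :=
  WithLp.toLp 2 fun i => w i.castSucc

@[simp] theorem head_pair {n : ℕ} (z : C n) (s : ℂ) : head (pair z s) = z := by
  ext i; simp [head, pair]

@[simp] theorem pair_last {n : ℕ} (z : C n) (s : ℂ) : pair z s (Fin.last n) = s := by
  simp [pair]

@[simp] theorem pair_head {n : ℕ} (w : C (n + 1)) : pair (head w) (w (Fin.last n)) = w := by
  ext i
  refine Fin.lastCases ?_ (fun j => ?_) i <;> simp [head, pair]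

theorem pair_add {n : ℕ} (z z' : C n) (s s' : ℂ) :
    pair (z + z') (s + s') = pair z s + pair z' s' := by
  ext i
  refine Fin.lastCases ?_ (fun j => ?_) i <;> simp [pair]

theorem pair_smul {n : ℕ} (c : ℂ) (z : C n) (s : ℂ) : pair (c • z) (c * s) = c • pair z s := by
  ext i
  refine Fin.lastCases ?_ (fun j => ?_) i <;> simp [pair]

/-- The representation of `SU(n)` on `ℂ^{n+1} = ℂ^n × ℂ` that is trivial on the last coordinate. -/
def ext (n : ℕ) : SU n →* Module.End ℂ (C (n + 1)) where
  toFun g :=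
    { toFun := fun w => pair (std n g (head w)) (w (Fin.last n))
      map_add' := fun z w => by
        have h : head (z + w) = head z + head w := rfl
        rw [h, map_add, ← pair_add]; rfl
      map_smul' := fun c z => by
        have h : head (c • z) = c • head z := rfl
        rw [h, map_smul]; exact pair_smul c _ _ }
  map_one' := LinearMap.ext fun w => by simp
  map_mul' g h := LinearMap.ext fun w => by simp

/-! ### Lie algebras and the standard moment map -/

/-- The real vector space of complex `n × n` matrices `X = (X (i, j))`, with the
(`Ad U(n)`-invariant) inner product `Re tr (X^* Y)`. -/
abbrev Mat (n : ℕ) : Type := EuclideanSpace ℂ (Fin n × Fin n)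

/-- The Lie algebra of a subgroup `H ≤ SU(n)`: the tangent space at the identity, i.e. the space
of velocities at time `0` of curves in `H` through the identity. -/
def lieAlg {n : ℕ} (H : Subgroup (SU n)) : Submodule ℝ (Mat n) where
  carrier := {X | ∃ γ : ℝ → SU n, (∀ t, γ t ∈ H) ∧ γ 0 = 1 ∧
    ∀ i j, HasDerivAt (fun t => (γ t).1 i j) (X (i, j)) 0}
  zero_mem' := ⟨fun _ => 1, fun _ => H.one_mem, rfl, fun i j => by
    simpa using hasDerivAt_const (0 : ℝ) ((1 : SU n).1 i j)⟩
  add_mem' := by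
    rintro X Y ⟨γ, hγ, hγ0, hX⟩ ⟨η, hη, hη0, hY⟩
    refine ⟨fun t => γ t * η t, fun t => H.mul_mem (hγ t) (hη t), by simp [hγ0, hη0], ?_⟩
    intro i j
    have h := HasDerivAt.fun_sum (u := Finset.univ)
      fun (k : Fin n) _ => (hX i k).mul (hY k j)
    have e : (∑ k, (X (i, k) * (η 0).1 k j + (γ 0).1 i k * Y (k, j))) = (X + Y) (i, j) := by
      rw [hγ0, hη0]
      simp [Matrix.one_apply, Finset.sum_add_distrib]
    rw [e] at h
    refine h.congr_of_eventuallyEq (Filter.Eventually.of_forall fun t => ?_)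
    simp [Matrix.mul_apply]
  smul_mem' := by
    rintro c X ⟨γ, hγ, hγ0, hX⟩
    refine ⟨fun t => γ (c * t), fun t => hγ _, by simp [hγ0], fun i j => ?_⟩
    have h1 : HasDerivAt (fun t : ℝ => c * t) c 0 := by
      simpa using (hasDerivAt_id (0 : ℝ)).const_mul c
    have h2 : HasDerivAt (fun t => (γ t).1 i j) (X (i, j)) (c * 0) := by simpa using hX i j
    have h3 := h2.scomp (0 : ℝ) h1
    exact h3

/-- The standard moment map `μ(z) = -½ π_𝔤(i z z̄ᵀ)` of `G ≤ SU(n)`, where `π_𝔤` is the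
orthogonal projection onto the Lie algebra. -/
def momentMap {n : ℕ} (G : Subgroup (SU n)) (z : C n) : Mat n :=
  (-(1 / 2) : ℝ) • (lieAlg G).starProjection
    (WithLp.toLp 2 fun p : Fin n × Fin n => I * (z p.1 * star (z p.2)))

/-! ### Cohomogeneity and invariance -/

/-- The isotropy group in `G` of a point, for a linear action `ρ` of `SU(n)`. -/
def isotropy {n : ℕ} (G : Subgroup (SU n)) {V : Type*} [AddCommGroup V] [Module ℂ V]
    (ρ : SU n →* Module.End ℂ V) (p : V) : Subgroup G where
  carrier := {g | ρ g p = p}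
  one_mem' := by simp
  mul_mem' := fun {a b} (ha : ρ a p = p) (hb : ρ b p = p) => by
    change ρ (a * b : SU n) p = p
    rw [map_mul, Module.End.mul_apply, hb, ha]
  inv_mem' := fun {a} (ha : ρ a p = p) => by
    change ρ ((a : SU n)⁻¹) p = p
    conv_lhs => rw [← ha]
    rw [← Module.End.mul_apply, ← map_mul, inv_mul_cancel, map_one, Module.End.one_apply]

/-- `S` is invariant under `G`, for a linear action `ρ` of `SU(n)`. -/
def IsInvariant {n : ℕ} (G : Subgroup (SU n)) {V : Type*} [AddCommGroup V] [Module ℂ V]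
    (ρ : SU n →* Module.End ℂ V) (S : Set V) : Prop :=
  ∀ g ∈ G, ∀ p ∈ S, ρ g p ∈ S

/-- `S`, of dimension `d`, has cohomogeneity `k`: all points of `S` have the same isotropy type
`(H)`, and `dim (G / H) = dim G - dim H` is `d - k`. -/
def IsCohomogeneity {n : ℕ} (G : Subgroup (SU n)) {V : Type*} [AddCommGroup V] [Module ℂ V]
    (ρ : SU n →* Module.End ℂ V) (S : Set V) (d k : ℕ) : Prop :=
  ∃ H : Subgroup G,
    (∀ p ∈ S, ∃ g : G, isotropy G ρ p = H.map (MulAut.conj g).toMonoidHom) ∧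
    Module.finrank ℝ (lieAlg G) + k = Module.finrank ℝ (lieAlg (H.map G.subtype)) + d

/-- The set `Z` contains a (nonempty, immersed) `G`-invariant Lagrangian submanifold of `ℂ^n` of
cohomogeneity one. -/
def AdmitsCohomOneLagrangian {n : ℕ} (G : Subgroup (SU n)) (Z : Set (C n)) : Prop :=
  ∃ F : LagrangianImmersion n, Nonempty F.carrier ∧ Set.range F.toFun ⊆ Z ∧
    IsInvariant G (std n) (Set.range F.toFun) ∧ IsCohomogeneity G (std n) (Set.range F.toFun) n 1

/-! ### The profile plane `P × ℂ` and the group `C_k` -/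

/-- The complex line `P` through `z`. -/
abbrev line {n : ℕ} (z : C n) : Submodule ℂ (C n) := Submodule.span ℂ {z}

/-- The subset `S × ℂ` of `ℂ^n × ℂ = ℂ^{n+1}`. -/
def timesC {n : ℕ} (S : Set (C n)) : Set (C (n + 1)) := {w | head w ∈ S}

/-- The stabiliser `Stab(P)` in `G` of the line `P` through `z`. -/
def stabLine {n : ℕ} (G : Subgroup (SU n)) (z : C n) : Subgroup G where
  carrier := {g | ∀ v : C n, std n g v ∈ line z ↔ v ∈ line z}
  one_mem' := fun v => by simp
  mul_mem' := fun {a b} ha hb v => by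
    change std n (a * b : SU n) v ∈ line z ↔ _
    rw [map_mul]; exact (ha _).trans (hb v)
  inv_mem' := fun {a} ha v => by
    have h := ha (std n ((a : SU n)⁻¹) v)
    rw [← Module.End.mul_apply, ← map_mul, mul_inv_cancel, map_one, Module.End.one_apply] at h
    exact h.symm

/-- `Stab(z)`, as a subgroup of `Stab(P)`. -/
def stabPoint {n : ℕ} (G : Subgroup (SU n)) (z : C n) : Subgroup (stabLine G z) :=
  (isotropy G (std n) z).subgroupOf (stabLine G z)

instance stabPoint_normal {n : ℕ} (G : Subgroup (SU n)) (z : C n) :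
    (stabPoint G z).Normal where
  conj_mem := by
    rintro ⟨h, hh⟩ hz ⟨g, hg⟩
    have hz' : std n h z = z := hz
    have h0 : std n g (std n ((g : SU n)⁻¹) z) = z := by
      rw [← Module.End.mul_apply, ← map_mul, mul_inv_cancel, map_one, Module.End.one_apply]
    have h1 : std n ((g : SU n)⁻¹) z ∈ line z := by
      rw [← hg, h0]; exact Submodule.mem_span_singleton_self z
    obtain ⟨c, hc⟩ := Submodule.mem_span_singleton.1 h1
    change std n ((g : SU n) * h * (g : SU n)⁻¹) z = z
    rw [map_mul, map_mul, Module.End.mul_apply, Module.End.mul_apply, ← hc, map_smul, hz', hc, h0]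

/-- The group `C_k = Stab(P) / Stab(z)`. -/
abbrev Ck {n : ℕ} (G : Subgroup (SU n)) (z : C n) : Type := stabLine G z ⧸ stabPoint G z

/-- The embedding `(Φ ⊕ Id)⁻¹ : ℂ² → P × ℂ ⊂ ℂ^n × ℂ`, for an identification `Φ : P → ℂ`. -/
def embed {n : ℕ} {z : C n} (Φ : line z ≃ₗᵢ[ℂ] ℂ) (x : C 2) : C (n + 1) :=
  pair (Φ.symm (x 0) : C n) (x 1)

/-- `Ľ = L ∩ (P × ℂ)`, seen in `ℂ²` through `Φ ⊕ Id`. -/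
def slice {n : ℕ} {z : C n} (Φ : line z ≃ₗᵢ[ℂ] ℂ) (L : Set (C (n + 1))) : Set (C 2) :=
  {x | embed Φ x ∈ L}

theorem embed_image_slice {n : ℕ} {z : C n} (Φ : line z ≃ₗᵢ[ℂ] ℂ) (L : Set (C (n + 1))) :
    embed Φ '' slice Φ L = L ∩ timesC (line z : Set (C n)) := by
  ext w
  constructor
  · rintro ⟨x, hx, rfl⟩
    exact ⟨hx, by simp [timesC, embed]⟩
  · rintro ⟨hw, hP⟩
    have hP' : head w ∈ line z := hP
    have key : embed Φ (WithLp.toLp 2 ![Φ ⟨head w, hP'⟩, w (Fin.last n)]) = w := by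
      simp [embed]
    exact ⟨_, by change embed Φ _ ∈ L; rwa [key], key⟩

/-- The orbit `G · Ľ` of a subset `Ľ` of `ℂ² ≅ P × ℂ`. -/
def orbitOf {n : ℕ} (G : Subgroup (SU n)) {z : C n} (Φ : line z ≃ₗᵢ[ℂ] ℂ) (S : Set (C 2)) :
    Set (C (n + 1)) :=
  {w | ∃ g : G, ∃ x ∈ S, w = ext n g (embed Φ x)}

/-- `C_k`-invariance of a subset of `ℂ² ≅ P × ℂ`; the class of `g ∈ Stab(P)` in `C_k` acts on
`P × ℂ` as `g`. -/
def IsCkInvariant {n : ℕ} (G : Subgroup (SU n)) {z : C n} (Φ : line z ≃ₗᵢ[ℂ] ℂ)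
    (S : Set (C 2)) : Prop :=
  ∀ g : stabLine G z, ∀ x ∈ S, ext n (g : G) (embed Φ x) ∈ embed Φ '' S

/-! ### The correspondence for submanifolds regarded as subsets -/

/-- The `G`-invariant cohomogeneity-two Lagrangians `L ⊂ Z × ℂ ⊂ ℂ^{n+1}`, as subsets, which are
the image of an immersion with the properties `E` and `Q`. -/
def leftSets {n : ℕ} (G : Subgroup (SU n)) (Z : Set (C n))
    (E Q : LagrangianImmersion (n + 1) → Prop) : Set (Set (C (n + 1))) :=
  {L | (∃ F : LagrangianImmersion (n + 1), E F ∧ Q F ∧ Set.range F.toFun = L) ∧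
    L ⊆ timesC Z ∧ IsInvariant G (ext n) L ∧ IsCohomogeneity G (ext n) L (n + 1) 2}

/-- The `C_k`-invariant Lagrangian surfaces `Ľ ⊂ ℂ²`, as subsets, which are the image of an
immersion with the properties `E` and `R`. -/
def rightSets {n : ℕ} (G : Subgroup (SU n)) {z : C n} (Φ : line z ≃ₗᵢ[ℂ] ℂ)
    (E R : LagrangianImmersion 2 → Prop) : Set (Set (C 2)) :=
  {S | (∃ f : LagrangianImmersion 2, E f ∧ R f ∧ Set.range f.toFun = S) ∧ IsCkInvariant G Φ S}

/-- `L ↦ L ∩ (P × ℂ)` and `Ľ ↦ G · Ľ` are mutually inverse bijections between the two sets. -/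
def SetCorrespondence {n : ℕ} (G : Subgroup (SU n)) {z : C n} (Φ : line z ≃ₗᵢ[ℂ] ℂ)
    (A : Set (Set (C (n + 1)))) (B : Set (Set (C 2))) : Prop :=
  Set.BijOn (slice Φ) A B ∧ Set.BijOn (orbitOf G Φ) B A ∧
    Set.InvOn (orbitOf G Φ) (slice Φ) A B

/-- The immersion is an embedding, i.e. its image is an embedded submanifold. -/
def IsEmbedded {N : ℕ} (F : LagrangianImmersion N) : Prop := Topology.IsEmbedding F.toFun

/-! ### The correspondence for immersed submanifolds regarded as immersions -/

/-- A `G`-invariant immersed Lagrangian in `ℂ^{n+1}`, as a `G`-equivariant immersion; the isotropy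
group of a point of the submanifold is the one of its position in `ℂ^{n+1}`. -/
structure GImmersion {n : ℕ} (G : Subgroup (SU n)) extends LagrangianImmersion (n + 1) where
  [action : MulAction G carrier]
  [continuous_action : ContinuousSMul G carrier]
  equivariant : ∀ (g : G) (p : carrier), toFun (g • p) = ext n g (toFun p)
  isotropy_eq : ∀ (g : G) (p : carrier), ext n g (toFun p) = toFun p → g • p = p

attribute [instance] GImmersion.action GImmersion.continuous_action

/-- A `C_k`-invariant immersed Lagrangian in `ℂ² ≅ P × ℂ`, as a `C_k`-equivariant immersion. -/
structure CkImmersion {n : ℕ} (G : Subgroup (SU n)) {z : C n} (Φ : line z ≃ₗᵢ[ℂ] ℂ)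
    extends LagrangianImmersion 2 where
  [action : MulAction (Ck G z) carrier]
  [continuous_action : ContinuousConstSMul (Ck G z) carrier]
  equivariant : ∀ (g : stabLine G z) (x : carrier),
    embed Φ (toFun ((g : Ck G z) • x)) = ext n (g : G) (embed Φ (toFun x))

attribute [instance] CkImmersion.action CkImmersion.continuous_action

/-- Two immersed submanifolds are the same: they differ by an equivariant reparametrisation. -/
def GImmersion.Equivalent {n : ℕ} {G : Subgroup (SU n)} (F F' : GImmersion G) : Prop :=
  ∃ φ : Diffeomorph (𝓡 (n + 1)) (𝓡 (n + 1)) F.carrier F'.carrier ∞,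
    (∀ p, F'.toFun (φ p) = F.toFun p) ∧ ∀ (g : G) p, φ (g • p) = g • φ p

/-- Two immersed submanifolds are the same: they differ by an equivariant reparametrisation. -/
def CkImmersion.Equivalent {n : ℕ} {G : Subgroup (SU n)} {z : C n} {Φ : line z ≃ₗᵢ[ℂ] ℂ}
    (f f' : CkImmersion G Φ) : Prop :=
  ∃ φ : Diffeomorph (𝓡 2) (𝓡 2) f.carrier f'.carrier ∞,
    (∀ x, f'.toFun (φ x) = f.toFun x) ∧ ∀ (c : Ck G z) x, φ (c • x) = c • φ x

/-- `f` is the intersection of the immersed submanifold `F` with `P × ℂ`: through `Φ ⊕ Id` it is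
the restriction of `F` to the submanifold `F⁻¹(P × ℂ)`, with the action of
`C_k = Stab(P) / Stab(z)` induced by the action of `Stab(P)`. -/
def IsSliceOf {n : ℕ} {G : Subgroup (SU n)} {z : C n} {Φ : line z ≃ₗᵢ[ℂ] ℂ}
    (f : CkImmersion G Φ) (F : GImmersion G) : Prop :=
  ∃ ι : f.carrier → F.carrier,
    ContMDiff (𝓡 2) (𝓡 (n + 1)) ∞ ι ∧ Topology.IsEmbedding ι ∧
    Set.range ι = F.toFun ⁻¹' timesC (line z : Set (C n)) ∧
    (∀ x, F.toFun (ι x) = embed Φ (f.toFun x)) ∧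
    ∀ (g : stabLine G z) x, ι ((g : Ck G z) • x) = (g : G) • ι x

/-- Intersection with `P × ℂ` is a 1-1 correspondence, up to reparametrisation, between the
equivariant immersed Lagrangians in the classes `A` and `B`, and the inverse correspondence is
given by taking the `G`-orbit. -/
def ImmersedCorrespondence {n : ℕ} {G : Subgroup (SU n)} {z : C n} {Φ : line z ≃ₗᵢ[ℂ] ℂ}
    (A : Set (GImmersion G)) (B : Set (CkImmersion G Φ)) : Prop :=
  (∀ F ∈ A, ∃ f ∈ B, IsSliceOf f F) ∧
  (∀ f ∈ B, ∃ F ∈ A, IsSliceOf f F) ∧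
  (∀ F ∈ A, ∀ F' ∈ A, ∀ f ∈ B, ∀ f' ∈ B, IsSliceOf f F → IsSliceOf f' F' →
    (F.Equivalent F' ↔ f.Equivalent f')) ∧
  (∀ F ∈ A, ∀ f ∈ B, IsSliceOf f F →
    Set.range f.toFun = slice Φ (Set.range F.toFun) ∧
    Set.range F.toFun = orbitOf G Φ (Set.range f.toFun))

/-- The `G`-equivariant immersed cohomogeneity-two Lagrangians in `Z × ℂ` with property `Q`. -/
def leftImmersions {n : ℕ} (G : Subgroup (SU n)) (Z : Set (C n))
    (Q : LagrangianImmersion (n + 1) → Prop) : Set (GImmersion G) :=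
  {F | Q F.toLagrangianImmersion ∧ Set.range F.toFun ⊆ timesC Z ∧
    IsCohomogeneity G (ext n) (Set.range F.toFun) (n + 1) 2}

/-- The `C_k`-equivariant immersed Lagrangian surfaces in `ℂ²` with property `R`. -/
def rightImmersions {n : ℕ} (G : Subgroup (SU n)) {z : C n} (Φ : line z ≃ₗᵢ[ℂ] ℂ)
    (R : LagrangianImmersion 2 → Prop) : Set (CkImmersion G Φ) :=
  {f | R f.toLagrangianImmersion}

/-- The full 1-1 correspondence between Lagrangians in `Z × ℂ` with property `Q` and Lagrangian
surfaces in `ℂ²` with property `R`: for embedded submanifolds, for immersed submanifolds regarded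
as subsets, and for immersed submanifolds regarded as equivariant immersions. -/
def Correspondence {n : ℕ} (G : Subgroup (SU n)) (Z : Set (C n)) {z : C n}
    (Φ : line z ≃ₗᵢ[ℂ] ℂ) (Q : LagrangianImmersion (n + 1) → Prop)
    (R : LagrangianImmersion 2 → Prop) : Prop :=
  SetCorrespondence G Φ (leftSets G Z IsEmbedded Q) (rightSets G Φ IsEmbedded R) ∧
  SetCorrespondence G Φ (leftSets G Z (fun _ => True) Q) (rightSets G Φ (fun _ => True) R) ∧
  ImmersedCorrespondence (leftImmersions G Z Q) (rightImmersions G Φ R)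

end CohomTwo

end

noncomputable section

namespace CohomTwo

open Filter Topology

/-! ### Compact subgroups of SU(n): Lie algebra, exponential map, isotropic orbits. -/

section

/-! ### Hermitian linear algebra -/

/-! Write n = k + 1, so that m = k + 2. Everything rests on one fact (`Reg.exists_gop_smul`): if p
is a unit zero of μ whose orbit has dimension k, then μ⁻¹(0) = G · ℂp. The cohomogeneity-one
Lagrangian supplies such a p, and since μ⁻¹(0) is a cone, Z is all of it. For the fact, take z in
μ⁻¹(0), maximise |⟨gp, z⟩| over G, and let q be the maximiser rotated so that ⟨q, z⟩ = |w| ≥ 0. The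
orbit of q is isotropic and complex orthogonal to q, so the first variation leaves z = |w| q + i Yq
with Y in 𝔤. The equation ⟨Yz, z⟩ = 0 then turns the second variation along Y into |w| |Yq|², which
has the wrong sign for a maximum unless Yq = 0 or w = 0; in the latter case the first variation at
iq gives Yq = 0. The same computation near p (`Reg.eventually_mem_line`) shows that μ⁻¹(0) meets the
normal space of the orbit only in ℂp.

Hence G moves every point of Z × ℂ into P × ℂ. An element that moves a point of P ∖ 0 into P
stabilises P, and since det g = 1 it acts on P by a root of unity of order dividing 2(k + 1)
(`Reg.pow_eq_one`). So C_k is finite and acts freely away from z₁ = 0. Cohomogeneity two excludes z₁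
= 0 unless k = 0, where SU(1) is trivial.

For the angles, a Lagrangian L in μ⁻¹(0) × ℂ has 𝔤z in its tangent planes (`pair_mem_tangentPlane`),
so along P × ℂ the tangent plane is 𝔤z ⊕ TĽ. At z = z₁p one has 𝔤z = z₁𝔤p, and each of the k orbit
directions contributes arg z₁: θ_L = θ_Ľ + (m - 2) arg z₁ + const. The constant is removed by
rotating p (`Reg.exists_normalised`), and this rotation determines Φ. The curvature equations follow
from the angle equations (`LagrangianImmersion.meanCurvature_eq`), so translators and special
Lagrangians are the cases s = 1 and s = 0 of the single condition θ_L = -s Im z_m, treated together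
through `AnglePair`.

For the smooth structures, the slice is cut out by the inverse function theorem (`hasChart_slice`).
The orbit is realised as a subspace of ℂ^m × Q with Q = Ľ / C_k (`OrbitData`). Charts are compatible
because they are all read through one immersion into Euclidean space. -/

theorem kahlerForm_eq {N : ℕ} (v w : C N) : kahlerForm v w = (inner ℂ v w).im := by
  simp only [kahlerForm, PiLp.inner_apply, RCLike.inner_apply, Complex.im_sum, Complex.mul_im,
    Complex.conj_re, Complex.conj_im]
  exact Finset.sum_congr rfl fun i _ => by ring

theorem real_inner_eq {N : ℕ} (v w : C N) : inner ℝ v w = (inner ℂ v w).re := by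
  simp [PiLp.inner_apply, Complex.inner]

/-! ### Operators of the group and of its Lie algebra -/

/-- The operator of a group element. -/
def gop {n : ℕ} (g : SU n) : C n →L[ℂ] C n := Matrix.toEuclideanCLM (𝕜 := ℂ) g.1

theorem std_eq {n : ℕ} (g : SU n) (z : C n) : std n g z = gop g z := rfl

@[simp] theorem gop_one {n : ℕ} : gop (1 : SU n) = 1 := map_one _

theorem gop_mul {n : ℕ} (g h : SU n) : gop (g * h) = gop g * gop h := map_mul _ _ _

theorem star_gop {n : ℕ} (g : SU n) : star (gop g) = gop g⁻¹ := by
  rw [gop, gop, ← map_star]; rfl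

theorem gop_mem_unitary {n : ℕ} (g : SU n) : gop g ∈ unitary (C n →L[ℂ] C n) := by
  rw [Unitary.mem_iff, star_gop, ← gop_mul, ← gop_mul]
  simp

theorem inner_gop {n : ℕ} (g : SU n) (v w : C n) : inner ℂ (gop g v) (gop g w) = inner ℂ v w := by
  rw [← ContinuousLinearMap.adjoint_inner_right, ← ContinuousLinearMap.star_eq_adjoint, star_gop,
    ← mul_apply_eq_comp, ← gop_mul]
  simp

theorem norm_gop {n : ℕ} (g : SU n) (v : C n) : ‖gop g v‖ = ‖v‖ := by
  have h := inner_gop g v v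
  rw [inner_self_eq_norm_sq_to_K, inner_self_eq_norm_sq_to_K] at h
  have h' : ‖gop g v‖ ^ 2 = ‖v‖ ^ 2 := by exact_mod_cast h
  exact (sq_eq_sq₀ (norm_nonneg _) (norm_nonneg _)).1 h'

theorem gop_inv_apply {n : ℕ} (g : SU n) (v : C n) : gop g⁻¹ (gop g v) = v := by
  rw [← mul_apply_eq_comp, ← gop_mul]; simp

theorem gop_apply_inv {n : ℕ} (g : SU n) (v : C n) : gop g (gop g⁻¹ v) = v := by
  rw [← mul_apply_eq_comp, ← gop_mul]; simp

theorem inner_gop_left {n : ℕ} (g : SU n) (v w : C n) :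
    inner ℂ (gop g v) w = inner ℂ v (gop g⁻¹ w) := by
  conv_lhs => rw [← gop_apply_inv g w]
  rw [inner_gop]

/-- The operator of a matrix. -/
def op {n : ℕ} : Mat n →ₗ[ℝ] (C n →L[ℂ] C n) where
  toFun X := Matrix.toEuclideanCLM (𝕜 := ℂ) (Matrix.of fun i j => X (i, j))
  map_add' X Y := by rw [← map_add]; rfl
  map_smul' c X := by
    have : (Matrix.of fun i j => (c • X) (i, j)) = (c : ℂ) • Matrix.of fun i j => X (i, j) := by
      ext i j; simp
    rw [this, map_smul]; rfl

theorem op_apply {n : ℕ} (X : Mat n) (v : C n) (i : Fin n) : op X v i = ∑ j, X (i, j) * v j := rfl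

theorem gop_apply {n : ℕ} (g : SU n) (v : C n) (i : Fin n) : gop g v i = ∑ j, g.1 i j * v j := rfl

/-- The elementary operator `e_i e_j^*`. -/
def elemOp {n : ℕ} (i j : Fin n) : C n →L[ℂ] C n :=
  Matrix.toEuclideanCLM (𝕜 := ℂ) (Matrix.single i j 1)

theorem toEuclideanCLM_eq_sum {n : ℕ} (A : Matrix (Fin n) (Fin n) ℂ) :
    Matrix.toEuclideanCLM (𝕜 := ℂ) A = ∑ i, ∑ j, A i j • elemOp i j := by
  conv_lhs => rw [Matrix.matrix_eq_sum_single A]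
  simp only [map_sum, elemOp, ← map_smul, Matrix.smul_single, smul_eq_mul, mul_one]

theorem continuous_gop {n : ℕ} : Continuous (gop (n := n)) := by
  have h : gop (n := n) = fun g => ∑ i, ∑ j, g.1 i j • elemOp i j :=
    funext fun g => toEuclideanCLM_eq_sum g.1
  rw [h]
  refine continuous_finsetSum _ fun i _ => continuous_finsetSum _ fun j _ => ?_
  have h : Continuous fun g : SU n => g.1 i j :=
    (continuous_subtype_val (p := fun A : Matrix (Fin n) (Fin n) ℂ =>
      A ∈ Matrix.specialUnitaryGroup (Fin n) ℂ)).matrix_elem i j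
  exact h.smul (continuous_const (y := elemOp i j))

variable {n : ℕ} {G : Subgroup (SU n)}

theorem hasDerivAt_gop {γ : ℝ → SU n} {X : Mat n} {t : ℝ}
    (h : ∀ i j, HasDerivAt (fun t => (γ t).1 i j) (X (i, j)) t) :
    HasDerivAt (fun t => gop (γ t)) (op X) t := by
  have h1 : op X = ∑ i, ∑ j, X (i, j) • elemOp i j := toEuclideanCLM_eq_sum _
  rw [h1]
  simp only [gop, fun s => toEuclideanCLM_eq_sum (γ s).1]
  exact HasDerivAt.fun_sum fun i _ => HasDerivAt.fun_sum fun j _ => by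
    exact HasDerivAt.smul_const (h i j) (elemOp i j)

/-- A Lie algebra element is the velocity of a curve of operators. -/
theorem exists_curve {X : Mat n} (hX : X ∈ lieAlg G) :
    ∃ γ : ℝ → SU n, (∀ t, γ t ∈ G) ∧ γ 0 = 1 ∧ HasDerivAt (fun t => gop (γ t)) (op X) 0 := by
  obtain ⟨γ, h1, h2, h3⟩ := hX
  exact ⟨γ, h1, h2, hasDerivAt_gop h3⟩

theorem hasDerivAt_apply {f : ℝ → C n →L[ℂ] C n} {f' : C n →L[ℂ] C n} {t : ℝ}
    (h : HasDerivAt f f' t) (v : C n) : HasDerivAt (fun t => f t v) (f' v) t :=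
  ((ContinuousLinearMap.apply ℂ (C n) v).restrictScalars ℝ).hasFDerivAt.comp_hasDerivAt t h

theorem inner_op_left {X : Mat n} (hX : X ∈ lieAlg G) (v w : C n) :
    inner ℂ (op X v) w = -inner ℂ v (op X w) := by
  obtain ⟨γ, -, h0, h⟩ := exists_curve hX
  have hv : HasDerivAt (fun t => gop (γ t) v) (op X v) 0 :=
    hasDerivAt_apply h v
  have hw : HasDerivAt (fun t => gop (γ t) w) (op X w) 0 :=
    hasDerivAt_apply h w
  have h1 := hv.inner ℂ hw
  simp only [inner_gop] at h1
  have h2 := h1.unique (hasDerivAt_const 0 (inner ℂ v w))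
  simp only [h0, gop_one, one_apply_eq_self] at h2
  linear_combination h2

theorem star_op {X : Mat n} (hX : X ∈ lieAlg G) : star (op X) = -op X := by
  rw [ContinuousLinearMap.star_eq_adjoint, eq_comm, ContinuousLinearMap.eq_adjoint_iff]
  intro v w
  rw [neg_apply, inner_neg_left, inner_op_left hX, neg_neg]

/-- Telescoping; contractions keep all the other factors bounded by 1. It turns a first-order error
at time 1/k into a small error after k steps. -/
theorem norm_pow_sub_pow_le {A : Type*} [NormedRing A] {a b : A} (ha : ‖a‖ ≤ 1)
    (hb : ‖b‖ ≤ 1) (k : ℕ) : ‖a ^ (k + 1) - b ^ (k + 1)‖ ≤ (k + 1) * ‖a - b‖ := by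
  induction k with
  | zero => simp
  | succ k ih =>
    have e : a ^ (k + 1 + 1) - b ^ (k + 1 + 1) =
        a ^ (k + 1) * (a - b) + (a ^ (k + 1) - b ^ (k + 1)) * b := by
      rw [pow_succ a (k + 1), pow_succ b (k + 1)]; noncomm_ring
    rw [e]
    have h1 : ‖a ^ (k + 1)‖ ≤ 1 :=
      (norm_pow_le' a k.succ_pos).trans (pow_le_one₀ (norm_nonneg _) ha)
    calc _ ≤ ‖a ^ (k + 1)‖ * ‖a - b‖ + ‖a ^ (k + 1) - b ^ (k + 1)‖ * ‖b‖ :=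
          (norm_add_le _ _).trans (add_le_add (norm_mul_le _ _) (norm_mul_le _ _))
      _ ≤ 1 * ‖a - b‖ + ((k + 1) * ‖a - b‖) * 1 := by gcongr
      _ = _ := by push_cast; ring

theorem norm_le_one_of_mem_unitary {u : C n →L[ℂ] C n} (hu : u ∈ unitary (C n →L[ℂ] C n)) :
    ‖u‖ ≤ 1 := by
  refine u.opNorm_le_bound zero_le_one fun v => ?_
  have h : inner ℂ (u v) (u v) = inner ℂ v v := by
    rw [← ContinuousLinearMap.adjoint_inner_right, ← ContinuousLinearMap.star_eq_adjoint,
      ← mul_apply_eq_comp, (Unitary.mem_iff.1 hu).1, one_apply_eq_self]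
  rw [inner_self_eq_norm_sq_to_K, inner_self_eq_norm_sq_to_K] at h
  have h' : ‖u v‖ ^ 2 = ‖v‖ ^ 2 := by exact_mod_cast h
  rw [one_mul]
  exact ((sq_eq_sq₀ (norm_nonneg _) (norm_nonneg _)).1 h').le

theorem isCompact_gop_image (hG : IsCompact (G : Set (SU n))) :
    IsCompact (gop '' (G : Set (SU n))) := hG.image continuous_gop

/-- The exponential of a matrix, as an operator. -/
def expOp (X : Mat n) : C n →L[ℂ] C n := NormedSpace.exp (op X)

@[simp] theorem expOp_zero : expOp (0 : Mat n) = 1 := by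
  rw [expOp, map_zero, NormedSpace.exp_zero]

theorem hasDerivAt_expOp_smul (X : Mat n) (t : ℝ) :
    HasDerivAt (fun t : ℝ => expOp (t • X)) (expOp (t • X) * op X) t := by
  have h := hasDerivAt_exp_smul_const (𝕂 := ℝ) (op X) t
  have e : (fun t : ℝ => expOp (t • X)) = fun t : ℝ => NormedSpace.exp (t • op X) :=
    funext fun s => by rw [expOp, map_smul]
  rw [e, expOp, map_smul]
  exact h

theorem hasDerivAt_expOp_zero (X : Mat n) : HasDerivAt (fun t : ℝ => expOp (t • X)) (op X) 0 := by
  have h := hasDerivAt_expOp_smul X 0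
  rwa [zero_smul, expOp_zero, one_mul] at h

theorem exp_op_mem_unitary {X : Mat n} (hX : X ∈ lieAlg G) :
    expOp X ∈ unitary (C n →L[ℂ] C n) := by
  let _ : NormedAlgebra ℚ (C n →L[ℂ] C n) := NormedAlgebra.restrictScalars ℚ ℂ _
  exact NormedSpace.exp_mem_unitary_of_mem_skewAdjoint (skewAdjoint.mem_iff.2 (star_op hX))

/-- The exponential of the Lie algebra of a closed group lies in the group. -/
theorem exists_gop_eq_exp (hG : IsCompact (G : Set (SU n))) {X : Mat n} (hX : X ∈ lieAlg G) :
    ∃ g ∈ G, gop g = expOp X := by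
  obtain ⟨γ, hγ, h0, h⟩ := exists_curve hX
  have hclosed := (isCompact_gop_image hG).isClosed
  -- The curve is differentiable only at 0, so exp X is reached as the limit of γ(1/k)^k, and
  -- closedness of G keeps the limit in the group.
  suffices Tendsto (fun k : ℕ => gop (γ (1 / ((k : ℝ) + 1)) ^ (k + 1))) atTop (𝓝 (expOp X)) by
    have := hclosed.mem_of_tendsto this (Eventually.of_forall fun k =>
      Set.mem_image_of_mem _ (G.pow_mem (hγ _) _))
    obtain ⟨g, hg, hgX⟩ := this
    exact ⟨g, hg, hgX⟩
  have hd := h.sub (hasDerivAt_expOp_zero X)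
  rw [sub_self] at hd
  have hs : Tendsto (fun k : ℕ => (1 / ((k : ℝ) + 1))) atTop (𝓝[≠] 0) := by
    refine tendsto_nhdsWithin_iff.2 ⟨tendsto_one_div_add_atTop_nhds_zero_nat, ?_⟩
    exact Eventually.of_forall fun k => by
      simp only [Set.mem_compl_iff, Set.mem_singleton_iff]; positivity
  have hsl := (hd.tendsto_slope.comp hs).norm
  rw [norm_zero] at hsl
  rw [tendsto_iff_norm_sub_tendsto_zero]
  refine squeeze_zero (fun _ => norm_nonneg _) (fun k => ?_) hsl
  have hk : (0 : ℝ) < (k : ℝ) + 1 := by positivity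
  have hpow : gop (γ (1 / ((k : ℝ) + 1)) ^ (k + 1)) = gop (γ (1 / ((k : ℝ) + 1))) ^ (k + 1) :=
    map_pow (Matrix.toEuclideanCLM (𝕜 := ℂ) (n := Fin n)) _ _
  have he : expOp X = expOp ((1 / ((k : ℝ) + 1)) • X) ^ (k + 1) := by
    let _ : NormedAlgebra ℚ (C n →L[ℂ] C n) := NormedAlgebra.restrictScalars ℚ ℂ _
    rw [expOp, expOp, ← NormedSpace.exp_nsmul, ← map_nsmul, ← Nat.cast_smul_eq_nsmul ℝ, smul_smul]
    push_cast
    rw [mul_one_div_cancel hk.ne', one_smul]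
  have hu1 : ‖gop (γ (1 / ((k : ℝ) + 1)))‖ ≤ 1 := norm_le_one_of_mem_unitary (gop_mem_unitary _)
  have hu2 : ‖expOp ((1 / ((k : ℝ) + 1)) • X)‖ ≤ 1 :=
    norm_le_one_of_mem_unitary (exp_op_mem_unitary ((lieAlg G).smul_mem _ hX))
  rw [hpow, he]
  -- The bound (k + 1) ‖a - b‖ is the norm of a difference quotient at 0 of γ(t) - exp(tX), whose
  -- derivative there vanishes.
  refine (norm_pow_sub_pow_le hu1 hu2 k).trans (le_of_eq ?_)
  simp only [Function.comp, slope, vsub_eq_sub, sub_zero, h0, gop_one, Pi.sub_apply, zero_smul,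
    expOp_zero, sub_self, norm_smul, norm_inv, Real.norm_eq_abs]
  rw [abs_of_pos (by positivity : (0 : ℝ) < 1 / ((k : ℝ) + 1)), one_div, inv_inv]

theorem conj_mem_lieAlg {g : SU n} (hg : g ∈ G) {X : Mat n} (hX : X ∈ lieAlg G) :
    ∃ Y ∈ lieAlg G, op Y = gop g * op X * gop g⁻¹ := by
  obtain ⟨γ, hγ, h0, h⟩ := hX
  refine ⟨WithLp.toLp 2 fun p => (g.1 * (Matrix.of fun i j => X (i, j)) * (g⁻¹).1) p.1 p.2,
    ⟨fun t => g * γ t * g⁻¹, fun t => G.mul_mem (G.mul_mem hg (hγ t)) (G.inv_mem hg),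
      by simp [h0], fun i j => ?_⟩, ?_⟩
  · simp only [Submonoid.coe_mul, Matrix.mul_apply]
    exact HasDerivAt.fun_sum fun k _ => (HasDerivAt.fun_sum fun l _ =>
      (h l k).const_mul _).mul_const _
  · change Matrix.toEuclideanCLM (𝕜 := ℂ) (g.1 * (Matrix.of fun i j => X (i, j)) * (g⁻¹).1) = _
    rw [map_mul, map_mul]; rfl

/-! ### The moment map and the tangent spaces of the orbits -/

/-- The map `X ↦ X z` on matrices. -/
def evalOp (z : C n) : Mat n →ₗ[ℝ] C n :=
  ((ContinuousLinearMap.apply ℂ (C n) z).restrictScalars ℝ).toLinearMap ∘ₗ op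

@[simp] theorem evalOp_apply (z : C n) (X : Mat n) : evalOp z X = op X z := rfl

/-- The tangent space `𝔤 z` of the orbit of `z`. -/
def tang (G : Subgroup (SU n)) (z : C n) : Submodule ℝ (C n) := (lieAlg G).map (evalOp z)

theorem op_mem_tang {X : Mat n} (hX : X ∈ lieAlg G) (z : C n) : op X z ∈ tang G z := ⟨X, hX, rfl⟩

/-- The pairing of X with i z z̄ᵀ is -Im ⟨Xz, z⟩, and the real part of ⟨Xz, z⟩ vanishes anyway
because X is skew-Hermitian. -/
theorem momentMap_eq_zero_iff {z : C n} :
    momentMap G z = 0 ↔ ∀ X ∈ lieAlg G, inner ℂ (op X z) z = 0 := by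
  have key : ∀ X ∈ lieAlg G, inner ℝ X (WithLp.toLp 2 fun p : Fin n × Fin n =>
      I * (z p.1 * star (z p.2)) : Mat n) = -(inner ℂ (op X z) z).im := by
    intro X hX
    have e : inner ℂ (op X z) z = ∑ i, ∑ j, star (X (i, j)) * (star (z j) * z i) := by
      simp only [PiLp.inner_apply, RCLike.inner_apply, op_apply, map_sum, map_mul, Finset.mul_sum]
      refine Finset.sum_congr rfl fun i _ => Finset.sum_congr rfl fun j _ => ?_
      simp only [RCLike.star_def]; ring
    rw [e, PiLp.inner_apply, Fintype.sum_prod_type, Complex.im_sum, ← Finset.sum_neg_distrib]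
    refine Finset.sum_congr rfl fun i _ => ?_
    rw [Complex.im_sum, ← Finset.sum_neg_distrib]
    refine Finset.sum_congr rfl fun j _ => ?_
    simp only [Complex.inner, Complex.mul_re, Complex.mul_im, Complex.I_re, Complex.I_im,
      RCLike.star_def, Complex.conj_re, Complex.conj_im]
    ring
  have h1 : momentMap G z = 0 ↔ (lieAlg G).starProjection (WithLp.toLp 2 fun p : Fin n × Fin n =>
      I * (z p.1 * star (z p.2)) : Mat n) = 0 := by
    rw [momentMap, smul_eq_zero]; norm_num
  rw [h1, Submodule.starProjection_apply_eq_zero_iff, Submodule.mem_orthogonal]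
  refine forall₂_congr fun X hX => ?_
  rw [key X hX, neg_eq_zero]
  constructor
  · intro h
    refine Complex.ext ?_ h
    have := congrArg Complex.re (inner_op_left hX z z)
    rw [← inner_conj_symm z (op X z), Complex.neg_re, Complex.conj_re] at this
    simp only [Complex.zero_re]; linarith
  · intro h; rw [h]; rfl

/-- `z` is a zero of the moment map. -/
def MZero (G : Subgroup (SU n)) (z : C n) : Prop := ∀ X ∈ lieAlg G, inner ℂ (op X z) z = 0

theorem MZero.smul {z : C n} (hz : MZero G z) (c : ℂ) : MZero G (c • z) := fun X hX => by
  rw [map_smul, inner_smul_left, inner_smul_right, hz X hX]; simp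

theorem MZero.gop {z : C n} (hz : MZero G z) {g : SU n} (hg : g ∈ G) : MZero G (gop g z) := by
  intro X hX
  obtain ⟨Y, hY, e⟩ := conj_mem_lieAlg (G.inv_mem hg) hX
  have := hz Y hY
  rw [e, mul_apply_eq_comp, mul_apply_eq_comp, inner_gop_left, inv_inv] at this
  exact this

theorem tang_smul {c : ℂ} {z : C n} (v : C n) (hv : v ∈ tang G (c • z)) :
    ∃ w ∈ tang G z, v = c • w := by
  obtain ⟨X, hX, rfl⟩ := hv
  exact ⟨_, op_mem_tang hX z, by simp⟩

theorem smul_mem_tang {c : ℂ} {z v : C n} (hv : v ∈ tang G z) : c • v ∈ tang G (c • z) := by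
  obtain ⟨X, hX, rfl⟩ := hv
  exact ⟨X, hX, by simp⟩

theorem gop_mem_tang {g : SU n} (hg : g ∈ G) {z v : C n} (hv : v ∈ tang G z) :
    gop g v ∈ tang G (gop g z) := by
  obtain ⟨X, hX, rfl⟩ := hv
  obtain ⟨Y, hY, e⟩ := conj_mem_lieAlg hg hX
  refine ⟨Y, hY, ?_⟩
  simp [e, gop_inv_apply]

theorem MZero.inner_tang {z v : C n} (hz : MZero G z) (hv : v ∈ tang G z) : inner ℂ v z = 0 := by
  obtain ⟨X, hX, rfl⟩ := hv
  exact hz X hX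

/-- The orbit of a zero of the moment map is isotropic. -/
theorem MZero.isotropic {z v w : C n} (hz : MZero G z) (hv : v ∈ tang G z) (hw : w ∈ tang G z) :
    (inner ℂ v w).im = 0 := by
  obtain ⟨X, hX, rfl⟩ := hv
  obtain ⟨Y, hY, rfl⟩ := hw
  obtain ⟨γ, hγ, h0, h⟩ := exists_curve hX
  have hz' : HasDerivAt (fun t => CohomTwo.gop (γ t) z) (op X z) 0 :=
    hasDerivAt_apply h z
  have hY' : HasDerivAt (fun t => op Y (CohomTwo.gop (γ t) z)) (op Y (op X z)) 0 :=
    ((op Y).restrictScalars ℝ).hasFDerivAt.comp_hasDerivAt 0 hz'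
  -- Differentiating ⟨Y γz, γz⟩ = 0 gives ⟨Yz, Xz⟩ = ⟨Xz, Yz⟩, so the Hermitian product of two orbit
  -- directions is real.
  have h1 := hY'.inner ℂ hz'
  have h2 := h1.unique ((hasDerivAt_const 0 (0 : ℂ)).congr_of_eventuallyEq
    (Eventually.of_forall fun t => hz.gop (hγ t) Y hY))
  simp only [h0, gop_one, one_apply_eq_self, inner_op_left hY (op X z)] at h2
  have h3 := congrArg Complex.im h2
  rw [← inner_conj_symm (op Y z) (op X z), Complex.add_im, Complex.neg_im, Complex.conj_im,
    Complex.zero_im] at h3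
  simp only [evalOp_apply]
  linarith

/-- Rank and nullity of X ↦ Xz on 𝔤: the kernel is the Lie algebra of the stabiliser. It converts
the isotropy-group definition of cohomogeneity into the dimension of 𝔤z. -/
theorem finrank_lieAlg_eq {z : C n} (hG : IsCompact (G : Set (SU n))) :
    Module.finrank ℝ (lieAlg G) = Module.finrank ℝ (tang G z) +
      Module.finrank ℝ (lieAlg ((isotropy G (std n) z).map G.subtype)) := by
  have h := LinearMap.finrank_range_add_finrank_ker ((evalOp z).domRestrict (lieAlg G))
  rw [LinearMap.range_domRestrict] at h
  rw [← h]
  congr 1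
  have e : (LinearMap.ker ((evalOp z).domRestrict (lieAlg G))).map (lieAlg G).subtype =
      lieAlg ((isotropy G (std n) z).map G.subtype) := by
    ext X
    simp only [Submodule.mem_map, LinearMap.mem_ker, LinearMap.domRestrict_apply, evalOp_apply,
      Submodule.subtype_apply, Subtype.exists, exists_and_left, exists_prop, exists_eq_right_right]
    constructor
    -- If Xz = 0, then exp(tX) lies in G and fixes z, because t ↦ exp(tX)z has derivative exp(tX)Xz
    -- = 0.
    · rintro ⟨h0, hX⟩
      have hcurve : ∀ t : ℝ, ∃ g ∈ G, gop g = expOp (t • X) := fun t =>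
        exists_gop_eq_exp hG ((lieAlg G).smul_mem t hX)
      choose γ hγ hγe using hcurve
      have hval : ∀ (g : SU n) (i j : Fin n), g.1 i j = gop g (EuclideanSpace.single j 1) i := by
        intro g i j; simp [gop_apply]
      refine ⟨γ, fun t => ⟨⟨γ t, hγ t⟩, ?_, rfl⟩, ?_, fun i j => ?_⟩
      · change std n (γ t) z = z
        rw [std_eq, hγe]
        have hd : ∀ s : ℝ, HasDerivAt (fun s : ℝ => expOp (s • X) z) 0 s := by
          intro s
          have := hasDerivAt_apply (hasDerivAt_expOp_smul X s) z
          rwa [mul_apply_eq_comp, h0, map_zero] at this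
        have := is_const_of_deriv_eq_zero (fun s => (hd s).differentiableAt)
          (fun s => (hd s).deriv) t 0
        simpa using this
      · apply Subtype.ext
        refine (Matrix.toEuclideanCLM (𝕜 := ℂ) (n := Fin n)).injective ?_
        change gop _ = gop 1
        rw [hγe]; simp
      · simp only [hval, hγe]
        have h1 := hasDerivAt_apply (hasDerivAt_expOp_zero X) (EuclideanSpace.single j 1)
        have h2 := ((EuclideanSpace.proj i : C n →L[ℂ] ℂ).restrictScalars
          ℝ).hasFDerivAt.comp_hasDerivAt 0 h1
        have e : X (i, j) = op X (EuclideanSpace.single j 1) i := by simp [op_apply]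
        rw [e]
        exact h2
    · rintro ⟨γ, hγ, h0, h⟩
      have hG' : ∀ t, γ t ∈ G ∧ gop (γ t) z = z := fun t => by
        obtain ⟨g, hg, e⟩ := hγ t
        rw [← e]; exact ⟨g.2, hg⟩
      refine ⟨?_, γ, fun t => (hG' t).1, h0, h⟩
      have h1 := hasDerivAt_apply (hasDerivAt_gop h) z
      have h2 := h1.unique ((hasDerivAt_const 0 z).congr_of_eventuallyEq
        (Eventually.of_forall fun t => (hG' t).2))
      exact h2
  rw [← e]
  exact (LinearEquiv.finrank_eq (Submodule.equivMapOfInjective _ (Submodule.injective_subtype _) _))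

end

/-! ### The zero set of the moment map as the orbit of a complex line. -/

section

/-! ### Regular points of the zero set of the moment map -/

variable {k : ℕ} {G : Subgroup (SU (k + 1))}

/-- A unit zero of the moment map whose orbit has dimension `k`. -/
structure Reg (G : Subgroup (SU (k + 1))) (p : C (k + 1)) : Prop where
  norm_eq : ‖p‖ = 1
  mzero : MZero G p
  finrank_tang : Module.finrank ℝ (tang G p) = k

/-- Scaling by a complex number, as a real linear map. -/
def smulMap (N : ℕ) (c : ℂ) : C N →ₗ[ℝ] C N := (LinearMap.lsmul ℂ (C N) c).restrictScalars ℝ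

theorem tang_smul_eq (c : ℂ) (z : C (k + 1)) : tang G (c • z) = (tang G z).map (smulMap _ c) := by
  ext v
  constructor
  · intro hv
    obtain ⟨w, hw, rfl⟩ := tang_smul v hv
    exact ⟨w, hw, rfl⟩
  · rintro ⟨w, hw, rfl⟩
    exact smul_mem_tang hw

theorem finrank_tang_smul {c : ℂ} (hc : c ≠ 0) (z : C (k + 1)) :
    Module.finrank ℝ (tang G (c • z)) = Module.finrank ℝ (tang G z) := by
  rw [tang_smul_eq]
  refine (LinearEquiv.finrank_eq (Submodule.equivMapOfInjective _ ?_ _)).symm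
  exact fun v w h => smul_right_injective (C (k + 1)) hc h

theorem tang_gop_eq {g : SU (k + 1)} (hg : g ∈ G) (z : C (k + 1)) :
    tang G (gop g z) = (tang G z).map ((gop g).restrictScalars ℝ).toLinearMap := by
  ext v
  constructor
  · intro hv
    refine ⟨gop g⁻¹ v, ?_, gop_apply_inv g v⟩
    have := gop_mem_tang (G.inv_mem hg) hv
    rwa [gop_inv_apply] at this
  · rintro ⟨w, hw, rfl⟩
    exact gop_mem_tang hg hw

theorem gop_injective (g : SU (k + 1)) : Function.Injective (gop g) :=
  Function.LeftInverse.injective (gop_inv_apply g)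

theorem finrank_tang_gop {g : SU (k + 1)} (hg : g ∈ G) (z : C (k + 1)) :
    Module.finrank ℝ (tang G (gop g z)) = Module.finrank ℝ (tang G z) := by
  rw [tang_gop_eq hg]
  refine (LinearEquiv.finrank_eq (Submodule.equivMapOfInjective _ ?_ _)).symm
  exact gop_injective g

theorem Reg.smul {p : C (k + 1)} (hp : Reg G p) {c : ℂ} (hc : ‖c‖ = 1) : Reg G (c • p) where
  norm_eq := by rw [norm_smul, hc, hp.norm_eq, one_mul]
  mzero := hp.mzero.smul c
  finrank_tang := by
    rw [finrank_tang_smul (by rintro rfl; simp at hc), hp.finrank_tang]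

theorem Reg.gop {p : C (k + 1)} (hp : Reg G p) {g : SU (k + 1)} (hg : g ∈ G) :
    Reg G (gop g p) where
  norm_eq := by rw [norm_gop, hp.norm_eq]
  mzero := hp.mzero.gop hg
  finrank_tang := by rw [finrank_tang_gop hg, hp.finrank_tang]

/-- A real orthonormal basis of the tangent space of the orbit completes `p` to a unitary basis. -/
theorem Reg.exists_frame {p : C (k + 1)} (hp : Reg G p) : ∃ e : Fin k → C (k + 1),
    (∀ i, e i ∈ tang G p) ∧ Orthonormal ℂ (Fin.snoc e p : Fin (k + 1) → C (k + 1)) := by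
  let b := (stdOrthonormalBasis ℝ (tang G p)).reindex (finCongr hp.finrank_tang)
  refine ⟨fun i => b i, fun i => (b i).2, ?_⟩
  have hb : ∀ i j, inner ℂ (b i : C (k + 1)) (b j : C (k + 1)) = if i = j then 1 else 0 := by
    intro i j
    have h1 : inner ℝ (b i : C (k + 1)) (b j : C (k + 1)) = if i = j then 1 else 0 :=
      orthonormal_iff_ite.1 b.orthonormal i j
    rw [real_inner_eq] at h1
    refine Complex.ext ?_ ?_
    · rw [h1]; split_ifs <;> simp
    · rw [hp.mzero.isotropic (b i).2 (b j).2]; split_ifs <;> simp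
  rw [orthonormal_iff_ite]
  intro i j
  refine Fin.lastCases ?_ (fun i => ?_) i <;> refine Fin.lastCases ?_ (fun j => ?_) j
  · simp [inner_self_eq_norm_sq_to_K, hp.norm_eq]
  · rw [Fin.snoc_last, Fin.snoc_castSucc, ← inner_conj_symm, hp.mzero.inner_tang (b j).2,
      if_neg (Fin.castSucc_lt_last j).ne']; simp
  · rw [Fin.snoc_last, Fin.snoc_castSucc, hp.mzero.inner_tang (b i).2,
      if_neg (Fin.castSucc_lt_last i).ne]
  · rw [Fin.snoc_castSucc, Fin.snoc_castSucc, hb]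
    simp

/-- The vectors orthogonal to the orbit through `p`. -/
theorem Reg.exists_eq_add {p z : C (k + 1)} (hp : Reg G p)
    (hz : ∀ v ∈ tang G p, (inner ℂ v z).re = 0) :
    ∃ u ∈ tang G p, z = inner ℂ p z • p + I • u := by
  obtain ⟨e, he, ho⟩ := hp.exists_frame
  let b := basisOfOrthonormalOfCardEqFinrank ho (by simp)
  have hb : ⇑b = (Fin.snoc e p : Fin (k + 1) → C (k + 1)) :=
    coe_basisOfOrthonormalOfCardEqFinrank ho (by simp)
  let B := b.toOrthonormalBasis (by rw [hb]; exact ho)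
  have hB : ⇑B = (Fin.snoc e p : Fin (k + 1) → C (k + 1)) := by
    rw [Module.Basis.coe_toOrthonormalBasis, hb]
  have hs := B.sum_repr' z
  rw [Fin.sum_univ_castSucc, hB] at hs
  simp only [Fin.snoc_castSucc, Fin.snoc_last] at hs
  refine ⟨∑ i, (inner ℂ (e i) z).im • e i,
    Submodule.sum_mem _ fun i _ => Submodule.smul_mem _ _ (he i), ?_⟩
  refine hs.symm.trans ((add_comm _ _).trans ?_)
  rw [Finset.smul_sum]
  -- The coefficients along the orbit have zero real part, so the normal space of the orbit is ℂp ⊕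
  -- i𝔤p.
  congr 1
  refine Finset.sum_congr rfl fun i _ => ?_
  rw [← Complex.coe_smul, smul_smul]
  congr 1
  refine Complex.ext ?_ ?_
  · simp [hz _ (he i)]
  · simp

/-- Expand ⟨Yz, z⟩ = 0 at z = cp + iYp: the two cross terms add up to i(c + c̄)|Yp|². This identity
fixes the sign of the second variation in `Reg.exists_gop_smul` and supplies the rigidity in
`Reg.eventually_mem_line`. -/
theorem inner_eq_of_mzero {p : C (k + 1)} (hp : MZero G p) {c : ℂ} {Y : Mat (k + 1)}
    (hY : Y ∈ lieAlg G) (hz : MZero G (c • p + I • op Y p)) :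
    inner ℂ (op Y (op Y p)) (op Y p) = -(2 * c.re * ‖op Y p‖ ^ 2 : ℝ) * I := by
  have h := hz Y hY
  have h1 : inner ℂ (op Y (op Y p)) p = -(‖op Y p‖ ^ 2 : ℝ) := by
    rw [inner_op_left hY, inner_self_eq_norm_sq_to_K]; simp
  have h2 : inner ℂ (op Y p) (op Y p) = (‖op Y p‖ ^ 2 : ℝ) := by
    rw [inner_self_eq_norm_sq_to_K]; simp
  have h3 : c + (starRingEnd ℂ) c = (2 * c.re : ℝ) := Complex.add_conj c
  simp only [map_add, map_smul, inner_add_left, inner_add_right, inner_smul_left, inner_smul_right,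
    h1, h2, hp Y hY, Complex.conj_I] at h
  push_cast at *
  linear_combination h - (‖op Y p‖ : ℂ) ^ 2 * I * h3 + inner ℂ (op Y (op Y p)) (op Y p) * Complex.I_sq

/-- A positive second derivative would make the maximum also a local minimum, so f would be constant
near 0, a contradiction. -/
theorem deriv_deriv_nonpos_of_le {f f' : ℝ → ℝ} {f'' : ℝ} (h : ∀ t, HasDerivAt f (f' t) t)
    (h' : HasDerivAt f' f'' 0) (hmax : ∀ t, f t ≤ f 0) : f' 0 = 0 ∧ f'' ≤ 0 := by
  have h0 : f' 0 = 0 := (IsLocalMax.hasDerivAt_eq_zero (Eventually.of_forall hmax) (h 0))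
  refine ⟨h0, ?_⟩
  by_contra! hpos
  have hd : deriv f = f' := funext fun t => (h t).deriv
  have hmin : IsLocalMin f 0 := isLocalMin_of_deriv_deriv_pos (by rw [hd, h'.deriv]; exact hpos)
    (by rw [hd, h0]) (h 0).continuousAt
  have hc : f =ᶠ[𝓝 0] fun _ => f 0 := by
    filter_upwards [hmin] with t ht using le_antisymm (hmax t) ht
  have h2 : deriv f =ᶠ[𝓝 0] fun _ => 0 := by
    have := hc.deriv
    simpa using this
  rw [hd] at h2
  have h3 := h'.unique ((hasDerivAt_const (0 : ℝ) (0 : ℝ)).congr_of_eventuallyEq h2)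
  exact hpos.ne' h3

theorem hasDerivAt_re_inner (X : Mat (k + 1)) (p z : C (k + 1)) (t : ℝ) :
    HasDerivAt (fun t : ℝ => (inner ℂ (expOp (t • X) p) z).re)
      (inner ℂ (expOp (t • X) (op X p)) z).re t := by
  have h1 := hasDerivAt_apply (hasDerivAt_expOp_smul X t) p
  have h2 := h1.inner ℂ (hasDerivAt_const t z)
  have h3 := Complex.reCLM.hasFDerivAt.comp_hasDerivAt t h2
  simp only [inner_zero_right, zero_add, mul_apply_eq_comp] at h3
  exact h3

/-- The zero set of the moment map is the orbit of the complex line through a regular point. -/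
theorem Reg.exists_gop_smul (hG : IsCompact (G : Set (SU (k + 1)))) {p z : C (k + 1)}
    (hp : Reg G p) (hz : MZero G z) : ∃ g ∈ G, ∃ c : ℂ, z = CohomTwo.gop g (c • p) := by
  have hcont : Continuous fun g : SU (k + 1) => ‖inner ℂ (CohomTwo.gop g p) z‖ := by
    have : Continuous fun g : SU (k + 1) => CohomTwo.gop g p :=
      (ContinuousLinearMap.apply ℂ (C (k + 1)) p).continuous.comp continuous_gop
    exact (this.inner continuous_const).norm
  -- The modulus is maximised and not the real part, so the bound holds for every phase α; the phase
  -- i is needed when the maximum is 0.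
  obtain ⟨g, hg, hmax⟩ := hG.exists_isMaxOn ⟨1, G.one_mem⟩ hcont.continuousOn
  have hmax' : ∀ h ∈ G, ‖inner ℂ (CohomTwo.gop h (CohomTwo.gop g p)) z‖ ≤
      ‖inner ℂ (CohomTwo.gop g p) z‖ := by
    intro h hh
    have : h * g ∈ (G : Set (SU (k + 1))) := G.mul_mem hh hg
    have := hmax this
    simpa [gop_mul] using this
  have hexp : ∀ X ∈ lieAlg G, ∀ (t : ℝ) (α : ℂ), ‖α‖ = 1 →
      (inner ℂ (expOp (t • X) (α • CohomTwo.gop g p)) z).re ≤ ‖inner ℂ (CohomTwo.gop g p) z‖ := by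
    intro X hX t α hα
    obtain ⟨h, hh, e⟩ := exists_gop_eq_exp hG ((lieAlg G).smul_mem t hX)
    refine (Complex.re_le_norm _).trans ?_
    rw [← e, map_smul, inner_smul_left, norm_mul, RCLike.norm_conj, hα, one_mul]
    exact hmax' h hh
  set w := inner ℂ (CohomTwo.gop g p) z with hw
  obtain ⟨α, hα, hαw⟩ : ∃ α : ℂ, ‖α‖ = 1 ∧ (starRingEnd ℂ) α * w = ‖w‖ := by
    by_cases h0 : w = 0
    · exact ⟨1, by simp, by simp [h0]⟩
    · refine ⟨w / ‖w‖, by simp [h0], ?_⟩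
      have : (‖w‖ : ℂ) ≠ 0 := by simpa using h0
      rw [map_div₀, Complex.conj_ofReal, div_mul_eq_mul_div, mul_comm, Complex.mul_conj']
      field_simp
  have hq : Reg G (α • CohomTwo.gop g p) := (hp.gop hg).smul hα
  obtain ⟨q, hqdef⟩ : ∃ q, q = α • CohomTwo.gop g p := ⟨_, rfl⟩
  rw [← hqdef] at hq
  have hqz : inner ℂ q z = (‖w‖ : ℂ) := by rw [hqdef, inner_smul_left, ← hw, hαw]
  have hvar : ∀ X ∈ lieAlg G, (inner ℂ (op X q) z).re = 0 ∧ (inner ℂ (op X (op X q)) z).re ≤ 0 := by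
    intro X hX
    have := deriv_deriv_nonpos_of_le (fun t => hasDerivAt_re_inner X q z t)
      (hasDerivAt_re_inner X (op X q) z 0) (fun t => by
        have := hexp X hX t α hα
        rw [← hqdef] at this
        refine this.trans (le_of_eq ?_)
        simp [hqz])
    simpa using this
  obtain ⟨u, ⟨Y, hY, rfl⟩, hzu⟩ := hq.exists_eq_add (z := z)
    (by rintro _ ⟨X, hX, rfl⟩; exact (hvar X hX).1)
  rw [hqz, evalOp_apply] at hzu
  have hYY := inner_eq_of_mzero hq.mzero hY (by rw [← hzu]; exact hz)
  have h2 := (hvar Y hY).2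
  have hYq : op Y q = 0 := by
    -- The part |w| q of z contributes -|w||Yq|² and the part iYq contributes +2|w||Yq|².
    have e1 : inner ℂ (op Y (op Y q)) z = ((‖w‖ * ‖op Y q‖ ^ 2 : ℝ) : ℂ) := by
      conv_lhs => rw [hzu]
      rw [inner_add_right, inner_smul_right, inner_smul_right, hYY, inner_op_left hY,
        inner_self_eq_norm_sq_to_K]
      simp only [Complex.ofReal_re]
      push_cast
      simp only [RCLike.ofReal_eq_complex_ofReal] 
      linear_combination (-2 * (‖w‖ : ℂ) * (‖op Y q‖ : ℂ) ^ 2) * Complex.I_sq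
    rw [e1, Complex.ofReal_re] at h2
    by_contra hne
    have hpos : 0 < ‖op Y q‖ ^ 2 := by positivity
    have hw0 : ‖w‖ = 0 := le_antisymm (by nlinarith) (norm_nonneg _)
    -- When the maximum is 0, z is orthogonal to the whole orbit, and z = iYq. The first variation
    -- at iq along Y is then |Yq|².
    have hall : ∀ t : ℝ, (inner ℂ (expOp (t • Y) (I • q)) z).re ≤ 0 := fun t => by
      have := hexp Y hY t (I * α) (by simp [hα])
      rwa [hw0, mul_smul, ← hqdef] at this
    have := (deriv_deriv_nonpos_of_le (fun t => hasDerivAt_re_inner Y (I • q) z t)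
      (hasDerivAt_re_inner Y (op Y (I • q)) z 0) (fun t => (hall t).trans (by
        simp [hqz, hw0]))).1
    rw [zero_smul, expOp_zero, one_apply_eq_self, map_smul, inner_smul_left, hzu, hw0,
      Complex.ofReal_zero, zero_smul, zero_add, inner_smul_right, inner_self_eq_norm_sq_to_K] at this
    simp [← Complex.ofReal_pow] at this
    exact hne this
  refine ⟨g, hg, ‖w‖ * α, ?_⟩
  rw [hzu, hYq, smul_zero, add_zero, map_smul, mul_smul, hqdef]

/-- A continuous real linear choice of `Y ∈ 𝔤` with `Y p` a given tangent vector. -/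
theorem exists_section (p : C (k + 1)) : ∃ σ : tang G p →L[ℝ] Mat (k + 1),
    (∀ v, σ v ∈ lieAlg G) ∧ ∀ v, op (σ v) p = v := by
  let φ : lieAlg G →ₗ[ℝ] tang G p := (evalOp p).restrict (fun X hX => op_mem_tang hX p)
  have hφ : Function.Surjective φ := by
    rintro ⟨v, X, hX, rfl⟩
    exact ⟨⟨X, hX⟩, rfl⟩
  obtain ⟨s, hs⟩ := φ.exists_rightInverse_of_surjective (LinearMap.range_eq_top.2 hφ)
  refine ⟨LinearMap.toContinuousLinearMap ((lieAlg G).subtype ∘ₗ s), fun v => (s v).2, fun v => ?_⟩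
  exact congrArg Subtype.val (LinearMap.congr_fun hs v)

/-- Near a point of the complex line of `p`, the zeros of the moment map that are orthogonal to the
orbit of `p` lie on this line. -/
theorem Reg.eventually_mem_line {p : C (k + 1)} (hp : Reg G p) {r : ℝ} (hr : 0 < r) :
    ∀ᶠ z in 𝓝 ((r : ℂ) • p), MZero G z → (∀ v ∈ tang G p, (inner ℂ v z).re = 0) →
      z = inner ℂ p z • p := by
  obtain ⟨σ, hσ, hσp⟩ := exists_section (G := G) p
  let opL : Mat (k + 1) →L[ℝ] (C (k + 1) →L[ℂ] C (k + 1)) := LinearMap.toContinuousLinearMap op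
  have hpp : inner ℂ p p = (1 : ℂ) := by rw [inner_self_eq_norm_sq_to_K, hp.norm_eq]; simp
  have hc : Tendsto (fun z => (inner ℂ p z).re) (𝓝 ((r : ℂ) • p)) (𝓝 r) := by
    have : Continuous fun z => (inner ℂ p z).re := by fun_prop
    have h := this.tendsto ((r : ℂ) • p)
    rwa [inner_smul_right, hpp, mul_one, Complex.ofReal_re] at h
  have hu : Tendsto (fun z => (‖opL‖ * ‖σ‖) * ‖z - inner ℂ p z • p‖) (𝓝 ((r : ℂ) • p)) (𝓝 0) := by
    have : Continuous fun z => (‖opL‖ * ‖σ‖) * ‖z - inner ℂ p z • p‖ := by fun_prop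
    have h := this.tendsto ((r : ℂ) • p)
    rwa [inner_smul_right, hpp, mul_one, sub_self, norm_zero, mul_zero] at h
  -- On these neighbourhoods 2 Re ⟨p, z⟩ > r > ‖Y‖, where z = ⟨p, z⟩p + iu and u = Yp. The moment
  -- map equation says |⟨Yu, u⟩| = 2 Re ⟨p, z⟩ |u|², which exceeds ‖Y‖|u|² unless u = 0. The linear
  -- section σ is what makes ‖Y‖ small together with u.
  have h1 := hc.eventually (lt_mem_nhds (half_lt_self hr))
  have h2 := hu.eventually (gt_mem_nhds hr)
  filter_upwards [h1, h2] with z hz1 hz2 hz hperp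
  obtain ⟨u, hu, hzu⟩ := hp.exists_eq_add hperp
  have hsu := hσp ⟨u, hu⟩
  set Y := σ ⟨u, hu⟩ with hYdef
  have hY : Y ∈ lieAlg G := hσ _
  simp only at hsu
  have hYY := inner_eq_of_mzero (c := inner ℂ p z) hp.mzero hY (by rw [hsu, ← hzu]; exact hz)
  rw [hsu] at hYY
  have hnorm : ‖z - inner ℂ p z • p‖ = ‖u‖ := by
    conv_lhs => rw [hzu]
    rw [inner_add_right, inner_smul_right, inner_smul_right, hpp]
    rw [← inner_conj_symm p u, hp.mzero.inner_tang hu]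
    simp [norm_smul]
  have hle : ‖op Y‖ ≤ (‖opL‖ * ‖σ‖) * ‖u‖ := by
    calc ‖op Y‖ = ‖opL Y‖ := rfl
      _ ≤ ‖opL‖ * ‖Y‖ := opL.le_opNorm Y
      _ ≤ ‖opL‖ * (‖σ‖ * ‖u‖) := by gcongr; exact σ.le_opNorm ⟨u, hu⟩
      _ = _ := by ring
  rw [hnorm] at hz2
  have h3 : ‖inner ℂ (op Y u) u‖ ≤ ‖op Y‖ * ‖u‖ * ‖u‖ :=
    (norm_inner_le_norm _ _).trans (by gcongr; exact (op Y).le_opNorm u)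
  have hu0 : ‖u‖ = 0 := by
    by_contra hne
    have hpos : 0 < ‖u‖ := lt_of_le_of_ne (norm_nonneg _) (Ne.symm hne)
    have h4 : ‖inner ℂ (op Y u) u‖ = 2 * (inner ℂ p z).re * ‖u‖ ^ 2 := by
      rw [hYY, norm_mul, Complex.norm_I, mul_one, norm_neg, Complex.norm_real, Real.norm_eq_abs,
        abs_of_nonneg]
      have : 0 < (inner ℂ p z).re := by linarith
      positivity
    rw [h4] at h3
    have h5 : ‖op Y‖ < r := hle.trans_lt hz2
    nlinarith [mul_pos hpos hpos]
  conv_lhs => rw [hzu]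
  rw [norm_eq_zero.1 hu0, smul_zero, add_zero]

end

/-! ### Lagrangian angles computed from frames, and the shift caused by the orbit directions. -/

section

/-! ### Frames of Lagrangian planes -/

theorem holVol_sum {N : ℕ} (b : Fin N → C N) (D : Matrix (Fin N) (Fin N) ℂ) :
    holVol (fun j => ∑ i, D i j • b i) = holVol b * D.det := by
  rw [holVol, holVol, ← Matrix.det_mul]
  congr 1
  ext i j
  simp [Matrix.mul_apply, mul_comm]

theorem norm_holVol {N : ℕ} {e : Fin N → C N} (he : Orthonormal ℂ e) : ‖holVol e‖ = 1 := by
  have h : (Matrix.of fun i j => e j i).conjTranspose * (Matrix.of fun i j => e j i) = 1 := by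
    ext i j
    have := orthonormal_iff_ite.1 he i j
    rw [PiLp.inner_apply] at this
    simp only [RCLike.inner_apply] at this
    simp only [Matrix.mul_apply, Matrix.conjTranspose_apply, Matrix.of_apply, Matrix.one_apply]
    rw [← this]
    exact Finset.sum_congr rfl fun l _ => by rw [mul_comm]; rfl
  have h2 := congrArg Matrix.det h
  rw [Matrix.det_mul, Matrix.det_conjTranspose, Matrix.det_one] at h2
  have h3 := congrArg norm h2
  rw [norm_mul, norm_star, norm_one] at h3
  have h4 : ‖holVol e‖ * ‖holVol e‖ = 1 := h3
  nlinarith [norm_nonneg (holVol e)]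

theorem sum_inner_smul {N : ℕ} {e : Fin N → C N} (he : Orthonormal ℂ e) (v : C N) :
    ∑ i, inner ℂ (e i) v • e i = v := by
  have hcard : Fintype.card (Fin N) = Module.finrank ℂ (C N) := by simp
  by_cases hN : N = 0
  · subst hN; exact Subsingleton.elim _ _
  have : Nonempty (Fin N) := ⟨⟨0, Nat.pos_of_ne_zero hN⟩⟩
  let b := basisOfOrthonormalOfCardEqFinrank he hcard
  have hb : ⇑b = e := coe_basisOfOrthonormalOfCardEqFinrank he hcard
  let B := b.toOrthonormalBasis (by rw [hb]; exact he)
  have hB : ⇑B = e := by rw [Module.Basis.coe_toOrthonormalBasis, hb]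
  have hs := B.sum_repr' v
  rwa [hB] at hs

/-- The holomorphic volumes of two frames of the same Lagrangian plane have a real quotient. -/
theorem exists_holVol_eq_mul {N : ℕ} {e a : Fin N → C N} (he : Orthonormal ℂ e)
    (h : ∀ i j, (inner ℂ (e i) (a j)).im = 0) : ∃ r : ℝ, holVol a = holVol e * r := by
  refine ⟨Matrix.det (Matrix.of fun i j => (inner ℂ (e i) (a j)).re), ?_⟩
  -- The transition matrix between frames of one Lagrangian plane is real, hence so is its
  -- determinant.
  have e1 : a = fun j => ∑ i, (Matrix.of fun i j => inner ℂ (e i) (a j)) i j • e i :=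
    funext fun j => (sum_inner_smul he (a j)).symm
  conv_lhs => rw [e1]
  rw [holVol_sum]
  congr 1
  have := Complex.ofRealHom.map_det (Matrix.of fun i j => (inner ℂ (e i) (a j)).re)
  change _ = Complex.ofRealHom _
  rw [this]
  congr 1
  ext i j
  refine Complex.ext ?_ ?_
  · simp
  · simp [h i j]

theorem holVol_eq_or_eq_neg {N : ℕ} {e a : Fin N → C N} (he : Orthonormal ℂ e)
    (ha : Orthonormal ℂ a) (h : ∀ i j, (inner ℂ (e i) (a j)).im = 0) :
    holVol a = holVol e ∨ holVol a = -holVol e := by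
  obtain ⟨r, hr⟩ := exists_holVol_eq_mul he h
  have h1 := congrArg norm hr
  rw [norm_mul, norm_holVol he, norm_holVol ha, one_mul, Complex.norm_real, Real.norm_eq_abs] at h1
  rcases (abs_eq zero_le_one).1 h1.symm with h2 | h2
  · left; rw [hr, h2]; simp
  · right; rw [hr, h2]; simp

/-- A Lagrangian plane. -/
structure IsLagPlane {N : ℕ} (T : Submodule ℝ (C N)) : Prop where
  finrank_eq : Module.finrank ℝ T = N
  isotropic : ∀ v ∈ T, ∀ w ∈ T, (inner ℂ v w).im = 0

theorem orthonormal_complex {N : ℕ} {ι : Type*} [DecidableEq ι] {e : ι → C N}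
    (he : Orthonormal ℝ e) (h : ∀ i j, (inner ℂ (e i) (e j)).im = 0) : Orthonormal ℂ e := by
  rw [orthonormal_iff_ite] at *
  intro i j
  have h1 := he i j
  rw [real_inner_eq] at h1
  refine Complex.ext ?_ ?_
  · rw [h1]; split_ifs <;> simp
  · rw [h]; split_ifs <;> simp

theorem orthonormal_real {N : ℕ} {ι : Type*} [DecidableEq ι] {e : ι → C N}
    (he : Orthonormal ℂ e) : Orthonormal ℝ e := by
  rw [orthonormal_iff_ite] at *
  intro i j
  rw [real_inner_eq, he]
  split_ifs <;> simp

namespace IsLagPlane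

variable {N : ℕ} {T : Submodule ℝ (C N)}

theorem orthonormal (hT : IsLagPlane T) {e : Fin N → C N} (he : ∀ i, e i ∈ T)
    (ho : Orthonormal ℝ e) : Orthonormal ℂ e :=
  orthonormal_complex ho fun i j => hT.isotropic _ (he i) _ (he j)

theorem exists_frame (hT : IsLagPlane T) : ∃ e : Fin N → C N,
    (∀ i, e i ∈ T) ∧ Orthonormal ℂ e := by
  let b := (stdOrthonormalBasis ℝ T).reindex (finCongr hT.finrank_eq)
  exact ⟨fun i => b i, fun i => (b i).2, hT.orthonormal (fun i => (b i).2)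
    (b.orthonormal.comp_linearIsometry T.subtypeₗᵢ)⟩

/-- The Lagrangian angle can be read off from any orthonormal frame. -/
theorem isLagrangianAngle_iff [NeZero N] (hT : IsLagPlane T) {e : Fin N → C N}
    (he : ∀ i, e i ∈ T) (ho : Orthonormal ℂ e) (θ : ℝ) : IsLagrangianAngle T θ ↔
      holVol e = Complex.exp (θ * I) ∨ holVol e = -Complex.exp (θ * I) := by
  constructor
  · rintro ⟨a, haT, hao, ha⟩
    rw [← ha]
    exact holVol_eq_or_eq_neg (hT.orthonormal haT hao) ho
      fun i j => hT.isotropic _ (haT i) _ (he j)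
  · rintro (h | h)
    · exact ⟨e, he, orthonormal_real ho, h⟩
    -- The opposite orientation is obtained by reversing the first vector, which exists because N ≠
    -- 0.
    · refine ⟨fun j => ∑ i, Matrix.diagonal (Function.update (1 : Fin N → ℂ) 0 (-1)) i j • e i,
        ?_, ?_, ?_⟩
      · intro j
        simp only [Matrix.diagonal_apply, ite_smul, zero_smul, Finset.sum_ite_eq',
          Finset.mem_univ, if_true]
        by_cases hj : j = 0
        · subst hj; simpa using T.neg_mem (he 0)
        · simpa [Function.update_of_ne hj] using he j
      · refine orthonormal_real ?_
        rw [orthonormal_iff_ite] at *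
        intro i j
        simp only [Matrix.diagonal_apply, ite_smul, zero_smul, Finset.sum_ite_eq',
          Finset.mem_univ, if_true, inner_smul_left, inner_smul_right, ho]
        split_ifs with hij
        · subst hij
          by_cases hi : i = 0
          · subst hi; simp
          · simp [Function.update_of_ne hi]
        · simp
      · rw [holVol_sum, Matrix.det_diagonal, Finset.prod_update_of_mem (Finset.mem_univ _), h]
        simp

theorem exists_angle [NeZero N] (hT : IsLagPlane T) : ∃ θ, IsLagrangianAngle T θ := by
  obtain ⟨e, he, ho⟩ := hT.exists_frame
  refine ⟨Complex.arg (holVol e), (hT.isLagrangianAngle_iff he ho _).2 (Or.inl ?_)⟩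
  conv_lhs => rw [← Complex.norm_mul_exp_arg_mul_I (holVol e), norm_holVol ho]
  simp

end IsLagPlane

/-- Both sides say that the squares e^{2ia} and e^{2ib} agree. -/
theorem modEq_pi_iff (a b : ℝ) : a ≡ b [PMOD Real.pi] ↔
    Complex.exp (a * I) = Complex.exp (b * I) ∨ Complex.exp (a * I) = -Complex.exp (b * I) := by
  have h1 : Complex.exp (a * I) = Complex.exp (b * I) ∨ Complex.exp (a * I) = -Complex.exp (b * I) ↔
      Complex.exp (a * I) ^ 2 = Complex.exp (b * I) ^ 2 := sq_eq_sq_iff_eq_or_eq_neg.symm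
  rw [h1, ← Complex.exp_nat_mul, ← Complex.exp_nat_mul, Complex.exp_eq_exp_iff_exists_int,
    AddCommGroup.modEq_iff_zsmul]
  have key : ∀ m : ℤ, ((2 : ℕ) : ℂ) * (a * I) = (2 : ℕ) * (b * I) + m * (2 * Real.pi * I) ↔
      a = b + m * Real.pi := by
    intro m
    constructor
    · intro h
      have h2 : (a : ℂ) = ((b + m * Real.pi : ℝ) : ℂ) := by
        have : (2 * I) * (a : ℂ) = (2 * I) * (b + m * Real.pi) := by push_cast at h; linear_combination h
        have := mul_left_cancel₀ (by simp) this
        rw [this]; push_cast; rfl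
      exact_mod_cast h2
    · intro h; rw [h]; push_cast; ring
  simp only [key, zsmul_eq_mul]
  constructor
  · rintro ⟨m, hm⟩; exact ⟨-m, by push_cast; linarith⟩
  · rintro ⟨m, hm⟩; exact ⟨-m, by push_cast; linarith⟩

/-- The angle of a Lagrangian plane is unique modulo `π`. -/
theorem IsLagPlane.angle_iff_modEq {N : ℕ} [NeZero N] {T : Submodule ℝ (C N)} (hT : IsLagPlane T)
    {θ : ℝ} (h : IsLagrangianAngle T θ) (θ' : ℝ) :
    IsLagrangianAngle T θ' ↔ θ' ≡ θ [PMOD Real.pi] := by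
  obtain ⟨e, he, ho, hθ⟩ := h
  rw [hT.isLagrangianAngle_iff he (hT.orthonormal he ho), hθ, modEq_pi_iff]
  constructor
  · rintro (h | h)
    · exact Or.inl h.symm
    · right; rw [h, neg_neg]
  · rintro (h | h)
    · exact Or.inl h.symm
    · right; rw [h, neg_neg]

/-! ### Frames adapted to the orbits -/

variable {k : ℕ} {G : Subgroup (SU (k + 1))}

theorem inner_pair {n : ℕ} (z w : C n) (s t : ℂ) :
    inner ℂ (pair z s) (pair w t) = inner ℂ z w + inner ℂ s t := by
  simp [PiLp.inner_apply, Fin.sum_univ_castSucc, pair]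

/-- The embedding `(a, b) ↦ (a p, b)` of `ℂ²`. -/
def emb {n : ℕ} (p : C n) : C 2 →ₗ[ℂ] C (n + 1) where
  toFun x := pair (x 0 • p) (x 1)
  map_add' x y := by
    rw [← pair_add]; simp [add_smul]
  map_smul' c x := by
    rw [RingHom.id_apply, ← pair_smul]; simp [mul_smul]

theorem emb_apply {n : ℕ} (p : C n) (x : C 2) : emb p x = pair (x 0 • p) (x 1) := rfl

theorem inner_emb {n : ℕ} {p : C n} (hp : ‖p‖ = 1) (x y : C 2) :
    inner ℂ (emb p x) (emb p y) = inner ℂ x y := by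
  rw [emb_apply, emb_apply, inner_pair, inner_smul_left, inner_smul_right,
    inner_self_eq_norm_sq_to_K, hp, PiLp.inner_apply, Fin.sum_univ_two]
  simp [mul_comm]

/-- The frame of `𝔤 z ⊕ T'` given by frames of `𝔤 p` and of `T' ⊂ P × ℂ`. -/
def orbitFrame (e : Fin k → C (k + 1)) (p : C (k + 1)) (u : ℂ) (f : Fin 2 → C 2) :
    Fin (k + 2) → C (k + 2) :=
  Fin.append (fun i => pair (u • e i) 0) (fun j => emb p (f j))

/-- The change of basis is block diagonal, with the scalar u on the k orbit directions and f on P ×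
ℂ. The factor u^k is the source of the term (m - 2) arg z₁. -/
theorem holVol_orbitFrame (e : Fin k → C (k + 1)) (p : C (k + 1)) (u : ℂ) (f : Fin 2 → C 2) :
    holVol (orbitFrame e p u f) =
      holVol (orbitFrame e p 1 fun j => EuclideanSpace.single j 1) * (u ^ k * holVol f) := by
  let D : Matrix (Fin k ⊕ Fin 2) (Fin k ⊕ Fin 2) ℂ :=
    Matrix.fromBlocks (u • 1) 0 0 (Matrix.of fun i j => f j i)
  have hD : D.det = u ^ k * holVol f := by
    rw [Matrix.det_fromBlocks_zero₂₁, Matrix.det_smul, Matrix.det_one, Fintype.card_fin, mul_one]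
    rfl
  rw [← hD, ← Matrix.det_submatrix_equiv_self (finSumFinEquiv (m := k) (n := 2)).symm D,
    ← holVol_sum]
  congr 1
  ext1 j
  rw [Fin.sum_univ_add]
  refine Fin.addCases (fun j => ?_) (fun j => ?_) j
  · simp only [orbitFrame, Fin.append_left, Fin.append_right, Matrix.submatrix_apply,
      finSumFinEquiv_symm_apply_castAdd, finSumFinEquiv_symm_apply_natAdd, D,
      Matrix.fromBlocks_apply₁₁, Matrix.fromBlocks_apply₂₁, Matrix.zero_apply, zero_smul,
      Finset.sum_const_zero, add_zero, Matrix.smul_apply, Matrix.one_apply, smul_eq_mul,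
      mul_ite, mul_one, mul_zero, ite_smul, Finset.sum_ite_eq', Finset.mem_univ, if_true, one_smul]
    rw [← pair_smul, mul_zero]
  · simp only [orbitFrame, Fin.append_left, Fin.append_right, Matrix.submatrix_apply,
      finSumFinEquiv_symm_apply_castAdd, finSumFinEquiv_symm_apply_natAdd, D,
      Matrix.fromBlocks_apply₂₂, Matrix.fromBlocks_apply₁₂, Matrix.zero_apply, zero_smul,
      Finset.sum_const_zero, zero_add, Matrix.of_apply, ← map_smul, ← map_sum]
    congr 1
    ext i
    fin_cases i <;> simp [Fin.sum_univ_two]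

theorem orthonormal_orbitFrame {e : Fin k → C (k + 1)} {p : C (k + 1)} {u : ℂ} {f : Fin 2 → C 2}
    (h : Orthonormal ℂ (Fin.snoc e p : Fin (k + 1) → C (k + 1))) (hu : ‖u‖ = 1)
    (hf : Orthonormal ℂ f) : Orthonormal ℂ (orbitFrame e p u f) := by
  have hp : ‖p‖ = 1 := by simpa using h.1 (Fin.last k)
  rw [orthonormal_iff_ite] at *
  have hee : ∀ i j, inner ℂ (e i) (e j) = if i = j then (1 : ℂ) else 0 := fun i j => by
    have := h i.castSucc j.castSucc
    simpa using this
  have hep : ∀ i, inner ℂ (e i) p = (0 : ℂ) := fun i => by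
    have := h i.castSucc (Fin.last k)
    simpa [(Fin.castSucc_lt_last i).ne] using this
  have huu : u * (starRingEnd ℂ) u = 1 := by
    rw [Complex.mul_conj', hu]; simp
  intro i j
  refine Fin.addCases (fun i => ?_) (fun i => ?_) i <;>
    refine Fin.addCases (fun j => ?_) (fun j => ?_) j
  · simp only [orbitFrame, Fin.append_left, inner_pair, inner_smul_left, inner_smul_right, hee,
      inner_zero_right, add_zero, mul_ite, mul_one, mul_zero, huu]
    simp
  · simp only [orbitFrame, Fin.append_left, Fin.append_right, emb_apply, inner_pair,
      inner_smul_left, inner_smul_right, hep, inner_zero_left, add_zero, mul_zero]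
    rw [if_neg (by simp [Fin.ext_iff]; omega)]
  · simp only [orbitFrame, Fin.append_left, Fin.append_right, emb_apply, inner_pair,
      inner_smul_left, inner_smul_right, inner_zero_right, add_zero]
    rw [← inner_conj_symm, hep, if_neg (by simp [Fin.ext_iff]; omega)]; simp
  · simp only [orbitFrame, Fin.append_right, inner_emb hp, hf]
    simp

/-- The point `p`, rotated so that the base frame has holomorphic volume `1`. -/
theorem Reg.exists_normalised {p : C (k + 1)} (hp : Reg G p) : ∃ β : ℂ, ‖β‖ = 1 ∧
    ∃ e : Fin k → C (k + 1), (∀ i, e i ∈ tang G (β • p)) ∧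
      Orthonormal ℂ (Fin.snoc e (β • p) : Fin (k + 1) → C (k + 1)) ∧
      holVol (orbitFrame e (β • p) 1 fun j => EuclideanSpace.single j 1) = 1 := by
  obtain ⟨e, he, ho⟩ := hp.exists_frame
  have hs : Orthonormal ℂ fun j : Fin 2 => (EuclideanSpace.single j 1 : C 2) :=
    EuclideanSpace.orthonormal_single
  set d := holVol (orbitFrame e p 1 fun j => EuclideanSpace.single j 1) with hd
  have hd1 : ‖d‖ = 1 := norm_holVol (orthonormal_orbitFrame ho (by simp) hs)
  -- Rotating p by β rotates the k orbit directions and the direction of p, so the base volume d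
  -- becomes d β^(k+1).
  obtain ⟨β, hβ⟩ := IsAlgClosed.exists_pow_nat_eq d⁻¹ (Nat.succ_pos k)
  have hβ1 : ‖β‖ = 1 := by
    have := congrArg norm hβ
    rw [norm_pow, norm_inv, hd1, inv_one] at this
    exact (pow_eq_one_iff_of_nonneg (norm_nonneg _) (Nat.succ_ne_zero k)).1 this
  have hββ : (starRingEnd ℂ) β * β = 1 := by
    rw [mul_comm, Complex.mul_conj', hβ1]; simp
  refine ⟨β, hβ1, fun i => β • e i, fun i => smul_mem_tang (he i), ?_, ?_⟩
  · have e1 : (Fin.snoc (fun i => β • e i) (β • p) : Fin (k + 1) → C (k + 1)) =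
        fun i => β • (Fin.snoc e p : Fin (k + 1) → C (k + 1)) i := by
      ext1 i
      refine Fin.lastCases ?_ (fun i => ?_) i <;> simp
    rw [e1, orthonormal_iff_ite]
    intro i j
    rw [inner_smul_left, inner_smul_right, ← mul_assoc, hββ, one_mul]
    exact orthonormal_iff_ite.1 ho i j
  · have e2 : orbitFrame (fun i => β • e i) (β • p) 1 (fun j => EuclideanSpace.single j 1) =
        orbitFrame e p β ![EuclideanSpace.single 0 β, EuclideanSpace.single 1 1] := by
      rw [orbitFrame, orbitFrame]
      congr 1
      · simp
      · ext1 j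
        fin_cases j <;> simp [emb_apply]
    rw [e2, holVol_orbitFrame, ← hd]
    have : holVol (![EuclideanSpace.single 0 β, EuclideanSpace.single 1 1] : Fin 2 → C 2) = β := by
      simp [holVol, Matrix.det_fin_two]
    rw [this, ← pow_succ, hβ, mul_inv_cancel₀]
    rintro h; rw [h] at hd1; simp at hd1

/-- The angle of `𝔤 z ⊕ T'`. -/
theorem angle_orbitFrame_iff {p : C (k + 1)} {e : Fin k → C (k + 1)}
    (he : ∀ i, e i ∈ tang G p)
    (ho : Orthonormal ℂ (Fin.snoc e p : Fin (k + 1) → C (k + 1)))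
    (h1 : holVol (orbitFrame e p 1 fun j => EuclideanSpace.single j 1) = 1)
    {T : Submodule ℝ (C (k + 2))} {T' : Submodule ℝ (C 2)} (hT : IsLagPlane T)
    (hT' : IsLagPlane T') {c : ℂ} (hc : k = 0 ∨ c ≠ 0)
    (hsub : ∀ v ∈ tang G (c • p), pair v 0 ∈ T) (hsub' : ∀ x ∈ T', emb p x ∈ T) (θ : ℝ) :
    IsLagrangianAngle T θ ↔ IsLagrangianAngle T' (θ - k * Complex.arg c) := by
  obtain ⟨f, hf, hfo⟩ := hT'.exists_frame
  set u := Complex.exp (Complex.arg c * I) with hu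
  have hu1 : ‖u‖ = 1 := Complex.norm_exp_ofReal_mul_I _
  have hmem : ∀ i, orbitFrame e p u f i ∈ T := by
    intro i
    refine Fin.addCases (fun i => ?_) (fun j => ?_) i
    · rw [orbitFrame, Fin.append_left]
      refine hsub _ ?_
      rcases hc with rfl | hc
      · exact i.elim0
      -- Only a positive real factor separates u e_i from c e_i, which is tangent to the orbit of
      -- cp.
      · have e3 : u • e i = (‖c‖⁻¹ : ℝ) • (c • e i) := by
          have hn : (‖c‖ : ℂ) ≠ 0 := by simpa using hc
          conv_rhs => rw [← Complex.norm_mul_exp_arg_mul_I c]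
          rw [← hu, RCLike.real_smul_eq_coe_smul (K := ℂ), smul_smul, ← mul_assoc]
          simp [hc, hu1]
        rw [e3]
        exact Submodule.smul_mem _ _ (smul_mem_tang (he i))
    · rw [orbitFrame, Fin.append_right]; exact hsub' _ (hf j)
  rw [hT.isLagrangianAngle_iff hmem (orthonormal_orbitFrame ho hu1 hfo),
    hT'.isLagrangianAngle_iff hf hfo, holVol_orbitFrame, h1, one_mul]
  have hne : u ^ k ≠ 0 := pow_ne_zero _ (Complex.exp_ne_zero _)
  have e4 : Complex.exp (θ * I) = u ^ k * Complex.exp ((θ - k * Complex.arg c : ℝ) * I) := by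
    rw [hu, ← Complex.exp_nat_mul, ← Complex.exp_add]
    congr 1; push_cast; ring
  rw [e4, ← mul_neg, mul_right_inj' hne, mul_right_inj' hne]

theorem holVol_gop (g : SU (k + 1)) (e : Fin (k + 1) → C (k + 1)) :
    holVol (fun i => gop g (e i)) = holVol e := by
  rw [holVol, holVol]
  have : (Matrix.of fun i j => gop g (e j) i) = g.1 * Matrix.of fun i j => e j i := by
    ext i j; rw [Matrix.mul_apply]; rfl
  rw [this, Matrix.det_mul, (Matrix.mem_specialUnitaryGroup_iff.1 g.2).2, one_mul]

/-- The stabiliser of the line of `p` acts on it by roots of unity. -/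
theorem Reg.pow_eq_one {p : C (k + 1)} (hp : Reg G p) {g : SU (k + 1)} (hg : g ∈ G) {c : ℂ}
    (h : CohomTwo.gop g p = c • p) : c ^ (2 * (k + 1)) = 1 := by
  obtain ⟨e, he, ho⟩ := hp.exists_frame
  have hc : ‖c‖ = 1 := by
    have := norm_gop g p
    rwa [h, norm_smul, hp.norm_eq, mul_one] at this
  have hcc : (starRingEnd ℂ) c * c = 1 := by
    rw [mul_comm, Complex.mul_conj', hc]; simp
  set E : Fin (k + 1) → C (k + 1) := Fin.snoc e p with hE
  have ho1 : Orthonormal ℂ fun i => c • E i := by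
    rw [orthonormal_iff_ite] at *
    intro i j
    rw [inner_smul_left, inner_smul_right, ← mul_assoc, hcc, one_mul]; exact ho i j
  have ho2 : Orthonormal ℂ fun i => CohomTwo.gop g (E i) := by
    rw [orthonormal_iff_ite] at *
    intro i j
    rw [inner_gop]; exact ho i j
  -- Since gp = cp, g maps the Lagrangian plane 𝔤p ⊕ ℝp onto c times itself. Both frames span this
  -- image, so their volumes agree up to sign; as det g = 1, this says c^(k+1) = ±1.
  have hreal : ∀ i j, (inner ℂ (c • E i) (CohomTwo.gop g (E j))).im = 0 := by
    intro i j
    refine Fin.lastCases ?_ (fun j => ?_) j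
    · rw [hE, Fin.snoc_last, h, inner_smul_left, inner_smul_right, ← mul_assoc, hcc, one_mul]
      refine Fin.lastCases ?_ (fun i => ?_) i
      · rw [Fin.snoc_last]; exact inner_self_im (𝕜 := ℂ) p
      · rw [Fin.snoc_castSucc, hp.mzero.inner_tang (he i)]; rfl
    · have hgj := gop_mem_tang hg (he j)
      rw [h] at hgj
      obtain ⟨w, hw, hgw⟩ := tang_smul _ hgj
      rw [hE, Fin.snoc_castSucc, hgw, inner_smul_left, inner_smul_right, ← mul_assoc, hcc, one_mul]
      refine Fin.lastCases ?_ (fun i => ?_) i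
      · rw [Fin.snoc_last, ← inner_conj_symm, hp.mzero.inner_tang hw]; simp
      · rw [Fin.snoc_castSucc]; exact hp.mzero.isotropic (he i) hw
  have hv : holVol (fun i => c • E i) = holVol E * c ^ (k + 1) := by
    have := holVol_sum E (Matrix.diagonal fun _ => c)
    rw [Matrix.det_diagonal, Finset.prod_const, Finset.card_univ, Fintype.card_fin] at this
    rw [← this]
    congr 1; ext1 j
    simp [Matrix.diagonal_apply]
  have hne : holVol E ≠ 0 := fun h0 => by
    have := norm_holVol ho; rw [h0] at this; simp at this
  have := holVol_eq_or_eq_neg ho1 ho2 hreal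
  rw [holVol_gop, hv, ← mul_neg] at this
  have h2 : c ^ (k + 1) = 1 ∨ c ^ (k + 1) = -1 := by
    rcases this with h | h
    · left; exact mul_left_cancel₀ hne (by rw [mul_one]; exact h.symm)
    · right
      have := mul_left_cancel₀ hne ((mul_one _).trans h)
      rw [this, neg_neg]
  rw [mul_comm, pow_mul]
  rcases h2 with h | h <;> rw [h] <;> norm_num

end

/-! ### Differential geometry of Lagrangian immersions: the angle equation implies the curvature
equation. -/

section

/-! ### Local representations of a Lagrangian immersion -/

namespace LagrangianImmersion

variable {N : ℕ} (F : LagrangianImmersion N)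

theorem contDiffAt_localRep (p : F.carrier) {x : EuclideanSpace ℝ (Fin N)}
    (hx : x ∈ (chartAt (EuclideanSpace ℝ (Fin N)) p).target) :
    ContDiffAt ℝ ∞ (F.localRep p) x := by
  have h1 : ContMDiffAt (𝓡 N) (𝓡 N) ∞ (chartAt (EuclideanSpace ℝ (Fin N)) p).symm x :=
    (contMDiffOn_chart_symm (I := 𝓡 N) (n := ∞) (x := p)).contMDiffAt
      ((chartAt (EuclideanSpace ℝ (Fin N)) p).open_target.mem_nhds hx)
  have h2 := ContMDiffAt.comp x (F.smooth.contMDiffAt) h1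
  exact contMDiffAt_iff_contDiffAt.1 h2

theorem fderiv_localRep (p : F.carrier) {x : EuclideanSpace ℝ (Fin N)}
    (hx : x ∈ (chartAt (EuclideanSpace ℝ (Fin N)) p).target) :
    fderiv ℝ (F.localRep p) x =
      (mfderiv (𝓡 N) 𝓘(ℝ, C N) F.toFun ((chartAt (EuclideanSpace ℝ (Fin N)) p).symm x)).comp
        (mfderiv (𝓡 N) (𝓡 N) (chartAt (EuclideanSpace ℝ (Fin N)) p).symm x) := by
  rw [← mfderiv_eq_fderiv]
  exact mfderiv_comp x (F.smooth.mdifferentiableAt (by simp))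
    ((mdifferentiable_chart p).symm.mdifferentiableAt hx)

theorem range_fderiv_localRep (p : F.carrier) {x : EuclideanSpace ℝ (Fin N)}
    (hx : x ∈ (chartAt (EuclideanSpace ℝ (Fin N)) p).target) :
    LinearMap.range (fderiv ℝ (F.localRep p) x).toLinearMap =
      F.tangentPlane ((chartAt (EuclideanSpace ℝ (Fin N)) p).symm x) := by
  rw [F.fderiv_localRep p hx, tangentPlane]
  have hs := (mdifferentiable_chart (I := 𝓡 N) p).symm.mfderiv_surjective hx
  ext v
  constructor
  · rintro ⟨u, rfl⟩; exact ⟨_, rfl⟩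
  · rintro ⟨u, rfl⟩
    obtain ⟨w, rfl⟩ := hs u
    exact ⟨w, rfl⟩

theorem injective_fderiv_localRep (p : F.carrier) {x : EuclideanSpace ℝ (Fin N)}
    (hx : x ∈ (chartAt (EuclideanSpace ℝ (Fin N)) p).target) :
    Function.Injective (fderiv ℝ (F.localRep p) x) := by
  rw [F.fderiv_localRep p hx]
  exact (F.immersive _).comp ((mdifferentiable_chart (I := 𝓡 N) p).symm.mfderiv_injective hx)

theorem isLagPlane_tangentPlane (p : F.carrier) : IsLagPlane (F.tangentPlane p) where
  finrank_eq := by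
    rw [tangentPlane]
    refine (LinearMap.finrank_range_of_inj (F.immersive p)).trans ?_
    exact finrank_euclideanSpace_fin
  isotropic := by
    rintro _ ⟨u, rfl⟩ _ ⟨v, rfl⟩
    rw [← kahlerForm_eq]
    exact F.lagrangian p u v

end LagrangianImmersion

/-! ### The mean curvature of a Lagrangian with prescribed angle -/

/-- A nontrivial permutation moves at least two indices, so each term of its product rule keeps an
off-diagonal factor that vanishes at the identity. -/
theorem hasDerivAt_det_of_eq_one {m : ℕ} {M : ℝ → Matrix (Fin m) (Fin m) ℂ}
    {M' : Matrix (Fin m) (Fin m) ℂ} (h : ∀ i j, HasDerivAt (fun t => M t i j) (M' i j) 0)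
    (h1 : M 0 = 1) : HasDerivAt (fun t => (M t).det) M'.trace 0 := by
  have hσ : ∀ σ : Equiv.Perm (Fin m), HasDerivAt
      (fun t => ((Equiv.Perm.sign σ : ℤ) : ℂ) * ∏ i, M t (σ i) i)
      (if σ = 1 then M'.trace else 0) 0 := by
    intro σ
    have hp := (HasDerivAt.fun_finsetProd (u := Finset.univ) (f := fun i t => M t (σ i) i)
      fun i _ => h (σ i) i).const_mul ((Equiv.Perm.sign σ : ℤ) : ℂ)
    convert! hp using 1
    split_ifs with hs
    · subst hs
      simp [h1, Matrix.trace]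
    · rw [Finset.sum_eq_zero, mul_zero]
      intro i _
      obtain ⟨j, hj⟩ : ∃ j, σ j ≠ j := by
        by_contra! hall
        exact hs (Equiv.ext hall)
      obtain ⟨l, hl, hli⟩ : ∃ l, σ l ≠ l ∧ l ≠ i := by
        by_cases hji : j = i
        · exact ⟨σ j, fun h => hj (σ.injective h), by rw [← hji]; exact hj⟩
        · exact ⟨j, hj, hji⟩
      rw [Finset.prod_eq_zero (i := l) (Finset.mem_erase.2 ⟨hli, Finset.mem_univ _⟩)
        (by rw [h1, Matrix.one_apply_ne hl]), zero_smul]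
  have hsum := HasDerivAt.fun_sum (u := Finset.univ) fun σ _ => hσ σ
  simp only [Finset.sum_ite_eq', Finset.mem_univ, if_true] at hsum
  simpa only [Matrix.det_apply'] using hsum

/-- A Lagrangian plane is its own symplectic complement: in a unitary frame contained in T the
coefficients of w are real. -/
theorem IsLagPlane.mem_of_inner_im {N : ℕ} {T : Submodule ℝ (C N)} (hT : IsLagPlane T) {w : C N}
    (h : ∀ v ∈ T, (inner ℂ v w).im = 0) : w ∈ T := by
  obtain ⟨e, he, ho⟩ := hT.exists_frame
  rw [← sum_inner_smul ho w]
  refine T.sum_mem fun i _ => ?_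
  have : inner ℂ (e i) w = ((inner ℂ (e i) w).re : ℂ) := Complex.ext rfl (by simp [h _ (he i)])
  rw [this, Complex.coe_smul]
  exact T.smul_mem _ (he i)

namespace LagrangianImmersion

variable {N : ℕ} (F : LagrangianImmersion N)

/-- The centre of the preferred chart. -/
def base (p : F.carrier) : EuclideanSpace ℝ (Fin N) := chartAt (EuclideanSpace ℝ (Fin N)) p p

theorem base_mem (p : F.carrier) :
    F.base p ∈ (chartAt (EuclideanSpace ℝ (Fin N)) p).target := mem_chart_target _ p

theorem symm_base (p : F.carrier) :
    (chartAt (EuclideanSpace ℝ (Fin N)) p).symm (F.base p) = p :=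
  (chartAt (EuclideanSpace ℝ (Fin N)) p).left_inv (mem_chart_source _ p)

theorem contDiffAt_fderiv_localRep (p : F.carrier) {x : EuclideanSpace ℝ (Fin N)}
    (hx : x ∈ (chartAt (EuclideanSpace ℝ (Fin N)) p).target) :
    ContDiffAt ℝ 1 (fderiv ℝ (F.localRep p)) x :=
  (F.contDiffAt_localRep p hx).fderiv_right
    (by rw [one_add_one_eq_two]; exact WithTop.coe_le_coe.2 (le_top : (2 : ℕ∞) ≤ ⊤))

theorem secondPartial_eq (p : F.carrier) (i j : Fin N) :
    F.secondPartial p i j = fderiv ℝ (fderiv ℝ (F.localRep p)) (F.base p)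
      (EuclideanSpace.single i 1) (EuclideanSpace.single j 1) := by
  have h := ((F.contDiffAt_fderiv_localRep p (F.base_mem p)).differentiableAt
    (by simp)).hasFDerivAt.clm_apply (hasFDerivAt_const (EuclideanSpace.single j (1 : ℝ)) _)
  rw [secondPartial]
  change fderiv ℝ (fun x => fderiv ℝ (F.localRep p) x (EuclideanSpace.single j 1)) (F.base p) _ = _
  rw [h.fderiv]
  simp

theorem secondPartial_symm (p : F.carrier) (i j : Fin N) :
    F.secondPartial p i j = F.secondPartial p j i := by
  rw [secondPartial_eq, secondPartial_eq]
  exact (F.contDiffAt_localRep p (F.base_mem p)).isSymmSndFDerivAt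
    (by simp only [minSmoothness_of_isRCLikeNormedField]
        exact WithTop.coe_le_coe.2 (le_top : (2 : ℕ∞) ≤ ⊤)) _ _

theorem hasDerivAt_partialDeriv (p : F.carrier) (i j : Fin N) :
    HasDerivAt (fun t : ℝ => F.partialDeriv p j (F.base p + t • EuclideanSpace.single i (1 : ℝ)))
      (F.secondPartial p i j) 0 := by
  have h := ((F.contDiffAt_fderiv_localRep p (F.base_mem p)).differentiableAt
    (by simp)).hasFDerivAt.clm_apply (hasFDerivAt_const (EuclideanSpace.single j (1 : ℝ)) _)
  have hl : HasDerivAt (fun t : ℝ => F.base p + t • EuclideanSpace.single i (1 : ℝ))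
      (EuclideanSpace.single i 1) 0 := by
    simpa using ((hasDerivAt_id (0 : ℝ)).smul_const (EuclideanSpace.single i (1 : ℝ))).const_add
      (F.base p)
  have h2 := HasFDerivAt.comp_hasDerivAt_of_eq (0 : ℝ) h hl (by simp)
  rw [secondPartial_eq]
  simp only [ContinuousLinearMap.comp_zero, zero_add, ContinuousLinearMap.flip_apply] at h2
  exact h2

theorem hasDerivAt_localRep (p : F.carrier) (i : Fin N) :
    HasDerivAt (fun t : ℝ => F.localRep p (F.base p + t • EuclideanSpace.single i (1 : ℝ)))
      (F.partialDeriv p i (F.base p)) 0 := by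
  have h := ((F.contDiffAt_localRep p (F.base_mem p)).differentiableAt (by simp)).hasFDerivAt
  have hl : HasDerivAt (fun t : ℝ => F.base p + t • EuclideanSpace.single i (1 : ℝ))
      (EuclideanSpace.single i 1) 0 := by
    simpa using ((hasDerivAt_id (0 : ℝ)).smul_const (EuclideanSpace.single i (1 : ℝ))).const_add
      (F.base p)
  exact HasFDerivAt.comp_hasDerivAt_of_eq (0 : ℝ) h hl (by simp)

theorem eventually_line_mem (p : F.carrier) (i : Fin N) : ∀ᶠ t : ℝ in 𝓝 0,
    F.base p + t • EuclideanSpace.single i (1 : ℝ) ∈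
      (chartAt (EuclideanSpace ℝ (Fin N)) p).target := by
  have hc : Continuous fun t : ℝ => F.base p + t • EuclideanSpace.single i (1 : ℝ) := by fun_prop
  refine hc.continuousAt.eventually_mem ?_
  simpa using (chartAt (EuclideanSpace ℝ (Fin N)) p).open_target.mem_nhds (F.base_mem p)

theorem partialDeriv_mem (p : F.carrier) (i : Fin N) {x : EuclideanSpace ℝ (Fin N)}
    (hx : x ∈ (chartAt (EuclideanSpace ℝ (Fin N)) p).target) : F.partialDeriv p i x ∈
      F.tangentPlane ((chartAt (EuclideanSpace ℝ (Fin N)) p).symm x) := by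
  rw [← F.range_fderiv_localRep p hx]
  exact ⟨_, rfl⟩

theorem partialDeriv_base_mem (p : F.carrier) (i : Fin N) :
    F.partialDeriv p i (F.base p) ∈ F.tangentPlane p := by
  simpa [F.symm_base] using F.partialDeriv_mem p i (F.base_mem p)

theorem exists_eq_sum_partialDeriv (p : F.carrier) {v : C N} (hv : v ∈ F.tangentPlane p) :
    ∃ c : Fin N → ℝ, v = ∑ i, c i • F.partialDeriv p i (F.base p) := by
  rw [← F.symm_base p, ← F.range_fderiv_localRep p (F.base_mem p)] at hv
  obtain ⟨y, rfl⟩ := hv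
  refine ⟨fun i => y i, ?_⟩
  simp only [partialDeriv, ← map_smul, ← map_sum]
  change fderiv ℝ _ _ _ = _
  congr 1
  ext i
  simp [Finset.sum_apply, Pi.single_apply]

/-- The symmetric cubic form `⟨J ∂ᵢF, ∂ⱼ∂ₗF⟩`. -/
theorem cubic_symm (p : F.carrier) (i j l : Fin N) :
    (inner ℂ (F.partialDeriv p i (F.base p)) (F.secondPartial p l j)).im =
      (inner ℂ (F.partialDeriv p j (F.base p)) (F.secondPartial p l i)).im := by
  have h := (F.hasDerivAt_partialDeriv p l i).inner ℂ (F.hasDerivAt_partialDeriv p l j)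
  have h2 := Complex.imCLM.hasFDerivAt.comp_hasDerivAt 0 h
  have h3 := h2.unique ((hasDerivAt_const (0 : ℝ) (0 : ℝ)).congr_of_eventuallyEq (by
    filter_upwards [F.eventually_line_mem p l] with t ht
    exact (F.isLagPlane_tangentPlane _).isotropic _ (F.partialDeriv_mem p i ht) _
      (F.partialDeriv_mem p j ht)))
  simp only [zero_smul, add_zero, Complex.imCLM_apply, Complex.add_im] at h3
  rw [← inner_conj_symm (F.secondPartial p l i), Complex.conj_im] at h3
  linarith

/-- A Lagrangian in `ℂ^{n+1}` with Lagrangian angle `-s Im z_m` has `H = s e_m^⊥`. -/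
theorem meanCurvature_eq {n : ℕ} (F : LagrangianImmersion (n + 1)) (s : ℝ)
    (hF : ∀ q, IsLagrangianAngle (F.tangentPlane q) (-(s * (F.toFun q (Fin.last n)).im)))
    (p : F.carrier) : F.meanCurvature p =
      F.normalPart p (s • EuclideanSpace.single (Fin.last n) 1) := by
  set e : Fin (n + 1) → C (n + 1) := fun i => F.partialDeriv p i (F.base p) with he
  have heT : ∀ i, e i ∈ F.tangentPlane p := fun i => F.partialDeriv_base_mem p i
  have hT := F.isLagPlane_tangentPlane p
  let A : Matrix (Fin (n + 1)) (Fin (n + 1)) ℂ := Matrix.of fun i j => e j i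
  have hA0 : A.det ≠ 0 := by
    obtain ⟨a, haT, hao⟩ := hT.exists_frame
    choose c hc using fun j => F.exists_eq_sum_partialDeriv p (haT j)
    have h1 : a = fun j => ∑ i, (Matrix.of fun i j => (c j i : ℂ)) i j • e i := by
      ext1 j; rw [hc j]; simp [he]
    have h2 := norm_holVol hao
    rw [h1, holVol_sum] at h2
    intro h0
    have h3 : holVol e = 0 := h0
    rw [h3] at h2
    simp at h2
  have hg : (F.inducedMetric p).map Complex.ofRealHom = A.conjTranspose * A := by
    ext i j
    have h1 : inner ℂ (e i) (e j) = ((inner ℝ (e i) (e j) : ℝ) : ℂ) := by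
      refine Complex.ext ?_ ?_
      · rw [Complex.ofReal_re, real_inner_eq]
      · rw [Complex.ofReal_im]; exact hT.isotropic _ (heT i) _ (heT j)
    change ((inner ℝ (e i) (e j) : ℝ) : ℂ) = _
    rw [← h1, PiLp.inner_apply, Matrix.mul_apply]
    refine Finset.sum_congr rfl fun l _ => ?_
    simp [A, mul_comm]
  have hgdet : IsUnit (F.inducedMetric p).det := by
    rw [isUnit_iff_ne_zero]
    intro h0
    have h1 := congrArg Matrix.det hg
    have h2 := Complex.ofRealHom.map_det (F.inducedMetric p)
    rw [h0, map_zero] at h2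
    rw [RingHom.mapMatrix_apply] at h2
    rw [← h2, Matrix.det_mul, Matrix.det_conjTranspose] at h1
    have := mul_ne_zero (star_ne_zero.2 hA0) hA0
    exact this h1.symm
  let B : Matrix (Fin (n + 1)) (Fin (n + 1)) ℂ :=
    (F.inducedMetric p)⁻¹.map Complex.ofRealHom * A.conjTranspose
  have hBA : B * A = 1 := by
    rw [Matrix.mul_assoc, ← hg, ← Matrix.map_mul, Matrix.nonsing_inv_mul _ hgdet]
    simp
  have hAB : A * B = 1 := mul_eq_one_comm.1 hBA
  -- This is the imaginary part of the logarithmic derivative of det A · e^{is Im z_m} along ∂_l.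
  -- Here A has columns ∂ⱼF and A⁻¹ = g⁻¹A*, because A*A = g on a Lagrangian plane.
  have key : ∀ l, ∑ i, ∑ j, (F.inducedMetric p)⁻¹ i j *
      (inner ℂ (e j) (F.secondPartial p l i)).im + s * (e l (Fin.last n)).im = 0 := by
    intro l
    let At : ℝ → Matrix (Fin (n + 1)) (Fin (n + 1)) ℂ := fun t => Matrix.of fun i j =>
      F.partialDeriv p j (F.base p + t • EuclideanSpace.single l (1 : ℝ)) i
    let A' : Matrix (Fin (n + 1)) (Fin (n + 1)) ℂ := Matrix.of fun i j => F.secondPartial p l j i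
    have hAt0 : At 0 = A := by
      ext i j; simp [At, A, he]
    have hAt : ∀ i j, HasDerivAt (fun t => At t i j) (A' i j) 0 := fun i j =>
      ((EuclideanSpace.proj i : C (n + 1) →L[ℂ] ℂ).restrictScalars
        ℝ).hasFDerivAt.comp_hasDerivAt 0 (F.hasDerivAt_partialDeriv p l j)
    have hdet := hasDerivAt_det_of_eq_one (M := fun t => B * At t) (M' := B * A')
      (fun i j => by
        simp only [Matrix.mul_apply]
        exact HasDerivAt.fun_sum fun m _ => (hAt m j).const_mul (B i m)) (by simp [hAt0, hBA])
    have hE : HasDerivAt (fun t : ℝ => Complex.exp ((s * (F.localRep p (F.base p +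
        t • EuclideanSpace.single l (1 : ℝ)) (Fin.last n)).im : ℝ) * I))
        (Complex.exp ((s * (F.localRep p (F.base p) (Fin.last n)).im : ℝ) * I) *
          ((s * (e l (Fin.last n)).im : ℝ) * I)) 0 := by
      have h1 := ((EuclideanSpace.proj (Fin.last n) : C (n + 1) →L[ℂ] ℂ).restrictScalars
        ℝ).hasFDerivAt.comp_hasDerivAt 0 (F.hasDerivAt_localRep p l)
      have h2 := (Complex.imCLM.hasFDerivAt.comp_hasDerivAt 0 h1).const_mul s
      have h3 := (h2.ofReal_comp.mul_const I).cexp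
      simpa using h3
    have hprod := (hdet.const_mul A.det).mul hE
    -- The hypothesis on the angle says exactly that Ω₀(∂₁F, …, ∂_NF) e^{is Im z_m} is real along
    -- the curve.
    have hreal : ∀ᶠ t : ℝ in 𝓝 0, (A.det * (B * At t).det * Complex.exp ((s * (F.localRep p
        (F.base p + t • EuclideanSpace.single l (1 : ℝ)) (Fin.last n)).im : ℝ) * I)).im = 0 := by
      filter_upwards [F.eventually_line_mem p l] with t ht
      obtain ⟨a, haT, hao, ha⟩ := hF ((chartAt (EuclideanSpace ℝ (Fin (n + 1))) p).symm
        (F.base p + t • EuclideanSpace.single l (1 : ℝ)))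
      have hTt := F.isLagPlane_tangentPlane ((chartAt (EuclideanSpace ℝ (Fin (n + 1))) p).symm
        (F.base p + t • EuclideanSpace.single l (1 : ℝ)))
      obtain ⟨r, hr⟩ := exists_holVol_eq_mul (hTt.orthonormal haT hao)
        (a := fun j => F.partialDeriv p j (F.base p + t • EuclideanSpace.single l (1 : ℝ)))
        (fun i j => hTt.isotropic _ (haT i) _ (F.partialDeriv_mem p j ht))
      have hr' : (At t).det = holVol a * r := hr
      rw [← Matrix.det_mul, ← Matrix.mul_assoc, hAB, Matrix.one_mul, hr', ha, mul_right_comm,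
        ← Complex.exp_add]
      have : ((-(s * (F.toFun ((chartAt (EuclideanSpace ℝ (Fin (n + 1))) p).symm
          (F.base p + t • EuclideanSpace.single l (1 : ℝ))) (Fin.last n)).im) : ℝ) : ℂ) * I +
          ((s * (F.localRep p (F.base p + t • EuclideanSpace.single l (1 : ℝ))
            (Fin.last n)).im : ℝ) : ℂ) * I = 0 := by
        rw [← add_mul, ← Complex.ofReal_add]
        simp [localRep]
      rw [this, Complex.exp_zero, one_mul, Complex.ofReal_im]
    have h0 := hreal.self_of_nhds
    have hd := (Complex.imCLM.hasFDerivAt.comp_hasDerivAt 0 hprod).unique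
      ((hasDerivAt_const (0 : ℝ) (0 : ℝ)).congr_of_eventuallyEq hreal)
    simp only [zero_smul, add_zero, hAt0, hBA, Matrix.det_one, mul_one] at h0 hd
    set E := Complex.exp ((s * (F.localRep p (F.base p) (Fin.last n)).im : ℝ) * I)
    have hW : A.det * E = ((A.det * E).re : ℂ) := Complex.ext rfl (by simp [h0])
    have hW0 : (A.det * E).re ≠ 0 := by
      intro h1
      rw [h1, Complex.ofReal_zero] at hW
      exact mul_ne_zero hA0 (Complex.exp_ne_zero _) hW
    have hcalc : A.det * (B * A').trace * E + A.det * (E * ((s * (e l (Fin.last n)).im : ℝ) * I)) =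
        ((A.det * E).re : ℂ) * ((B * A').trace + (s * (e l (Fin.last n)).im : ℝ) * I) := by
      rw [← hW]; ring
    rw [hcalc, Complex.imCLM_apply, Complex.im_ofReal_mul] at hd
    have htr := (mul_eq_zero.1 hd).resolve_left hW0
    rw [Complex.add_im, Complex.im_ofReal_mul, Complex.I_im, mul_one] at htr
    rw [← htr]
    congr 1
    have hinner : ∀ i j, (A.conjTranspose * A') j i = inner ℂ (e j) (F.secondPartial p l i) := by
      intro i j
      rw [PiLp.inner_apply, Matrix.mul_apply]
      refine Finset.sum_congr rfl fun m _ => ?_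
      simp [A, A', mul_comm]
    have : (B * A').trace = ∑ i, ∑ j, (((F.inducedMetric p)⁻¹ i j : ℝ) : ℂ) *
        inner ℂ (e j) (F.secondPartial p l i) := by
      rw [Matrix.mul_assoc, Matrix.trace]
      refine Finset.sum_congr rfl fun i _ => ?_
      rw [Matrix.diag_apply, Matrix.mul_apply]
      exact Finset.sum_congr rfl fun j _ => by rw [hinner]; rfl
    rw [this, Complex.im_sum]
    refine Finset.sum_congr rfl fun i _ => ?_
    rw [Complex.im_sum]
    exact Finset.sum_congr rfl fun j _ => by rw [Complex.im_ofReal_mul]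
  set w : C (n + 1) := ∑ i, ∑ j, (F.inducedMetric p)⁻¹ i j • F.secondPartial p i j with hw
  -- By the symmetry of the cubic form, `key` reads Im ⟨e_l, w - s e_m⟩ = 0 for all l, so w - s e_m
  -- is tangent and its normal part vanishes.
  have hmem : w - s • EuclideanSpace.single (Fin.last n) (1 : ℂ) ∈ F.tangentPlane p := by
    refine hT.mem_of_inner_im fun v hv => ?_
    obtain ⟨c, rfl⟩ := F.exists_eq_sum_partialDeriv p hv
    rw [sum_inner, Complex.im_sum]
    refine Finset.sum_eq_zero fun l _ => ?_
    have hl := key l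
    have hsym : ∀ i j, (inner ℂ (e j) (F.secondPartial p l i)).im =
        (inner ℂ (e l) (F.secondPartial p i j)).im := fun i j => by
      rw [F.secondPartial_symm p l i]; exact F.cubic_symm p j l i
    simp only [hsym] at hl
    have h1 : (inner ℂ (e l) w).im = ∑ i, ∑ j, (F.inducedMetric p)⁻¹ i j *
        (inner ℂ (e l) (F.secondPartial p i j)).im := by
      rw [hw, inner_sum, Complex.im_sum]
      refine Finset.sum_congr rfl fun i _ => ?_
      rw [inner_sum, Complex.im_sum]
      refine Finset.sum_congr rfl fun j _ => ?_
      rw [← Complex.coe_smul, inner_smul_right, Complex.im_ofReal_mul]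
    have h2 : (inner ℂ (e l) (s • EuclideanSpace.single (Fin.last n) (1 : ℂ))).im =
        -(s * (e l (Fin.last n)).im) := by
      rw [← Complex.coe_smul, inner_smul_right, Complex.im_ofReal_mul,
        EuclideanSpace.inner_single_right]
      simp
    have h3 : (inner ℂ (e l) (w - s • EuclideanSpace.single (Fin.last n) (1 : ℂ))).im = 0 := by
      rw [inner_sub_right, Complex.sub_im, h1, h2]
      linarith
    rw [← Complex.coe_smul, inner_smul_left, Complex.conj_ofReal, Complex.im_ofReal_mul, h3,
      mul_zero]
  have hzero : F.normalPart p (w - s • EuclideanSpace.single (Fin.last n) (1 : ℂ)) = 0 := by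
    rw [normalPart, Submodule.starProjection_apply_eq_zero_iff, Submodule.orthogonal_orthogonal]
    exact hmem
  have hlin : F.meanCurvature p = F.normalPart p w := by
    simp only [meanCurvature, normalPart, hw, map_sum, map_smul]
  rw [hlin]
  have hz := hzero
  rw [normalPart, map_sub, sub_eq_zero] at hz
  exact hz

end LagrangianImmersion

/-- The curvature equation follows from the angle equation, and an angle is unique modulo π, so a
single explicit angle at each point carries all the information. -/
theorem isTranslator_iff {n : ℕ} (F : LagrangianImmersion (n + 1)) : IsTranslator F ↔
    ∀ q, IsLagrangianAngle (F.tangentPlane q) (-(F.toFun q (Fin.last n)).im) := by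
  constructor
  · intro h q
    obtain ⟨θ, hθ⟩ := (F.isLagPlane_tangentPlane q).exists_angle
    rw [(F.isLagPlane_tangentPlane q).angle_iff_modEq hθ]
    have h2 := (h.2 q θ hθ)
    have h3 := h2.add_right (-(F.toFun q (Fin.last n)).im)
    simpa using h3.symm
  · intro h
    refine ⟨fun p => ?_, fun p θ hθ => ?_⟩
    · have := F.meanCurvature_eq 1 (by simpa using h) p
      simpa using this
    · have h2 := ((F.isLagPlane_tangentPlane p).angle_iff_modEq (h p) θ).1 hθ
      have h3 := h2.add_right (F.toFun p (Fin.last n)).im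
      simpa using h3

theorem isSpecialLagrangian_iff {n : ℕ} (F : LagrangianImmersion (n + 1)) :
    IsSpecialLagrangian F ↔ ∀ q, IsLagrangianAngle (F.tangentPlane q) 0 := by
  refine ⟨fun h => h.2, fun h => ⟨fun p => ?_, h⟩⟩
  have := F.meanCurvature_eq 0 (by simpa using h) p
  simpa [LagrangianImmersion.normalPart] using this

end

/-! ### Smoothness tools: inverse functions, and manifolds built from charts through an immersion.
-/

section

/-! ### Local diffeomorphisms and left inverses of immersions -/

section Euclidean

variable {E E' : Type*} [NormedAddCommGroup E] [NormedSpace ℝ E] [NormedAddCommGroup E']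
  [NormedSpace ℝ E']

/-- Invertibility of the derivative is an open condition, so the source can be shrunk inside U until
the inverse is smooth on the whole target and not merely at one point. -/
theorem exists_local_diffeo [CompleteSpace E] {U : Set E} (hU : IsOpen U) {φ : E → E'}
    (hφ : ∀ y ∈ U, ContDiffAt ℝ ∞ φ y) {y₀ : E} (hy₀ : y₀ ∈ U) {f' : E ≃L[ℝ] E'}
    (hf' : HasFDerivAt φ (f' : E →L[ℝ] E') y₀) :
    ∃ Ξ : OpenPartialHomeomorph E E', y₀ ∈ Ξ.source ∧ Ξ.source ⊆ U ∧ ⇑Ξ = φ ∧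
      (∀ y ∈ Ξ.source, ∃ f' : E ≃L[ℝ] E', HasFDerivAt φ (f' : E →L[ℝ] E') y) ∧
      ∀ b ∈ Ξ.target, ContDiffAt ℝ ∞ Ξ.symm b := by
  have hn : (∞ : WithTop ℕ∞) ≠ 0 := by simp
  let Ξ₀ := (hφ y₀ hy₀).toOpenPartialHomeomorph φ hf' hn
  have hcont : ContinuousOn (fderiv ℝ φ) U := fun y hy =>
    ((hφ y hy).continuousAt_fderiv hn).continuousWithinAt
  let W : Set E := U ∩ fderiv ℝ φ ⁻¹' Set.range ((↑) : (E ≃L[ℝ] E') → E →L[ℝ] E')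
  have hW : IsOpen W := hcont.isOpen_inter_preimage hU ContinuousLinearEquiv.isOpen
  have hcoe : ⇑(Ξ₀.restrOpen W hW) = φ := rfl
  have hinv : ∀ y ∈ (Ξ₀.restrOpen W hW).source, ∃ f' : E ≃L[ℝ] E',
      HasFDerivAt φ (f' : E →L[ℝ] E') y := by
    rintro y ⟨-, hyU, f', hf'⟩
    refine ⟨f', ?_⟩
    rw [hf']
    exact ((hφ y hyU).differentiableAt hn).hasFDerivAt
  refine ⟨Ξ₀.restrOpen W hW, ⟨(hφ y₀ hy₀).mem_toOpenPartialHomeomorph_source hf' hn, hy₀, f',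
    hf'.fderiv.symm⟩, fun y hy => hy.2.1, hcoe, hinv, fun b hb => ?_⟩
  obtain ⟨g', hg'⟩ := hinv _ ((Ξ₀.restrOpen W hW).map_target hb)
  exact (Ξ₀.restrOpen W hW).contDiffAt_symm hb hg'
    (hφ _ ((Ξ₀.restrOpen W hW).map_target hb).2.1)

/-- If L is a linear left inverse of the derivative, then L ∘ φ is locally invertible, and κ = (L ∘
φ)⁻¹ ∘ L. -/
theorem exists_left_inverse [FiniteDimensional ℝ E] {φ : E → E'} {y₀ : E}
    (hφ : ContDiffAt ℝ ∞ φ y₀) [FiniteDimensional ℝ E']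
    (hinj : Function.Injective (fderiv ℝ φ y₀)) :
    ∃ κ : E' → E, ContDiffAt ℝ ∞ κ (φ y₀) ∧ ∀ᶠ y in 𝓝 y₀, κ (φ y) = y := by
  have hn : (∞ : WithTop ℕ∞) ≠ 0 := by simp
  obtain ⟨L, hL⟩ := (fderiv ℝ φ y₀).toLinearMap.exists_leftInverse_of_injective
    (LinearMap.ker_eq_bot.2 hinj)
  let L' : E' →L[ℝ] E := LinearMap.toContinuousLinearMap L
  have : CompleteSpace E := FiniteDimensional.complete ℝ E
  have hd : HasFDerivAt (L' ∘ φ) ((ContinuousLinearEquiv.refl ℝ E : E ≃L[ℝ] E) : E →L[ℝ] E) y₀ := by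
    have h1 := L'.hasFDerivAt.comp y₀ (hφ.differentiableAt hn).hasFDerivAt
    convert! h1 using 1
    ext v
    exact (LinearMap.congr_fun hL v).symm
  have hc : ContDiffAt ℝ ∞ (L' ∘ φ) y₀ := L'.contDiff.contDiffAt.comp y₀ hφ
  refine ⟨hc.localInverse hd hn ∘ L', ?_, ?_⟩
  · exact (hc.to_localInverse hd hn).comp (φ y₀) L'.contDiff.contDiffAt
  · have hs := (hc.toOpenPartialHomeomorph (L' ∘ φ) hd hn).open_source.mem_nhds
      (hc.mem_toOpenPartialHomeomorph_source hd hn)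
    filter_upwards [hs] with y hy
    exact (hc.toOpenPartialHomeomorph (L' ∘ φ) hd hn).left_inv hy

end Euclidean

namespace LagrangianImmersion

variable {N : ℕ} (F : LagrangianImmersion N)

/-- An immersion has a smooth local left inverse. -/
theorem exists_left_inverse (p : F.carrier) : ∃ κ : C N → F.carrier,
    ContMDiffAt 𝓘(ℝ, C N) (𝓡 N) ∞ κ (F.toFun p) ∧ ∀ᶠ q in 𝓝 p, κ (F.toFun q) = q := by
  have hb := F.base_mem p
  obtain ⟨κ, hκ, hκF⟩ := CohomTwo.exists_left_inverse (F.contDiffAt_localRep p hb)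
    (F.injective_fderiv_localRep p hb)
  have hFp : F.localRep p (F.base p) = F.toFun p := by
    rw [localRep, Function.comp, F.symm_base]
  rw [hFp] at hκ
  have hκp : κ (F.toFun p) = F.base p := by rw [← hFp]; exact hκF.self_of_nhds
  let c := chartAt (EuclideanSpace ℝ (Fin N)) p
  refine ⟨c.symm ∘ κ, ?_, ?_⟩
  · have h1 : ContMDiffAt (𝓡 N) (𝓡 N) ∞ c.symm (κ (F.toFun p)) := by
      rw [hκp]
      exact (contMDiffOn_chart_symm (I := 𝓡 N) (n := ∞) (x := p)).contMDiffAt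
        (c.open_target.mem_nhds hb)
    exact h1.comp _ (contMDiffAt_iff_contDiffAt.2 hκ)
  · have hc : ContinuousAt c p := c.continuousAt (mem_chart_source _ p)
    filter_upwards [hc.eventually hκF, c.open_source.mem_nhds (mem_chart_source _ p)] with q hq hqs
    have : F.localRep p (c q) = F.toFun q := by
      change F.toFun (c.symm (c q)) = _
      rw [c.left_inv hqs]
    rw [this] at hq
    change c.symm (κ (F.toFun q)) = q
    rw [hq, c.left_inv hqs]

/-- A continuous map into an immersed submanifold is smooth if it is smooth in the ambient
space. -/
theorem contMDiff_of_comp {E' H' M' : Type*} [NormedAddCommGroup E'] [NormedSpace ℝ E']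
    [TopologicalSpace H'] {I' : ModelWithCorners ℝ E' H'} [TopologicalSpace M']
    [ChartedSpace H' M'] {h : M' → F.carrier} (hc : Continuous h)
    (hs : ContMDiff I' 𝓘(ℝ, C N) ∞ (F.toFun ∘ h)) : ContMDiff I' (𝓡 N) ∞ h := by
  intro x
  obtain ⟨κ, hκ, hκF⟩ := F.exists_left_inverse (h x)
  have h1 : ContMDiffAt I' (𝓡 N) ∞ (κ ∘ (F.toFun ∘ h)) x := ContMDiffAt.comp x hκ hs.contMDiffAt
  refine h1.congr_of_eventuallyEq ?_
  filter_upwards [hc.continuousAt.eventually hκF] with y hy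
  exact hy.symm

variable {F}

/-- It serves for the inclusions of slices, for the action of group elements and for
reparametrisations: a lift of an ambient linear map only has to be checked for continuity. -/
theorem contMDiff_of_comp_eq {N' : ℕ} {F' : LagrangianImmersion N'} {σ : F.carrier → F'.carrier}
    (hσ : Continuous σ) (A : C N →L[ℝ] C N') (h : ∀ q, F'.toFun (σ q) = A (F.toFun q)) :
    ContMDiff (𝓡 N) (𝓡 N') ∞ σ := by
  refine F'.contMDiff_of_comp hσ ?_
  have e : F'.toFun ∘ σ = A ∘ F.toFun := funext h
  rw [e]
  exact (A.contDiff.contMDiff).comp F.smooth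

theorem map_tangentPlane_le {N' : ℕ} {F' : LagrangianImmersion N'} {σ : F.carrier → F'.carrier}
    (hσ : Continuous σ) (A : C N →L[ℝ] C N') (h : ∀ q, F'.toFun (σ q) = A (F.toFun q))
    (p : F.carrier) {v : C N} (hv : v ∈ F.tangentPlane p) : A v ∈ F'.tangentPlane (σ p) := by
  obtain ⟨u, rfl⟩ := hv
  have hs := contMDiff_of_comp_eq hσ A h
  have e : F'.toFun ∘ σ = A ∘ F.toFun := funext h
  have h1 := mfderiv_comp p (F'.smooth.mdifferentiableAt (by simp))
    (hs.mdifferentiableAt (by simp) (x := p))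
  have h2 := mfderiv_comp p (A.contDiff.contMDiff (n := ∞) |>.mdifferentiableAt (by simp))
    (F.smooth.mdifferentiableAt (by simp) (x := p))
  rw [e, h2, mfderiv_eq_fderiv, A.fderiv] at h1
  exact ⟨_, (DFunLike.congr_fun h1 u).symm⟩

end LagrangianImmersion

/-! ### Immersed submanifolds from local charts -/

section Charts

variable {N : ℕ} {X : Type} [TopologicalSpace X]

/-- `F` is a Lagrangian immersion near `x`. -/
def HasChart (F : X → C N) (x : X) : Prop :=
  ∃ e : OpenPartialHomeomorph X (EuclideanSpace ℝ (Fin N)), x ∈ e.source ∧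
    (∀ y ∈ e.target, ContDiffAt ℝ ∞ (F ∘ e.symm) y ∧
      Function.Injective (fderiv ℝ (F ∘ e.symm) y)) ∧
    -- Isotropy is asked only at the centre, because every point is the centre of its own chart.
    ∀ u v, (inner ℂ (fderiv ℝ (F ∘ e.symm) (e x) u) (fderiv ℝ (F ∘ e.symm) (e x) v)).im = 0

theorem HasChart.of_model {B : Type*} [NormedAddCommGroup B] [NormedSpace ℝ B]
    [FiniteDimensional ℝ B] (hB : Module.finrank ℝ B = N) {F : X → C N} {x : X}
    (e : OpenPartialHomeomorph X B) (hx : x ∈ e.source)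
    (h : ∀ y ∈ e.target, ContDiffAt ℝ ∞ (F ∘ e.symm) y ∧
      Function.Injective (fderiv ℝ (F ∘ e.symm) y))
    (h' : ∀ u v, (inner ℂ (fderiv ℝ (F ∘ e.symm) (e x) u)
      (fderiv ℝ (F ∘ e.symm) (e x) v)).im = 0) : HasChart F x := by
  let L : B ≃L[ℝ] EuclideanSpace ℝ (Fin N) :=
    ContinuousLinearEquiv.ofFinrankEq (by rw [hB, finrank_euclideanSpace_fin])
  have hcomp : F ∘ (e.transHomeomorph L.toHomeomorph).symm = (F ∘ e.symm) ∘ L.symm := rfl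
  have hf : ∀ y, fderiv ℝ ((F ∘ e.symm) ∘ L.symm) y =
      (fderiv ℝ (F ∘ e.symm) (L.symm y)).comp (L.symm : EuclideanSpace ℝ (Fin N) →L[ℝ] B) :=
    fun y => L.symm.comp_right_fderiv
  refine ⟨e.transHomeomorph L.toHomeomorph, by simpa using hx, fun y hy => ?_, fun u v => ?_⟩
  · obtain ⟨h1, h2⟩ := h (L.symm y) hy
    rw [hcomp, hf]
    exact ⟨h1.comp y L.symm.contDiff.contDiffAt, h2.comp L.symm.injective⟩
  · rw [hcomp, hf]
    have : L.symm ((e.transHomeomorph L.toHomeomorph) x) = e x := L.symm_apply_apply (e x)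
    rw [this]
    exact h' _ _

variable {F : X → C N}

/-- The charted space structure given by local charts. -/
@[reducible]
def chartedSpaceOfCharts (h : ∀ x, HasChart F x) : ChartedSpace (EuclideanSpace ℝ (Fin N)) X where
  atlas := Set.range fun x => (h x).choose
  chartAt x := (h x).choose
  mem_chart_source x := (h x).choose_spec.1
  chart_mem_atlas x := ⟨x, rfl⟩

/-- A transition map equals κ ∘ (F ∘ e⁻¹) with κ a smooth local left inverse of F ∘ e'⁻¹. Its
continuity keeps it in the range where κ inverts. -/
theorem isManifoldOfCharts (h : ∀ x, HasChart F x) :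
    @IsManifold ℝ _ _ _ _ _ _ (𝓡 N) ∞ X _ (chartedSpaceOfCharts h) := by
  let _ : ChartedSpace (EuclideanSpace ℝ (Fin N)) X := chartedSpaceOfCharts h
  refine isManifold_of_contDiffOn (𝓡 N) ∞ X ?_
  rintro _ _ ⟨x, rfl⟩ ⟨x', rfl⟩
  have hx := (h x).choose_spec.2.1
  have hx' := (h x').choose_spec.2.1
  beta_reduce
  generalize (h x).choose = e at hx ⊢
  generalize (h x').choose = e' at hx' ⊢
  intro y hy
  simp only [modelWithCornersSelf_coe, modelWithCornersSelf_coe_symm, Set.preimage_id,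
    Set.range_id, Set.inter_univ] at hy ⊢
  refine ContDiffAt.contDiffWithinAt ?_
  obtain ⟨hy1, hy2⟩ := (Set.ext_iff.1 (e.symm.trans_source e') y).1 hy
  rw [OpenPartialHomeomorph.symm_source] at hy1
  have hy3 := e'.map_source hy2
  obtain ⟨κ, hκ, hκF⟩ := exists_left_inverse (hx' _ hy3).1 (hx' _ hy3).2
  have hFy : (F ∘ e'.symm) (e' (e.symm y)) = (F ∘ e.symm) y := by
    simp [e'.left_inv hy2]
  rw [hFy] at hκ
  have h1 : ContDiffAt ℝ ∞ (κ ∘ (F ∘ e.symm)) y := hκ.comp y (hx y hy1).1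
  refine h1.congr_of_eventuallyEq ?_
  have hc : ContinuousAt (fun y => e' (e.symm y)) y :=
    ContinuousAt.comp (e'.continuousAt hy2) (e.symm.continuousAt hy1)
  have hs : ∀ᶠ z in 𝓝 y, z ∈ (e.symm ≫ₕ e').source := (e.symm ≫ₕ e').open_source.mem_nhds hy
  filter_upwards [hc.eventually hκF, hs] with z hz hz2
  have hz3 : e.symm z ∈ e'.source :=
      ((Set.ext_iff.1 (e.symm.trans_source e') z).1 hz2).2
  simp only [Function.comp, e'.left_inv hz3] at hz
  exact hz.symm

/-- The immersed Lagrangian given by local charts. -/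
def LagrangianImmersion.ofCharts [T2Space X] [SecondCountableTopology X]
    (h : ∀ x, HasChart F x) : LagrangianImmersion N :=
  letI := chartedSpaceOfCharts h
  haveI := isManifoldOfCharts h
  have hcont : Continuous F := continuous_iff_continuousAt.2 fun x => by
    obtain ⟨e, hx, h1, -⟩ := h x
    have h2 := (h1 _ (e.map_source hx)).1.continuousAt
    have h3 : ContinuousAt ((F ∘ e.symm) ∘ e) x := ContinuousAt.comp h2 (e.continuousAt hx)
    refine h3.congr ?_
    filter_upwards [e.open_source.mem_nhds hx] with y hy
    simp [e.left_inv hy]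
  have hsmooth : ContMDiff (𝓡 N) 𝓘(ℝ, C N) ∞ F := fun x => by
    rw [contMDiffAt_iff]
    refine ⟨hcont.continuousAt, ?_⟩
    simp only [extChartAt_model_space_eq_id, PartialEquiv.refl_coe, modelWithCornersSelf_coe,
      Set.range_id, contDiffWithinAt_univ]
    exact ((h x).choose_spec.2.1 _ ((h x).choose.map_source (h x).choose_spec.1)).1
  have hmf : ∀ x, mfderiv (𝓡 N) 𝓘(ℝ, C N) F x =
      fderiv ℝ (F ∘ (h x).choose.symm) ((h x).choose x) := fun x => by
    refine (hsmooth.mdifferentiableAt (x := x) (by simp)).mfderiv.trans ?_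
    simp only [modelWithCornersSelf_coe, Set.range_id, fderivWithin_univ]
    rfl
  { carrier := X
    toFun := F
    smooth := hsmooth
    immersive := fun x => by
      have e := hmf x
      rw [e]
      exact ((h x).choose_spec.2.1 _ ((h x).choose.map_source (h x).choose_spec.1)).2
    lagrangian := fun x u v =>
      (congrArg₂ (kahlerForm (N := N)) (DFunLike.congr_fun (hmf x) u)
        (DFunLike.congr_fun (hmf x) v)).trans
        ((kahlerForm_eq _ _).trans ((h x).choose_spec.2.2 u v)) }

end Charts

/-- The chart of a subset that is a coordinate slice. -/
theorem exists_slice_chart {M A B : Type*} [TopologicalSpace M] [TopologicalSpace A]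
    [TopologicalSpace B] [Zero A] {S : Set M} (x₀ : S) (Θ : OpenPartialHomeomorph M (A × B))
    (hx₀ : (x₀ : M) ∈ Θ.source) (h : ∀ x ∈ Θ.source, x ∈ S ↔ (Θ x).1 = 0) :
    ∃ e : OpenPartialHomeomorph S B, x₀ ∈ e.source ∧ (∀ x, e x = (Θ x).2) ∧
      ∀ b ∈ e.target, ((0, b) : A × B) ∈ Θ.target ∧ (e.symm b : M) = Θ.symm (0, b) := by
  classical
  have hmem : ∀ b, ((0, b) : A × B) ∈ Θ.target → Θ.symm (0, b) ∈ S := fun b hb => by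
    rw [h _ (Θ.map_target hb), Θ.right_inv hb]
  -- The value x₀ off the target is never used.
  let inv : B → S := fun b => if hb : ((0, b) : A × B) ∈ Θ.target then ⟨Θ.symm (0, b), hmem b hb⟩
    else x₀
  have hinv : ∀ b, ((0, b) : A × B) ∈ Θ.target → (inv b : M) = Θ.symm (0, b) := fun b hb => by
    simp [inv, hb]
  have hΘ : ∀ x : S, (x : M) ∈ Θ.source → Θ x = (0, (Θ x).2) := fun x hx =>
    Prod.ext ((h x hx).1 x.2) rfl
  refine ⟨{
    toFun := fun x => (Θ x).2
    invFun := inv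
    source := {x | (x : M) ∈ Θ.source}
    target := {b | ((0, b) : A × B) ∈ Θ.target}
    map_source' := fun x hx => by
      change ((0, (Θ x).2) : A × B) ∈ Θ.target
      rw [← hΘ x hx]; exact Θ.map_source hx
    map_target' := fun b hb => by
      change (inv b : M) ∈ Θ.source
      rw [hinv b hb]; exact Θ.map_target hb
    left_inv' := fun x hx => by
      have hb : ((0, (Θ x).2) : A × B) ∈ Θ.target := by rw [← hΘ x hx]; exact Θ.map_source hx
      refine Subtype.ext ?_
      rw [hinv _ hb, ← hΘ x hx, Θ.left_inv hx]
    right_inv' := fun b hb => by rw [hinv b hb, Θ.right_inv hb]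
    open_source := Θ.open_source.preimage continuous_subtype_val
    open_target := Θ.open_target.preimage (by fun_prop)
    continuousOn_toFun := by
      refine continuous_snd.comp_continuousOn (Θ.continuousOn.comp
        continuous_subtype_val.continuousOn fun x hx => hx)
    continuousOn_invFun := by
      rw [Topology.IsInducing.subtypeVal.continuousOn_iff]
      refine ContinuousOn.congr (f := fun b => Θ.symm (0, b)) ?_ fun b hb => hinv b hb
      exact Θ.continuousOn_symm.comp (by fun_prop) fun b hb => hb }, hx₀, fun _ => rfl,
    fun b hb => ⟨hb, hinv b hb⟩⟩

end

/-! ### Slicing a Lagrangian in μ⁻¹(0) × ℂ by P × ℂ. -/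

section

/-! ### The action on `ℂ^{n+1}` -/

section Action

variable {n : ℕ}

theorem ext_apply (g : SU n) (w : C (n + 1)) :
    ext n g w = pair (gop g (head w)) (w (Fin.last n)) := rfl

@[simp] theorem ext_pair (g : SU n) (z : C n) (s : ℂ) :
    ext n g (pair z s) = pair (gop g z) s := by
  rw [ext_apply, head_pair, pair_last]

theorem ext_mul_apply (g h : SU n) (w : C (n + 1)) : ext n (g * h) w = ext n g (ext n h w) := by
  rw [map_mul]; rfl

@[simp] theorem ext_one_apply (w : C (n + 1)) : ext n (1 : SU n) w = w := by
  rw [map_one]; rfl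

@[simp] theorem ext_inv_apply (g : SU n) (w : C (n + 1)) : ext n g⁻¹ (ext n g w) = w := by
  rw [← ext_mul_apply]; simp

theorem head_ext (g : SU n) (w : C (n + 1)) : head (ext n g w) = gop g (head w) := by
  rw [ext_apply, head_pair]

theorem ext_last (g : SU n) (w : C (n + 1)) : ext n g w (Fin.last n) = w (Fin.last n) := by
  rw [ext_apply, pair_last]

/-- The action of a group element, as a continuous linear map. -/
def extL (g : SU n) : C (n + 1) →L[ℂ] C (n + 1) := LinearMap.toContinuousLinearMap (ext n g)

theorem inner_eq_head (v w : C (n + 1)) :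
    inner ℂ v w = inner ℂ (head v) (head w) + inner ℂ (v (Fin.last n)) (w (Fin.last n)) := by
  conv_lhs => rw [← pair_head v, ← pair_head w, inner_pair]

theorem inner_ext (g : SU n) (v w : C (n + 1)) :
    inner ℂ (ext n g v) (ext n g w) = inner ℂ v w := by
  rw [ext_apply, ext_apply, inner_pair, inner_gop, ← inner_eq_head]

/-- The first component, as a continuous linear map. -/
def headL (n : ℕ) : C (n + 1) →L[ℂ] C n := LinearMap.toContinuousLinearMap
  { toFun := head
    map_add' := fun _ _ => rfl
    map_smul' := fun _ _ => rfl }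

@[simp] theorem headL_apply (w : C (n + 1)) : headL n w = head w := rfl

/-- The pairing, as a continuous linear map. -/
def pairL (n : ℕ) : C n × ℂ →L[ℂ] C (n + 1) := LinearMap.toContinuousLinearMap
  { toFun := fun w => pair w.1 w.2
    map_add' := fun _ _ => pair_add _ _ _ _
    map_smul' := fun _ _ => pair_smul _ _ _ }

theorem continuous_ext : Continuous fun x : SU n × C (n + 1) => ext n x.1 x.2 := by
  have h1 : Continuous fun x : SU n × C (n + 1) => gop x.1 (headL n x.2) :=
    (continuous_gop.comp continuous_fst).clm_apply ((headL n).continuous.comp continuous_snd)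
  have h2 : Continuous fun x : SU n × C (n + 1) => x.2 (Fin.last n) := by fun_prop
  exact (pairL n).continuous.comp (h1.prodMk h2)

/-- The embedding `emb p`, as a continuous linear map. -/
def embL (p : C n) : C 2 →L[ℂ] C (n + 1) := LinearMap.toContinuousLinearMap (emb p)

/-- The orthogonal projection onto `ℂ p × ℂ`, in the coordinates of `ℂ²`. -/
def coproj (p : C n) : C (n + 1) →L[ℂ] C 2 := LinearMap.toContinuousLinearMap
  { toFun := fun w => WithLp.toLp 2 ![inner ℂ p (head w), w (Fin.last n)]
    map_add' := fun v w => by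
      ext i
      fin_cases i
      · exact inner_add_right (𝕜 := ℂ) p (head v) (head w)
      · simp
    map_smul' := fun c w => by
      ext i
      fin_cases i
      · exact inner_smul_right (𝕜 := ℂ) p (head w) c
      · simp }

@[simp] theorem coproj_zero (p : C n) (w : C (n + 1)) : coproj p w 0 = inner ℂ p (head w) := rfl

@[simp] theorem coproj_one (p : C n) (w : C (n + 1)) : coproj p w 1 = w (Fin.last n) := rfl

@[simp] theorem head_emb (p : C n) (x : C 2) : head (emb p x) = x 0 • p := by
  rw [emb_apply, head_pair]

@[simp] theorem emb_last (p : C n) (x : C 2) : emb p x (Fin.last n) = x 1 := by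
  rw [emb_apply, pair_last]

theorem inner_self_of_norm_one {p : C n} (hp : ‖p‖ = 1) : inner ℂ p p = (1 : ℂ) := by
  rw [inner_self_eq_norm_sq_to_K, hp]; simp

theorem coproj_emb {p : C n} (hp : ‖p‖ = 1) (x : C 2) : coproj p (emb p x) = x := by
  ext i
  fin_cases i
  · simp [hp]
  · simp

theorem emb_injective {p : C n} (hp : ‖p‖ = 1) : Function.Injective (emb p) :=
  Function.LeftInverse.injective (coproj_emb hp)

theorem emb_coproj {p : C n} (hp : ‖p‖ = 1) {w : C (n + 1)} {c : ℂ} (hw : head w = c • p) :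
    emb p (coproj p w) = w := by
  conv_rhs => rw [← pair_head w]
  rw [emb_apply, coproj_zero, coproj_one, hw, inner_smul_right, inner_self_of_norm_one hp, mul_one]

end Action

/-! ### Tangent planes of Lagrangians over the zero set of the moment map -/

variable {k : ℕ} {G : Subgroup (SU (k + 1))}

/-- The tangent planes of a Lagrangian in `μ⁻¹(0) × ℂ` contain the tangent spaces of the orbits. -/
theorem pair_mem_tangentPlane {F : LagrangianImmersion (k + 2)}
    (hF : ∀ q, MZero G (head (F.toFun q))) (q : F.carrier) {v : C (k + 1)}
    (hv : v ∈ tang G (head (F.toFun q))) : pair v 0 ∈ F.tangentPlane q := by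
  obtain ⟨X, hX, rfl⟩ := hv
  -- Differentiating ⟨Xz, z⟩ = 0 along the immersion shows that Xz is symplectically orthogonal to
  -- the tangent plane, hence contained in it.
  refine (F.isLagPlane_tangentPlane q).mem_of_inner_im fun w hw => ?_
  rw [← F.symm_base q, ← F.range_fderiv_localRep q (F.base_mem q)] at hw
  obtain ⟨y, rfl⟩ := hw
  have hd := ((F.contDiffAt_localRep q (F.base_mem q)).differentiableAt (by simp)).hasFDerivAt
  have h1 := ((headL (k + 1)).restrictScalars ℝ).hasFDerivAt.comp _ hd
  have h2 := ((op X).restrictScalars ℝ).hasFDerivAt.comp _ h1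
  have h3 := (h2.inner ℂ h1).unique ((hasFDerivAt_const (0 : ℂ) _).congr_of_eventuallyEq
    (Eventually.of_forall fun x => hF _ X hX))
  have h4 := congrArg Complex.im (DFunLike.congr_fun h3 y)
  have hb : F.localRep q (F.base q) = F.toFun q := by
    rw [LagrangianImmersion.localRep, Function.comp, F.symm_base]
  simp only [ContinuousLinearMap.comp_apply, ContinuousLinearMap.prod_apply,
    fderivInnerCLM_apply, Function.comp, ContinuousLinearMap.coe_restrictScalars',
    zero_apply, Complex.zero_im, headL_apply, hb, inner_op_left hX _ (head (F.toFun q)),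
    Complex.add_im, Complex.neg_im] at h4
  rw [← inner_conj_symm (op X _), Complex.conj_im] at h4
  rw [inner_eq_head, head_pair, pair_last, inner_zero_right, add_zero]
  simp only [evalOp_apply]
  change (inner ℂ (head (fderiv ℝ (F.localRep q) (F.base q) y)) _).im = 0
  linarith

/-- The orbit directions lie in the tangent plane because L is over μ⁻¹(0), the remaining two
because ι lifts `emb p`; together they are the adapted frame of `angle_orbitFrame_iff`. -/
theorem angle_slice_iff {p : C (k + 1)} {e : Fin k → C (k + 1)}
    (he : ∀ i, e i ∈ tang G p)
    (ho : Orthonormal ℂ (Fin.snoc e p : Fin (k + 1) → C (k + 1)))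
    (h1 : holVol (orbitFrame e p 1 fun j => EuclideanSpace.single j 1) = 1)
    {F : LagrangianImmersion (k + 2)} {f : LagrangianImmersion 2}
    {ι : f.carrier → F.carrier} (hι : Continuous ι) (hFι : ∀ x, F.toFun (ι x) = emb p (f.toFun x))
    (hF : ∀ q, MZero G (head (F.toFun q))) {x : f.carrier} (hx : k = 0 ∨ f.toFun x 0 ≠ 0) (θ : ℝ) :
    IsLagrangianAngle (F.tangentPlane (ι x)) θ ↔
      IsLagrangianAngle (f.tangentPlane x) (θ - k * Complex.arg (f.toFun x 0)) := by
  refine angle_orbitFrame_iff he ho h1 (F.isLagPlane_tangentPlane _)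
    (f.isLagPlane_tangentPlane _) hx (fun v hv => ?_) (fun v hv => ?_) θ
  · refine pair_mem_tangentPlane hF _ ?_
    rwa [hFι, head_emb]
  · exact LagrangianImmersion.map_tangentPlane_le hι ((embL p).restrictScalars ℝ) hFι x hv

/-! ### The slice -/

/-- At a point of the line of a regular point, one may rotate the regular point. -/
theorem Reg.exists_rotate {p : C (k + 1)} (hp : Reg G p) {c : ℂ} (hc : k = 0 ∨ c ≠ 0) :
    ∃ p₀, Reg G p₀ ∧ (∃ u : ℂ, p₀ = u • p) ∧ tang G (c • p) = tang G p₀ ∧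
      ∀ᶠ z in 𝓝 (c • p), MZero G z → (∀ v ∈ tang G p₀, (inner ℂ v z).re = 0) →
        z = inner ℂ p₀ z • p₀ := by
  by_cases hk : k = 0
  · subst hk
    have hbot : tang G p = ⊥ := Submodule.finrank_eq_zero.1 hp.finrank_tang
    refine ⟨p, hp, ⟨1, (one_smul _ _).symm⟩, ?_, Eventually.of_forall fun z _ hz => ?_⟩
    · rw [tang_smul_eq, hbot, Submodule.map_bot]
    · obtain ⟨u, hu, h⟩ := hp.exists_eq_add hz
      rw [hbot, Submodule.mem_bot] at hu
      rwa [hu, smul_zero, add_zero] at h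
  · have hc0 := hc.resolve_left hk
    have hn : (‖c‖ : ℂ) ≠ 0 := by simpa using hc0
    have hu : ‖c / ‖c‖‖ = 1 := by simp [hc0]
    have hreg := hp.smul hu
    -- The phase of c is absorbed in p₀, since `Reg.eventually_mem_line` works at positive real
    -- multiples of a regular point.
    have e1 : c • p = ((‖c‖ : ℝ) : ℂ) • ((c / ‖c‖) • p) := by
      rw [smul_smul, mul_div_cancel₀ _ hn]
    refine ⟨(c / ‖c‖) • p, hreg, ⟨_, rfl⟩, ?_, ?_⟩
    · rw [e1, tang_smul_eq]
      ext v
      constructor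
      · rintro ⟨w, hw, rfl⟩
        exact Submodule.smul_mem _ ‖c‖ hw
      · intro hv
        refine ⟨‖c‖⁻¹ • v, Submodule.smul_mem _ _ hv, ?_⟩
        change (‖c‖ : ℂ) • (‖c‖⁻¹ • v) = v
        rw [Complex.coe_smul, smul_smul, mul_inv_cancel₀ (by simpa using hc0), one_smul]
    · rw [e1]
      exact hreg.eventually_mem_line (by simpa using hc0)

theorem Reg.inner_tang_smul {p v : C (k + 1)} (hp : Reg G p) {c d : ℂ}
    (hv : v ∈ tang G (c • p)) : inner ℂ v (d • p) = 0 := by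
  obtain ⟨w, hw, rfl⟩ := tang_smul _ hv
  rw [inner_smul_left, inner_smul_right, hp.mzero.inner_tang hw]; simp

/-- The intersection of a Lagrangian with `P × ℂ` is a Lagrangian surface. -/
theorem hasChart_slice {p : C (k + 1)} (hp : Reg G p) (F : LagrangianImmersion (k + 2))
    (hF : ∀ q, MZero G (head (F.toFun q)))
    (hreg : ∀ q (c : ℂ), head (F.toFun q) = c • p → k = 0 ∨ c ≠ 0)
    (x₀ : {q : F.carrier | ∃ c : ℂ, head (F.toFun q) = c • p}) :
    HasChart (fun x : {q : F.carrier | ∃ c : ℂ, head (F.toFun q) = c • p} =>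
      coproj p (F.toFun x)) x₀ := by
  obtain ⟨q₀, c₀, hq₀⟩ := x₀
  obtain ⟨p₀, hp₀, ⟨u₀, hu₀⟩, htang, hev⟩ := hp.exists_rotate (hreg q₀ c₀ hq₀)
  set S := tang G p₀ with hS
  have hST : ∀ v ∈ S, pair v 0 ∈ F.tangentPlane q₀ := fun v hv =>
    pair_mem_tangentPlane hF q₀ (by rw [hq₀, htang]; exact hv)
  have hT := F.isLagPlane_tangentPlane q₀
  have hSp : ∀ v ∈ S, ∀ d : ℂ, inner ℂ v (d • p) = 0 := fun v hv d => by
    rw [hS, hu₀] at hv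
    exact hp.inner_tang_smul hv
  -- T' is the future tangent plane of the slice. The map l splits the tangent plane T of L as S ⊕
  -- T', orbit directions and slice directions.
  let T' : Submodule ℝ (C 2) := (F.tangentPlane q₀).comap ((emb p).restrictScalars ℝ)
  let l1 : C (k + 2) →L[ℝ] S := S.orthogonalProjectionOnto.comp ((headL (k + 1)).restrictScalars ℝ)
  let l2 : C (k + 2) →L[ℝ] T' := T'.orthogonalProjectionOnto.comp ((coproj p).restrictScalars ℝ)
  let l : C (k + 2) →L[ℝ] S × T' := l1.prod l2
  have hl1 : ∀ w, l1 w = 0 ↔ ∀ v ∈ S, (inner ℂ v (head w)).re = 0 := fun w => by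
    change S.orthogonalProjectionOnto (head w) = 0 ↔ _
    rw [Submodule.orthogonalProjectionOnto_eq_zero_iff, Submodule.mem_orthogonal]
    simp only [real_inner_eq]
  have hb : F.localRep q₀ (F.base q₀) = F.toFun q₀ := by
    rw [LagrangianImmersion.localRep, Function.comp, F.symm_base]
  let c := chartAt (EuclideanSpace ℝ (Fin (k + 2))) q₀
  have hφ : ∀ y ∈ c.target, ContDiffAt ℝ ∞ (l ∘ F.localRep q₀) y := fun y hy =>
    l.contDiff.contDiffAt.comp y (F.contDiffAt_localRep q₀ hy)
  have hdφ := ((F.contDiffAt_localRep q₀ (F.base_mem q₀)).differentiableAt (by simp)).hasFDerivAt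
  have hrange := F.range_fderiv_localRep q₀ (F.base_mem q₀)
  rw [F.symm_base] at hrange
  -- A tangent vector killed by l has first component cp₀ + iu with u in S. As S lies in T, isotropy
  -- gives ⟨u, iu⟩ = 0 and so u = 0. The vector then lies in P × ℂ, hence in T', and is orthogonal
  -- to T'.
  have hinj : Function.Injective (l.comp (fderiv ℝ (F.localRep q₀) (F.base q₀))) := by
    rw [injective_iff_map_eq_zero]
    intro y hy
    have hyT : fderiv ℝ (F.localRep q₀) (F.base q₀) y ∈ F.tangentPlane q₀ := by
      rw [← hrange]; exact ⟨y, rfl⟩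
    refine (injective_iff_map_eq_zero _).1 (F.injective_fderiv_localRep q₀ (F.base_mem q₀)) y ?_
    set w := fderiv ℝ (F.localRep q₀) (F.base q₀) y
    have h1 : l1 w = 0 := congrArg Prod.fst hy
    have h2 : l2 w = 0 := congrArg Prod.snd hy
    rw [hl1] at h1
    obtain ⟨u, hu, hwu⟩ := hp₀.exists_eq_add h1
    have h3 := hT.isotropic _ (hST u hu) _ hyT
    rw [inner_eq_head, head_pair, pair_last, inner_zero_left, add_zero] at h3
    have h4 : inner ℂ u (head w) = 0 := Complex.ext (h1 u hu) h3
    rw [hwu, inner_add_right, inner_smul_right, inner_smul_right, hp₀.mzero.inner_tang hu,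
      mul_zero, zero_add, mul_eq_zero] at h4
    have hu0 : u = 0 := inner_self_eq_zero.1 (h4.resolve_left Complex.I_ne_zero)
    rw [hu0, smul_zero, add_zero, hu₀, smul_smul] at hwu
    have hemb := emb_coproj hp.norm_eq hwu
    have hmem : coproj p w ∈ T' := by
      change emb p (coproj p w) ∈ F.tangentPlane q₀
      rw [hemb]; exact hyT
    have h5 : T'.orthogonalProjectionOnto (coproj p w) = ⟨coproj p w, hmem⟩ :=
      Submodule.orthogonalProjectionOnto_mem_subspace_eq_self (⟨coproj p w, hmem⟩ : T')
    have h6 : coproj p w = 0 := congrArg Subtype.val (h5.symm.trans h2)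
    rw [← hemb, h6, map_zero]
  have hsurj : Function.Surjective (l.comp (fderiv ℝ (F.localRep q₀) (F.base q₀))) := by
    rintro ⟨s, t⟩
    have hmem : pair (s : C (k + 1)) 0 + emb p t ∈ F.tangentPlane q₀ :=
      Submodule.add_mem _ (hST _ s.2) t.2
    rw [← hrange] at hmem
    obtain ⟨y, hy⟩ := hmem
    refine ⟨y, ?_⟩
    have hy' : fderiv ℝ (F.localRep q₀) (F.base q₀) y = pair (s : C (k + 1)) 0 + emb p t := hy
    rw [ContinuousLinearMap.comp_apply, hy']
    refine Prod.ext ?_ ?_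
    · change l1 _ = s
      have h1 : l1 (emb p t) = 0 := (hl1 _).2 fun v hv => by rw [head_emb, hSp v hv]; rfl
      rw [map_add, h1, add_zero]
      change S.orthogonalProjectionOnto (head (pair (s : C (k + 1)) 0)) = s
      rw [head_pair]
      exact Submodule.orthogonalProjectionOnto_mem_subspace_eq_self s
    · change l2 _ = t
      have h1 : coproj p (pair (s : C (k + 1)) 0) = 0 := by
        ext i
        fin_cases i
        · have := hSp s s.2 1
          rw [one_smul] at this
          simp [← inner_conj_symm p, this]
        · simp
      change T'.orthogonalProjectionOnto (coproj p (pair (s : C (k + 1)) 0 + emb p t)) = t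
      rw [map_add, h1, zero_add, coproj_emb hp.norm_eq]
      exact Submodule.orthogonalProjectionOnto_mem_subspace_eq_self t
  let f' : EuclideanSpace ℝ (Fin (k + 2)) ≃L[ℝ] S × T' :=
    (LinearEquiv.ofBijective (l.comp (fderiv ℝ (F.localRep q₀) (F.base q₀))).toLinearMap
      ⟨hinj, hsurj⟩).toContinuousLinearEquiv
  have hf' : HasFDerivAt (l ∘ F.localRep q₀)
      (f' : EuclideanSpace ℝ (Fin (k + 2)) →L[ℝ] S × T') (F.base q₀) :=
    (l.hasFDerivAt.comp (F.base q₀) hdφ).congr_fderiv (by ext y <;> rfl)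
  have hdim : Module.finrank ℝ T' = 2 := by
    have h1 := f'.toLinearEquiv.finrank_eq
    rw [finrank_euclideanSpace_fin, Module.finrank_prod, hp₀.finrank_tang] at h1
    omega
  -- Near q₀ the slice is the zero set of the S-component of l ∘ F: a nearby zero of μ orthogonal to
  -- S is already on the line.
  obtain ⟨W, hW, hWo, hq₀W⟩ : ∃ W ⊆ {q : F.carrier |
      (∀ v ∈ S, (inner ℂ v (head (F.toFun q))).re = 0) → ∃ d : ℂ, head (F.toFun q) = d • p},
      IsOpen W ∧ q₀ ∈ W := by
    rw [← mem_nhds_iff]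
    have hcont : ContinuousAt (fun q => head (F.toFun q)) q₀ :=
      ((headL (k + 1)).continuous.comp F.smooth.continuous).continuousAt
    have hev' := hev
    rw [← hq₀] at hev'
    filter_upwards [hcont.eventually hev'] with q hq hperp
    refine ⟨inner ℂ p₀ (head (F.toFun q)) * u₀, ?_⟩
    rw [mul_smul, ← hu₀]
    exact hq (hF q) hperp
  have hUo : IsOpen (c.target ∩ c.symm ⁻¹' W) := c.isOpen_inter_preimage_symm hWo
  obtain ⟨Ξ, hΞ0, hΞU, hΞ, -, hΞs⟩ := exists_local_diffeo hUo (fun y hy => hφ y hy.1)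
    (y₀ := F.base q₀) ⟨F.base_mem q₀, by
      change c.symm (F.base q₀) ∈ W
      rw [F.symm_base]; exact hq₀W⟩ hf'
  have hΘ : ∀ x ∈ (c ≫ₕ Ξ).source, (c ≫ₕ Ξ) x = l (F.toFun x) ∧ x ∈ W := fun x hx => by
    rw [OpenPartialHomeomorph.trans_source] at hx
    have h1 : c.symm (c x) = x := c.left_inv hx.1
    constructor
    · change Ξ (c x) = _
      rw [hΞ]
      change l (F.toFun (c.symm (c x))) = _
      rw [h1]
    · have := (hΞU hx.2).2
      rwa [Set.mem_preimage, h1] at this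
  obtain ⟨e, he0, hee, het⟩ := exists_slice_chart
    (S := {q : F.carrier | ∃ c : ℂ, head (F.toFun q) = c • p}) ⟨q₀, c₀, hq₀⟩ (c ≫ₕ Ξ) (by
      rw [OpenPartialHomeomorph.trans_source]
      exact ⟨mem_chart_source _ q₀, hΞ0⟩) (fun x hx => by
      rw [(hΘ x hx).1]
      change _ ↔ l1 (F.toFun x) = 0
      rw [hl1]
      constructor
      · rintro ⟨d, hd⟩ v hv
        rw [hd, hSp v hv]; rfl
      · exact hW (hΘ x hx).2)
  have hψ : ∀ b ∈ e.target, ContDiffAt ℝ ∞ (fun b => F.localRep q₀ (Ξ.symm (0, b))) b ∧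
      Ξ.symm (0, b) ∈ c.target ∧ ((0, b) : S × T') ∈ Ξ.target := fun b hb => by
    have h1 := (het b hb).1
    rw [OpenPartialHomeomorph.trans_target] at h1
    have h2 : Ξ.symm (0, b) ∈ c.target := h1.2
    refine ⟨?_, h2, h1.1⟩
    have h3 : ContDiffAt ℝ ∞ (fun b : T' => ((0, b) : S × T')) b := by fun_prop
    have h4 : ContDiffAt ℝ ∞ (fun b : T' => Ξ.symm ((0, b) : S × T')) b := (hΞs _ h1.1).comp b h3
    exact ContDiffAt.comp (g := F.localRep q₀) b (F.contDiffAt_localRep q₀ h2) h4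
  let fs : {q : F.carrier | ∃ c : ℂ, head (F.toFun q) = c • p} → C 2 :=
    fun x => coproj p (F.toFun x)
  have hFe : ∀ b ∈ e.target, F.toFun (e.symm b) = F.localRep q₀ (Ξ.symm (0, b)) := fun b hb => by
    rw [(het b hb).2]; rfl
  have hcomp : ∀ b ∈ e.target, fs ∘ e.symm =ᶠ[𝓝 b]
      fun b => coproj p (F.localRep q₀ (Ξ.symm (0, b))) := fun b hb => by
    filter_upwards [e.open_target.mem_nhds hb] with b' hb'
    change coproj p (F.toFun (e.symm b')) = _
    rw [hFe b' hb']
  refine HasChart.of_model hdim e he0 (fun b hb => ?_) ?_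
  · have h1 : ContDiffAt ℝ ∞ (fs ∘ e.symm) b :=
      (((coproj p).restrictScalars ℝ).contDiff.contDiffAt.comp b (hψ b hb).1).congr_of_eventuallyEq
        (hcomp b hb)
    refine ⟨h1, ?_⟩
    -- The slice coordinate is the projection of the position to T', so this projection is a left
    -- inverse of the derivative.
    have h2 := (T'.orthogonalProjectionOnto).hasFDerivAt.comp b
      (h1.differentiableAt (by simp)).hasFDerivAt
    have h3 := h2.unique ((hasFDerivAt_id b).congr_of_eventuallyEq (by
      filter_upwards [e.open_target.mem_nhds hb] with b' hb'
      have h4 : Ξ (Ξ.symm (0, b')) = (0, b') := Ξ.right_inv (hψ b' hb').2.2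
      rw [hΞ] at h4
      have h5 : l2 (F.localRep q₀ (Ξ.symm (0, b'))) = b' := congrArg Prod.snd h4
      change T'.orthogonalProjectionOnto (coproj p (F.toFun (e.symm b'))) = b'
      rw [hFe b' hb']
      exact h5))
    exact Function.LeftInverse.injective (g := T'.orthogonalProjectionOnto)
      fun y => DFunLike.congr_fun h3 y
  · set b₀ := e ⟨q₀, c₀, hq₀⟩ with hb₀
    have hb : b₀ ∈ e.target := e.map_source he0
    have hq : c.symm (Ξ.symm (0, b₀)) = q₀ := by
      have := (het b₀ hb).2
      rw [hb₀, e.left_inv he0] at this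
      exact this.symm
    have hD : ∀ y, emb p (fderiv ℝ (fs ∘ e.symm) b₀ y) ∈ F.tangentPlane q₀ := fun y => by
      have h1 : ContDiffAt ℝ ∞ (fs ∘ e.symm) b₀ :=
        (((coproj p).restrictScalars ℝ).contDiff.contDiffAt.comp b₀
          (hψ b₀ hb).1).congr_of_eventuallyEq (hcomp b₀ hb)
      have h2 := ((embL p).restrictScalars ℝ).hasFDerivAt.comp b₀
        (h1.differentiableAt (by simp)).hasFDerivAt
      have h3 : ContDiffAt ℝ ∞ (fun b : T' => Ξ.symm (0, b)) b₀ :=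
        (hΞs _ (hψ b₀ hb).2.2).comp b₀ (by fun_prop)
      have h4 := ((F.contDiffAt_localRep q₀ (hψ b₀ hb).2.1).differentiableAt
        (by simp)).hasFDerivAt.comp b₀ (h3.differentiableAt (by simp)).hasFDerivAt
      have h5 := h2.unique (h4.congr_of_eventuallyEq (by
        filter_upwards [e.open_target.mem_nhds hb] with b' hb'
        change emb p (coproj p (F.toFun (e.symm b'))) = F.localRep q₀ (Ξ.symm (0, b'))
        obtain ⟨d, hd⟩ := (e.symm b').2
        rw [emb_coproj hp.norm_eq hd, hFe b' hb']))
      have h6 := DFunLike.congr_fun h5 y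
      have h7 : emb p (fderiv ℝ (fs ∘ e.symm) b₀ y) = _ := h6
      have hr := F.range_fderiv_localRep q₀ (hψ b₀ hb).2.1
      change _ = F.tangentPlane (c.symm (Ξ.symm (0, b₀))) at hr
      rw [hq] at hr
      rw [h7]
      refine hr.le ?_
      exact ⟨_, rfl⟩
    intro y y'
    have := hT.isotropic _ (hD y) _ (hD y')
    rwa [inner_emb hp.norm_eq] at this

end

/-! ### Coordinates transverse to the orbits near P × ℂ. -/

section

variable {k : ℕ} {G : Subgroup (SU (k + 1))}

/-! ### Local structure of the orbits of a surface in `P × ℂ` -/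

theorem finite_pow_eq_one {N : ℕ} (hN : N ≠ 0) : {c : ℂ | c ^ N = 1}.Finite := by
  refine (Polynomial.nthRootsFinset N (1 : ℂ)).finite_toSet.subset fun c hc => ?_
  exact (Polynomial.mem_nthRootsFinset (Nat.pos_of_ne_zero hN) 1).2 hc

theorem SU.eq_one (g : SU 1) : g = 1 := by
  have h : g.1.det = 1 := (Matrix.mem_specialUnitaryGroup_iff.1 g.2).2
  rw [Matrix.det_fin_one] at h
  refine Subtype.ext ?_
  ext i j
  fin_cases i
  fin_cases j
  simpa using h

theorem ext_emb_eq {p : C (k + 1)} {g : SU (k + 1)} {x x' : C 2} :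
    emb p x' = ext (k + 1) g (emb p x) ↔ x' 0 • p = gop g (x 0 • p) ∧ x' 1 = x 1 := by
  constructor
  · intro h
    have h1 := congrArg head h
    have h2 := congrArg (fun w : C (k + 2) => w (Fin.last (k + 1))) h
    rw [head_emb, head_ext, head_emb] at h1
    simp only [emb_last, ext_last] at h2
    exact ⟨h1, h2⟩
  · rintro ⟨h1, h2⟩
    rw [emb_apply, emb_apply, ext_pair, h1, h2]

/-- Two points of `P × ℂ` in one orbit differ by a root of unity. -/
theorem Reg.exists_pow_eq_one {p : C (k + 1)} (hp : Reg G p) {g : SU (k + 1)} (hg : g ∈ G)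
    {x x' : C 2} (hx : k = 0 ∨ x 0 ≠ 0) (h : emb p x' = ext (k + 1) g (emb p x)) :
    (k = 0 ∧ x' = x) ∨ (x 0 ≠ 0 ∧ (x' 0 / x 0) ^ (2 * (k + 1)) = 1 ∧ x' 1 = x 1) := by
  by_cases hk : k = 0
  · subst hk
    rw [SU.eq_one g, ext_one_apply] at h
    exact Or.inl ⟨rfl, emb_injective hp.norm_eq h⟩
  · have h0 := hx.resolve_left hk
    obtain ⟨h1, h2⟩ := ext_emb_eq.1 h
    refine Or.inr ⟨h0, hp.pow_eq_one hg ?_, h2⟩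
    rw [map_smul] at h1
    rw [div_eq_inv_mul, mul_smul, h1, smul_smul, inv_mul_cancel₀ h0, one_smul]

/-- Two points of P × ℂ in one orbit have first coordinates whose ratio is a root of unity of
bounded order. Those different from 1 are finitely many, while near b the ratio is close to 1. -/
theorem Reg.exists_nhds_injective {p : C (k + 1)} (hp : Reg G p) {b : C 2}
    (hb : k = 0 ∨ b 0 ≠ 0) : ∃ W : Set (C 2), IsOpen W ∧ b ∈ W ∧ ∀ x ∈ W, ∀ x' ∈ W, ∀ g ∈ G,
      emb p x' = ext (k + 1) g (emb p x) → x' = x := by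
  by_cases hk : k = 0
  · subst hk
    refine ⟨Set.univ, isOpen_univ, trivial, fun x _ x' _ g hg h => ?_⟩
    rw [SU.eq_one g, ext_one_apply] at h
    exact emb_injective hp.norm_eq h
  · have hb0 := hb.resolve_left hk
    have hfin : {c : ℂ | c ^ (2 * (k + 1)) = 1 ∧ c ≠ 1}.Finite :=
      (finite_pow_eq_one (N := 2 * (k + 1)) (by simp)).subset fun c hc => hc.1
    have hcont : ContinuousAt (fun y : C 2 × C 2 => y.2 0 / y.1 0) (b, b) := by
      refine ContinuousAt.div ?_ ?_ hb0 <;> fun_prop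
    have h1 : ∀ᶠ c : ℂ in 𝓝 ((fun y : C 2 × C 2 => y.2 0 / y.1 0) (b, b)),
        c ∉ {c : ℂ | c ^ (2 * (k + 1)) = 1 ∧ c ≠ 1} := by
      refine hfin.isClosed.isOpen_compl.mem_nhds ?_
      simp [hb0]
    have h2 := (hcont.eventually h1).and
      ((show Continuous fun y : C 2 × C 2 => y.1 0 by fun_prop).continuousAt.eventually
        (isOpen_ne.mem_nhds (show (b, b).1 0 ≠ 0 from hb0)))
    rw [nhds_prod_eq] at h2
    obtain ⟨s, hs, t, ht, hst⟩ := eventually_prod_iff.1 h2 |>.imp fun s h => h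
    obtain ⟨W, hW, hWo, hbW⟩ := mem_nhds_iff.1 (hs.and ht)
    refine ⟨W, hWo, hbW, fun x hx x' hx' g hg h => ?_⟩
    obtain ⟨h3, h4⟩ := hst (hW hx).1 (hW hx').2
    rcases hp.exists_pow_eq_one hg (Or.inr h4) h with ⟨-, h5⟩ | ⟨-, h5, h6⟩
    · exact h5
    · have h7 : x' 0 / x 0 = 1 := by
        by_contra hne
        exact h3 ⟨h5, hne⟩
      ext i
      fin_cases i
      · exact (div_eq_one_iff_eq h4).1 h7
      · exact h6

theorem contDiff_expOp {n : ℕ} : ContDiff ℝ ∞ (expOp (n := n)) := by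
  have h1 : ContDiff ℝ ∞ (NormedSpace.exp : (C n →L[ℂ] C n) → (C n →L[ℂ] C n)) :=
    contDiff_iff_contDiffAt.2 fun x => (NormedSpace.exp_analytic (𝕂 := ℝ) x).contDiffAt
  exact h1.comp (LinearMap.toContinuousLinearMap op).contDiff

theorem hasFDerivAt_expOp_zero {n : ℕ} :
    HasFDerivAt (expOp (n := n)) (LinearMap.toContinuousLinearMap op) 0 := by
  have h0 : (LinearMap.toContinuousLinearMap (op (n := n))) 0 = 0 := map_zero _
  have h1 : HasFDerivAt (𝕜 := ℝ) (NormedSpace.exp : (C n →L[ℂ] C n) → (C n →L[ℂ] C n))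
      (1 : (C n →L[ℂ] C n) →L[ℝ] (C n →L[ℂ] C n)) (LinearMap.toContinuousLinearMap op 0) := by
    rw [h0]; exact hasFDerivAt_exp_zero (𝕂 := ℝ)
  exact h1.comp 0 (LinearMap.toContinuousLinearMap op).hasFDerivAt

/-- Only points with σ y = 0 are needed, where the derivative of exp is the identity, so no formula
for the differential of exp elsewhere enters. -/
theorem hasFDerivAt_expOp_apply {n : ℕ} {E : Type*} [NormedAddCommGroup E] [NormedSpace ℝ E]
    (σ : E →L[ℝ] Mat n) (l : E →L[ℝ] C n) {y : E} (hy : σ y = 0) :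
    HasFDerivAt (fun y => expOp (σ y) (l y))
      (l + ((ContinuousLinearMap.apply ℂ (C n) (l y)).restrictScalars ℝ).comp
        ((LinearMap.toContinuousLinearMap op).comp σ)) y := by
  have h1 : HasFDerivAt (fun y => expOp (σ y)) ((LinearMap.toContinuousLinearMap op).comp σ) y := by
    have h : HasFDerivAt (expOp (n := n)) (LinearMap.toContinuousLinearMap op) (σ y) := by
      rw [hy]; exact hasFDerivAt_expOp_zero
    exact h.comp y σ.hasFDerivAt
  let B := (ContinuousLinearMap.restrictScalarsL ℂ (C n) (C n) ℝ ℝ)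
  have h2 : HasFDerivAt (fun y => B (expOp (σ y))) _ y := B.hasFDerivAt.comp y h1
  have h3 := h2.clm_apply (l.hasFDerivAt (x := y))
  refine h3.congr_fderiv ?_
  ext v : 1
  change expOp (σ y) (l v) + op (σ v) (l y) = l v + op (σ v) (l y)
  rw [hy, expOp_zero]
  rfl

section OrbitMap

variable (p : C (k + 1)) {S : Submodule ℝ (C (k + 1))} (σ : S →L[ℝ] Mat (k + 1))

/-- The linear part of the parametrisation of `ℂ^{k+1} × ℂ` near a point of `P × ℂ`. -/
def normalMap : C 2 × S →L[ℝ] C (k + 1) :=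
  ((headL (k + 1)).comp (embL p)).restrictScalars ℝ |>.coprod
    (((I • ContinuousLinearMap.id ℂ (C (k + 1))).restrictScalars ℝ).comp S.subtypeL)

theorem normalMap_apply (y : C 2 × S) : normalMap p y = y.1 0 • p + I • (y.2 : C (k + 1)) := by
  change head (emb p y.1) + _ = _
  rw [head_emb]; rfl

/-- The parametrisation of `ℂ^{k+1} × ℂ` near a point of `P × ℂ`. -/
def orbitMap (y : S × C 2 × S) : C (k + 2) :=
  pair (expOp (σ y.1) (normalMap p y.2)) (y.2.1 1)

theorem contDiff_orbitMap : ContDiff ℝ ∞ (orbitMap p σ) := by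
  have h1 : ContDiff ℝ ∞ fun y : S × C 2 × S => expOp (σ y.1) :=
    contDiff_expOp.comp (σ.contDiff.comp contDiff_fst)
  have h2 : ContDiff ℝ ∞ fun y : S × C 2 × S => normalMap (S := S) p y.2 :=
    (normalMap p).contDiff.comp contDiff_snd
  have h3 : ContDiff ℝ ∞ fun y : S × C 2 × S => y.2.1 1 :=
    ((EuclideanSpace.proj (𝕜 := ℂ) (1 : Fin 2)).restrictScalars ℝ).contDiff.comp
      (contDiff_fst.comp contDiff_snd)
  have hL : ContDiff ℝ ∞ fun A : C (k + 1) →L[ℂ] C (k + 1) => A.restrictScalars ℝ :=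
    (ContinuousLinearMap.restrictScalarsL ℂ (C (k + 1)) (C (k + 1)) ℝ ℝ).contDiff
  have h4 := (hL.comp h1).clm_apply h2
  exact ((pairL (k + 1)).restrictScalars ℝ).contDiff.comp (h4.prodMk h3)

theorem hasFDerivAt_orbitMap {p} {x : C 2} (hσ : ∀ v, op (σ v) (x 0 • p) = v) :
    ∃ D : S × C 2 × S →L[ℝ] C (k + 2), HasFDerivAt (orbitMap p σ) D (0, x, 0) ∧
      ∀ y, D y = pair ((y.1 : C (k + 1)) + normalMap p y.2) (y.2.1 1) := by
  have h0 : σ.comp (ContinuousLinearMap.fst ℝ S (C 2 × S)) (0, x, 0) = 0 := map_zero σ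
  have h1 := hasFDerivAt_expOp_apply (σ.comp (ContinuousLinearMap.fst ℝ S (C 2 × S)))
    ((normalMap p).comp (ContinuousLinearMap.snd ℝ S (C 2 × S))) h0
  have h3 := (((EuclideanSpace.proj (𝕜 := ℂ) (1 : Fin 2)).restrictScalars ℝ).comp
    ((ContinuousLinearMap.fst ℝ _ _).comp (ContinuousLinearMap.snd ℝ S (C 2 × S)))).hasFDerivAt
    (x := ((0, x, 0) : S × C 2 × S))
  refine ⟨_, (((pairL (k + 1)).restrictScalars ℝ).hasFDerivAt).comp ((0, x, 0) : S × C 2 × S)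
    (h1.prodMk h3), fun y => ?_⟩
  have e1 : normalMap (S := S) p (x, 0) = x 0 • p := by rw [normalMap_apply]; simp
  change pair (normalMap p y.2 + op (σ y.1) (normalMap (S := S) p (x, 0))) (y.2.1 1) = _
  rw [e1, hσ, add_comm (normalMap p y.2)]

/-- The spaces S, ℂp and iS are independent: pair with p, and then take the real part of the pairing
with v, using that S is isotropic. -/
theorem Reg.orbitMap_deriv_injective {p : C (k + 1)} (hp : Reg G p)
    (hSp : ∀ v ∈ S, inner ℂ v p = 0) (hSS : ∀ v ∈ S, ∀ w ∈ S, (inner ℂ v w).im = 0)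
    {y : S × C 2 × S} (hy : pair ((y.1 : C (k + 1)) + normalMap p y.2) (y.2.1 1) = 0) : y = 0 := by
  obtain ⟨v, x, u⟩ := y
  rw [normalMap_apply] at hy
  dsimp only at hy
  have h1 := congrArg head hy
  have h2 := congrArg (fun w : C (k + 2) => w (Fin.last (k + 1))) hy
  simp only [head_pair, pair_last] at h1 h2
  have h1' : (v : C (k + 1)) + (x 0 • p + I • (u : C (k + 1))) = 0 := h1
  have hps : ∀ s : S, inner ℂ p (s : C (k + 1)) = 0 := fun s => by
    rw [← inner_conj_symm, hSp s s.2, map_zero]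
  have hx : x 0 = 0 := by
    have := congrArg (inner ℂ p) h1'
    rw [inner_add_right, inner_add_right, inner_smul_right, inner_smul_right, hps, hps,
      inner_self_of_norm_one hp.norm_eq, inner_zero_right] at this
    simpa using this
  rw [hx, zero_smul, zero_add] at h1'
  have hv : v = 0 := by
    have := congrArg (fun z => (inner ℂ (v : C (k + 1)) z).re) h1'
    simp only [inner_add_right, inner_smul_right, inner_zero_right, Complex.add_re,
      Complex.mul_re, Complex.I_re, Complex.I_im, hSS v v.2 u u.2, Complex.zero_re] at this
    have h3 : (inner ℂ (v : C (k + 1)) (v : C (k + 1))).re = 0 := by linarith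
    rw [← real_inner_eq, inner_self_eq_zero] at h3
    exact Subtype.ext h3
  rw [hv, Submodule.coe_zero, zero_add, smul_eq_zero] at h1'
  have hu : u = 0 := Subtype.ext (h1'.resolve_left Complex.I_ne_zero)
  have hx2 : x = 0 := by
    ext i
    fin_cases i
    · exact hx
    · exact h2
  rw [hv, hu, hx2]; rfl

end OrbitMap

/-! ### Local charts under symmetries -/

/-- Charts of an orbit then have to be built only at points of the surface itself. -/
theorem HasChart.translate {N : ℕ} {X : Type} [TopologicalSpace X] {F : X → C N} {x : X}
    (h : HasChart F x) (τ : X ≃ₜ X) (A : C N →L[ℂ] C N)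
    (hA : ∀ v w, inner ℂ (A v) (A w) = inner ℂ v w) (hF : ∀ y, F (τ y) = A (F y)) :
    HasChart F (τ x) := by
  obtain ⟨e, hx, h1, h2⟩ := h
  have hinj : Function.Injective A := by
    rw [injective_iff_map_eq_zero]
    intro v hv
    rw [← inner_self_eq_zero (𝕜 := ℂ), ← hA, hv, inner_zero_left]
  have hcomp : F ∘ (τ.symm.toOpenPartialHomeomorph ≫ₕ e).symm = A ∘ (F ∘ e.symm) := by
    funext y
    exact hF _
  have hd : ∀ y ∈ e.target, fderiv ℝ (A ∘ (F ∘ e.symm)) y =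
      (A.restrictScalars ℝ).comp (fderiv ℝ (F ∘ e.symm) y) := fun y hy =>
    ((A.restrictScalars ℝ).hasFDerivAt.comp y
      ((h1 y hy).1.differentiableAt (by simp)).hasFDerivAt).fderiv
  have ht : ∀ y, y ∈ (τ.symm.toOpenPartialHomeomorph ≫ₕ e).target ↔ y ∈ e.target := fun y => by
    simp
  have hxe : (τ.symm.toOpenPartialHomeomorph ≫ₕ e) (τ x) = e x :=
    congrArg e (τ.symm_apply_apply x)
  refine ⟨τ.symm.toOpenPartialHomeomorph ≫ₕ e, by simpa using hx, fun y hy => ?_, fun u v => ?_⟩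
  · rw [ht] at hy
    rw [hcomp, hd y hy]
    exact ⟨(A.restrictScalars ℝ).contDiff.contDiffAt.comp y (h1 y hy).1, hinj.comp (h1 y hy).2⟩
  · rw [hxe, hcomp, hd _ (e.map_source hx)]
    have := h2 u v
    rw [← hA] at this
    exact this

end

/-! ### Construction of G · Ľ as an equivariant immersed Lagrangian. -/

section

variable {k : ℕ} {G : Subgroup (SU (k + 1))} {p : C (k + 1)}

/-! ### The orbit of a surface in `P × ℂ` -/

/-- A Lagrangian surface in `P × ℂ` with a quotient by identifications induced by `G`. -/
structure OrbitData (G : Subgroup (SU (k + 1))) (p : C (k + 1)) : Type 1 where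
  f : LagrangianImmersion 2
  Q : Type
  [top : TopologicalSpace Q]
  [t2 : T2Space Q]
  [secondCountable : SecondCountableTopology Q]
  proj : f.carrier → Q
  isLocalHomeomorph : IsLocalHomeomorph proj
  exists_of_eq : ∀ x x', proj x = proj x' →
    ∃ h ∈ G, emb p (f.toFun x') = ext (k + 1) h (emb p (f.toFun x))
  ne_zero : ∀ x, k = 0 ∨ f.toFun x 0 ≠ 0

namespace OrbitData

attribute [instance] OrbitData.top OrbitData.t2 OrbitData.secondCountable

variable (D : OrbitData G p)

/-- The total space of the orbit. -/
def Space : Type :=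
  -- A point is its position together with a class in Q. The subspace topology makes the space
  -- Hausdorff and second countable at once, and since G does not move the class, the isotropy group
  -- of a point is that of its position.
  {y : C (k + 2) × D.Q // ∃ g ∈ G, ∃ x, y.2 = D.proj x ∧
    y.1 = ext (k + 1) g (emb p (D.f.toFun x))}

instance : TopologicalSpace D.Space := inferInstanceAs (TopologicalSpace (Subtype _))
instance : T2Space D.Space := inferInstanceAs (T2Space (Subtype _))
instance : SecondCountableTopology D.Space := by
  have : SecondCountableTopology (C (k + 2)) := secondCountable_of_proper
  exact (Topology.IsInducing.subtypeVal (Y := C (k + 2) × D.Q)).secondCountableTopology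

/-- The position of a point of the orbit. -/
def pos (y : D.Space) : C (k + 2) := y.1.1

/-- The point of the orbit of a point of the surface. -/
def incl (x : D.f.carrier) : D.Space :=
  ⟨(emb p (D.f.toFun x), D.proj x), 1, G.one_mem, x, rfl, by simp⟩

/-- The point of the quotient below a point of the orbit. -/
def base (y : D.Space) : D.Q := y.1.2

theorem continuous_pos : Continuous D.pos := continuous_fst.comp continuous_subtype_val

theorem continuous_base : Continuous D.base := continuous_snd.comp continuous_subtype_val

theorem ext_pos_base {y y' : D.Space} (h1 : D.pos y = D.pos y') (h2 : D.base y = D.base y') :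
    y = y' := Subtype.ext (Prod.ext h1 h2)

theorem continuous_iff {Y : Type*} [TopologicalSpace Y] {h : Y → D.Space} :
    Continuous h ↔ Continuous (D.pos ∘ h) ∧ Continuous (D.base ∘ h) :=
  ⟨fun hh => ⟨D.continuous_pos.comp hh, D.continuous_base.comp hh⟩,
    fun hh => (hh.1.prodMk hh.2).subtype_mk _⟩

instance : MulAction G D.Space where
  smul g y := ⟨(ext (k + 1) g y.1.1, y.1.2), by
    obtain ⟨h, hh, x, h1, h2⟩ := y.2
    exact ⟨g * h, G.mul_mem g.2 hh, x, h1, by rw [h2, ext_mul_apply]⟩⟩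
  one_smul y := Subtype.ext (Prod.ext (ext_one_apply _) rfl)
  mul_smul g h y := Subtype.ext (Prod.ext (ext_mul_apply (g : SU (k + 1)) h _) rfl)

theorem base_smul (g : G) (y : D.Space) : D.base (g • y) = D.base y := rfl

theorem pos_smul (g : G) (y : D.Space) : D.pos (g • y) = ext (k + 1) g (D.pos y) := rfl

instance : ContinuousSMul G D.Space where
  continuous_smul := by
    rw [D.continuous_iff]
    constructor
    · have h1 : Continuous fun y : G × D.Space => ((y.1 : SU (k + 1)), D.pos y.2) :=
        (continuous_subtype_val.comp continuous_fst).prodMk (D.continuous_pos.comp continuous_snd)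
      have h2 := (continuous_ext (n := k + 1)).comp h1
      exact h2.congr fun y => (D.pos_smul y.1 y.2).symm
    · have h1 : Continuous fun y : G × D.Space => D.base y.2 :=
        D.continuous_base.comp continuous_snd
      exact h1.congr fun y => (D.base_smul y.1 y.2).symm

theorem exists_smul_incl (y : D.Space) : ∃ (g : G) (x : D.f.carrier), y = g • D.incl x := by
  obtain ⟨⟨w, q⟩, g, hg, x, h1, h2⟩ := y
  exact ⟨⟨g, hg⟩, x, Subtype.ext (Prod.ext h2 h1)⟩

/-- Identifications in Q are induced by G, so any representative of the class may be used. -/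
theorem exists_eq_ext_of_proj_eq (y : D.Space) {x : D.f.carrier} (h : D.base y = D.proj x) :
    ∃ g ∈ G, D.pos y = ext (k + 1) g (emb p (D.f.toFun x)) := by
  obtain ⟨g, hg, x', h1, h2⟩ := y.2
  obtain ⟨g', hg', h3⟩ := D.exists_of_eq x x' (h.symm.trans h1)
  exact ⟨g * g', G.mul_mem hg hg', by rw [ext_mul_apply, ← h3]; exact h2⟩

/-- The coordinates are v in 𝔤z₀, moving along the orbit by exp(σ v), and a chart coordinate b of
the surface. Adding a normal coordinate u gives local coordinates (v, x, u) on ℂ^(k+2), in which the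
orbit is the set u = 0, x = φ(b). -/
theorem hasChart_incl (hG : IsCompact (G : Set (SU (k + 1)))) (hp : Reg G p) (x₀ : D.f.carrier) :
    HasChart D.pos (D.incl x₀) := by
  obtain ⟨W0, hW0, hx₀W, hinj⟩ := hp.exists_nhds_injective (D.ne_zero x₀)
  obtain ⟨p₀, hp₀, ⟨u₀, hu₀⟩, htang, hev⟩ := hp.exists_rotate (D.ne_zero x₀)
  set z₀ := D.f.toFun x₀ 0 • p with hz₀
  obtain ⟨S, hS⟩ : ∃ S, S = tang G z₀ := ⟨_, rfl⟩
  obtain ⟨σ, hσG, hσ⟩ : ∃ σ : S →L[ℝ] Mat (k + 1),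
      (∀ v, σ v ∈ lieAlg G) ∧ ∀ v, op (σ v) z₀ = v := by
    rw [hS]; exact exists_section z₀
  have hfin : Module.finrank ℝ S = k := by rw [hS, htang]; exact hp₀.finrank_tang
  have hSp' : ∀ v ∈ S, ∀ d : ℂ, inner ℂ v (d • p) = 0 := fun v hv d =>
    hp.inner_tang_smul (hS ▸ hv)
  have hSp : ∀ v ∈ S, inner ℂ v p = 0 := fun v hv => by simpa using hSp' v hv 1
  have hSS : ∀ v ∈ S, ∀ w ∈ S, (inner ℂ v w).im = 0 := fun v hv w hw =>
    (hp.mzero.smul _).isotropic (hS ▸ hv) (hS ▸ hw)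
  obtain ⟨W1, hW1, hW1o, hz₀W⟩ := mem_nhds_iff.1 hev
  obtain ⟨D₀, hD₀, hD₀'⟩ := hasFDerivAt_orbitMap (p := p) σ (x := D.f.toFun x₀) hσ
  have hDinj : Function.Injective D₀ := (injective_iff_map_eq_zero D₀).2 fun y hy => by
    rw [hD₀'] at hy
    exact hp.orbitMap_deriv_injective hSp hSS hy
  have hdim : Module.finrank ℝ (S × C 2 × S) = Module.finrank ℝ (C (k + 2)) := by
    rw [Module.finrank_prod, Module.finrank_prod, hfin, finrank_real_of_complex,
      finrank_real_of_complex, finrank_euclideanSpace_fin, finrank_euclideanSpace_fin]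
    omega
  let f' : (S × C 2 × S) ≃L[ℝ] C (k + 2) :=
    (LinearEquiv.ofBijective D₀.toLinearMap ⟨hDinj,
      (LinearMap.injective_iff_surjective_of_finrank_eq_finrank hdim).1
        hDinj⟩).toContinuousLinearEquiv
  have hf' : HasFDerivAt (orbitMap p σ) (f' : (S × C 2 × S) →L[ℝ] C (k + 2))
      (0, D.f.toFun x₀, 0) := hD₀.congr_fderiv (by ext y <;> rfl)
  -- In W0 distinct points of P × ℂ lie in distinct orbits; in W1 zeros of μ orthogonal to S lie on
  -- the line P.
  have hU : IsOpen {y : S × C 2 × S | y.2.1 ∈ W0 ∧ normalMap p y.2 ∈ W1} :=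
    (hW0.preimage (by fun_prop)).inter (hW1o.preimage (by fun_prop))
  have hn₀ : normalMap (S := S) p (D.f.toFun x₀, 0) = z₀ := by rw [normalMap_apply]; simp [hz₀]
  obtain ⟨B, hB0, hBU, hB, hBd, hBs⟩ := exists_local_diffeo hU
    (fun y _ => (contDiff_orbitMap p σ).contDiffAt) (y₀ := (0, D.f.toFun x₀, 0))
    ⟨hx₀W, by rw [hn₀]; exact hz₀W⟩ hf'
  obtain ⟨πl, hπ0, hπ⟩ := D.isLocalHomeomorph x₀
  let c := chartAt (EuclideanSpace ℝ (Fin 2)) x₀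
  have hVo : IsOpen (D.f.toFun ⁻¹' W0) := hW0.preimage D.f.smooth.continuous
  let τ : OpenPartialHomeomorph (EuclideanSpace ℝ (Fin 2)) D.Q :=
    c.symm ≫ₕ πl.restrOpen (D.f.toFun ⁻¹' W0) hVo
  have hτ : ∀ b, τ b = D.proj (c.symm b) := fun b => by rw [hπ]; rfl
  have hτs : ∀ b, b ∈ τ.source ↔ b ∈ c.target ∧ c.symm b ∈ πl.source ∧
      D.f.localRep x₀ b ∈ W0 := fun b => Iff.rfl
  set φ := D.f.localRep x₀ with hφ
  have hφs : ∀ b ∈ τ.source, ContDiffAt ℝ ∞ φ b := fun b hb =>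
    D.f.contDiffAt_localRep x₀ ((hτs b).1 hb).1
  have hφc : ContinuousOn φ τ.source := fun b hb => (hφs b hb).continuousAt.continuousWithinAt
  have hcx : c.symm (c x₀) = x₀ := c.left_inv (mem_chart_source _ x₀)
  have hφx : φ (c x₀) = D.f.toFun x₀ := congrArg D.f.toFun hcx
  have hτx₀ : c x₀ ∈ τ.source := by
    rw [hτs, hcx]
    refine ⟨mem_chart_target _ x₀, hπ0, ?_⟩
    rw [hφx]; exact hx₀W
  have horb : ∀ (v : S) (x : C 2), ∃ h ∈ G, orbitMap p σ (v, x, 0) = ext (k + 1) h (emb p x) :=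
    fun v x => by
    obtain ⟨h, hh, hexp⟩ := exists_gop_eq_exp hG (hσG v)
    refine ⟨h, hh, ?_⟩
    rw [emb_apply, ext_pair, hexp, orbitMap, normalMap_apply]
    simp
  -- Undoing exp(σ v) gives a zero of μ of the form x₀p + iu, which is orthogonal to S; being in W1
  -- it is on the line, so u = 0. Then x and φ(b) are points of W0 in one orbit, hence equal.
  have hkey : ∀ y : D.Space, D.pos y ∈ B.target → D.base y ∈ τ.target →
      B.symm (D.pos y) = ((B.symm (D.pos y)).1, φ (τ.symm (D.base y)), 0) := fun y hy1 hy2 => by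
    have hs := τ.map_target hy2
    have hq : D.base y = D.proj (c.symm (τ.symm (D.base y))) := by rw [← hτ, τ.right_inv hy2]
    obtain ⟨g, hg, hgy⟩ := D.exists_eq_ext_of_proj_eq y hq
    have hgy' : D.pos y = ext (k + 1) g (emb p (φ (τ.symm (D.base y)))) := hgy
    have hbU := hBU (B.map_target hy1)
    have hbr := B.right_inv hy1
    rw [hB] at hbr
    generalize B.symm (D.pos y) = b at hbU hbr ⊢
    obtain ⟨v, x, u⟩ := b
    obtain ⟨h, hh, hexp⟩ := exists_gop_eq_exp hG (hσG v)
    set x' := φ (τ.symm (D.base y))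
    rw [hgy', orbitMap, ← hexp, emb_apply, ext_pair] at hbr
    have h1 := congrArg head hbr
    have h2 := congrArg (fun w : C (k + 2) => w (Fin.last (k + 1))) hbr
    simp only [head_pair, pair_last] at h1 h2
    have h3 : normalMap (S := S) p (x, u) = gop (h⁻¹ * g) (x' 0 • p) := by
      rw [gop_mul, mul_apply_eq_comp, ← h1, gop_inv_apply]
    have hhg := G.mul_mem (G.inv_mem hh) hg
    have hm : MZero G (normalMap (S := S) p (x, u)) := by
      rw [h3]; exact (hp.mzero.smul _).gop hhg
    have hline := hW1 hbU.2 hm fun v' hv' => by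
      rw [← htang, ← hS] at hv'
      rw [normalMap_apply, inner_add_right, hSp' v' hv', inner_smul_right, zero_add]
      simp [hSS v' hv' u u.2]
    have hu : u = 0 := by
      have h4 := congrArg (inner ℂ (u : C (k + 1))) hline
      rw [hu₀, smul_smul, hSp' u u.2, normalMap_apply, inner_add_right, hSp' u u.2,
        inner_smul_right, zero_add, mul_eq_zero] at h4
      exact Subtype.ext (inner_self_eq_zero.1 (h4.resolve_left Complex.I_ne_zero))
    rw [hu, normalMap_apply] at h3
    have h5 : x' = x := by
      refine (hinj x' ((hτs _).1 hs).2.2 x hbU.1 _ hhg ?_).symm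
      rw [ext_emb_eq]
      refine ⟨?_, h2⟩
      simpa using h3
    rw [h5, hu]
  let e : OpenPartialHomeomorph D.Space (S × EuclideanSpace ℝ (Fin 2)) :=
    { toFun := fun y => ((B.symm (D.pos y)).1, τ.symm (D.base y))
      invFun := fun b => ⟨(orbitMap p σ (b.1, φ b.2, 0), τ b.2), by
        obtain ⟨h, hh, e⟩ := horb b.1 (φ b.2)
        exact ⟨h, hh, c.symm b.2, hτ b.2, e⟩⟩
      source := {y | D.pos y ∈ B.target ∧ D.base y ∈ τ.target}
      target := {b | b.2 ∈ τ.source ∧ (b.1, φ b.2, 0) ∈ B.source}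
      map_source' := fun y hy => ⟨τ.map_target hy.2, by
        rw [← hkey y hy.1 hy.2]; exact B.map_target hy.1⟩
      map_target' := fun b hb => ⟨by
        have := B.map_source hb.2
        rw [hB] at this
        exact this, τ.map_source hb.1⟩
      left_inv' := fun y hy => by
        refine Subtype.ext (Prod.ext ?_ (τ.right_inv hy.2))
        change orbitMap p σ ((B.symm (D.pos y)).1, φ (τ.symm (D.base y)), 0) = D.pos y
        rw [← hkey y hy.1 hy.2, ← hB, B.right_inv hy.1]
      right_inv' := fun b hb => by
        refine Prod.ext ?_ (τ.left_inv hb.1)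
        change (B.symm (orbitMap p σ (b.1, φ b.2, 0))).1 = b.1
        rw [← hB, B.left_inv hb.2]
      open_source := by
        refine (B.open_target.preimage D.continuous_pos).inter (τ.open_target.preimage ?_)
        exact D.continuous_base
      open_target := by
        have h1 : ContinuousOn (fun b : S × EuclideanSpace ℝ (Fin 2) =>
            ((b.1, φ b.2, 0) : S × C 2 × S)) (Prod.snd ⁻¹' τ.source) :=
          continuousOn_fst.prodMk ((hφc.comp continuousOn_snd fun b hb => hb).prodMk
            continuousOn_const)
        exact h1.isOpen_inter_preimage (τ.open_source.preimage continuous_snd) B.open_source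
      continuousOn_toFun := by
        refine ContinuousOn.prodMk ?_ ?_
        · exact continuous_fst.comp_continuousOn (B.continuousOn_symm.comp
            D.continuous_pos.continuousOn fun y hy => hy.1)
        · exact τ.continuousOn_symm.comp D.continuous_base.continuousOn fun y hy => hy.2
      continuousOn_invFun := by
        refine Topology.IsInducing.subtypeVal.continuousOn_iff.2 (ContinuousOn.prodMk ?_ ?_)
        · exact (contDiff_orbitMap p σ).continuous.comp_continuousOn (continuousOn_fst.prodMk
            ((hφc.comp continuousOn_snd fun b hb => hb.1).prodMk continuousOn_const))
        · exact τ.continuousOn.comp continuousOn_snd fun b hb => hb.1 }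
  have hecomp : D.pos ∘ e.symm = orbitMap p σ ∘ fun b => (b.1, φ b.2, 0) := rfl
  have hinc : B.symm (D.pos (D.incl x₀)) = (0, D.f.toFun x₀, 0) := by
    have h1 : B (0, D.f.toFun x₀, 0) = D.pos (D.incl x₀) := by
      rw [hB, orbitMap, hn₀, map_zero, expOp_zero]; rfl
    rw [← h1, B.left_inv hB0]
  have hpos0 : D.pos (D.incl x₀) ∈ B.target := by
    have h1 : B (0, D.f.toFun x₀, 0) = D.pos (D.incl x₀) := by
      rw [hB, orbitMap, hn₀, map_zero, expOp_zero]; rfl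
    rw [← h1]; exact B.map_source hB0
  have hbase0 : D.base (D.incl x₀) = τ (c x₀) := by rw [hτ, hcx]; rfl
  have he0 : D.incl x₀ ∈ e.source := ⟨hpos0, by rw [hbase0]; exact τ.map_source hτx₀⟩
  have hex : e (D.incl x₀) = (0, c x₀) := by
    refine Prod.ext (congrArg (fun y : S × C 2 × S => y.1) hinc) ?_
    change τ.symm (D.base (D.incl x₀)) = _
    rw [hbase0, τ.left_inv hτx₀]
  have hβ : ∀ b ∈ e.target, HasFDerivAt (fun b : S × EuclideanSpace ℝ (Fin 2) =>
      ((b.1, φ b.2, 0) : S × C 2 × S)) ((ContinuousLinearMap.fst ℝ _ _).prod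
        (((fderiv ℝ φ b.2).comp (ContinuousLinearMap.snd ℝ _ _)).prod 0)) b := fun b hb => by
    have h1 := ((hφs b.2 hb.1).differentiableAt (by simp)).hasFDerivAt.comp b
      (hasFDerivAt_snd (𝕜 := ℝ))
    exact (hasFDerivAt_fst (𝕜 := ℝ)).prodMk (h1.prodMk (hasFDerivAt_const _ _))
  refine HasChart.of_model (by rw [Module.finrank_prod, hfin, finrank_euclideanSpace_fin]) e he0
    (fun b hb => ⟨?_, ?_⟩) ?_
  · rw [hecomp]
    refine (contDiff_orbitMap p σ).contDiffAt.comp b ?_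
    exact contDiffAt_fst.prodMk (((hφs b.2 hb.1).comp b contDiffAt_snd).prodMk contDiffAt_const)
  · obtain ⟨g', hg'⟩ := hBd _ hb.2
    rw [hecomp, (hg'.comp b (hβ b hb)).fderiv]
    refine g'.injective.comp ?_
    rw [injective_iff_map_eq_zero]
    rintro ⟨v, b'⟩ h
    refine Prod.ext (congrArg (fun y : S × C 2 × S => y.1) h) ?_
    exact (injective_iff_map_eq_zero _).1 (D.f.injective_fderiv_localRep x₀ ((hτs _).1 hb.1).1) _
      (congrArg (fun y : S × C 2 × S => y.2.1) h)
  · have hd0 : HasFDerivAt (orbitMap p σ) D₀ (0, φ (c x₀), 0) := by rw [hφx]; exact hD₀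
    have hd := hd0.comp ((0, c x₀) : S × EuclideanSpace ℝ (Fin 2))
      (hβ _ (hex ▸ e.map_source he0))
    rw [hex, hecomp, hd.fderiv]
    intro u v
    -- At the centre the derivative is the sum of the inclusions of S and of TĽ. Both are isotropic,
    -- and S is complex orthogonal to P × ℂ.
    change (inner ℂ (D₀ (u.1, fderiv ℝ φ (c x₀) u.2, 0))
      (D₀ (v.1, fderiv ℝ φ (c x₀) v.2, 0))).im = 0
    rw [hD₀', hD₀', normalMap_apply, normalMap_apply]
    have hT := D.f.range_fderiv_localRep x₀ (mem_chart_target _ x₀)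
    have h1 := (D.f.isLagPlane_tangentPlane _).isotropic _ (hT.le ⟨u.2, rfl⟩) _
      (hT.le ⟨v.2, rfl⟩)
    rw [← inner_emb hp.norm_eq, emb_apply, emb_apply, inner_pair, Complex.add_im] at h1
    have hps : ∀ s : S, ∀ d : ℂ, inner ℂ (d • p) (s : C (k + 1)) = 0 := fun s d => by
      rw [← inner_conj_symm, hSp' s s.2, map_zero]
    simp only [Submodule.coe_zero, smul_zero, add_zero, inner_pair, inner_add_left,
      inner_add_right, hps, hSp' _ (Subtype.prop _), zero_add, Complex.add_im,
      hSS _ u.1.2 _ v.1.2]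
    exact h1

theorem hasChart (hG : IsCompact (G : Set (SU (k + 1)))) (hp : Reg G p) (y : D.Space) :
    HasChart D.pos y := by
  obtain ⟨g, x, rfl⟩ := D.exists_smul_incl y
  exact (D.hasChart_incl hG hp x).translate (Homeomorph.smul g) (extL (g : SU (k + 1)))
    (inner_ext _) (D.pos_smul g)

/-- The orbit of a surface in `P × ℂ`, as an equivariant immersion. -/
def toGImmersion (hG : IsCompact (G : Set (SU (k + 1)))) (hp : Reg G p) : GImmersion G where
  toLagrangianImmersion := LagrangianImmersion.ofCharts (D.hasChart hG hp)
  action := inferInstanceAs (MulAction G D.Space)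
  continuous_action := inferInstanceAs (ContinuousSMul G D.Space)
  equivariant := D.pos_smul
  isotropy_eq g y h := D.ext_pos_base ((D.pos_smul g y).trans h) (D.base_smul g y)

theorem continuous_incl : Continuous D.incl := by
  rw [D.continuous_iff]
  exact ⟨(embL p).continuous.comp D.f.smooth.continuous, D.isLocalHomeomorph.continuous⟩

variable (hG : IsCompact (G : Set (SU (k + 1)))) (hp : Reg G p)

theorem range_toFun : Set.range (D.toGImmersion hG hp).toFun =
    {w | ∃ g ∈ G, ∃ x, w = ext (k + 1) g (emb p (D.f.toFun x))} := by
  ext w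
  constructor
  · rintro ⟨y, rfl⟩
    obtain ⟨g, x, rfl⟩ := D.exists_smul_incl y
    exact ⟨g, g.2, x, rfl⟩
  · rintro ⟨g, hg, x, rfl⟩
    exact ⟨(⟨g, hg⟩ : G) • D.incl x, rfl⟩

end OrbitData

end

/-! ### Stabilisers, the group C_k and cohomogeneity for a normalised profile line. -/

section

/-! ### Lagrangian angles and symmetries -/

section

variable {n : ℕ}

theorem holVol_ext (g : SU n) (e : Fin (n + 1) → C (n + 1)) :
    holVol (fun i => ext n g (e i)) = holVol e := by
  let M : Matrix (Fin n ⊕ Fin 1) (Fin n ⊕ Fin 1) ℂ := Matrix.fromBlocks g.1 0 0 1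
  have hM : M.det = 1 := by
    rw [Matrix.det_fromBlocks_zero₂₁, (Matrix.mem_specialUnitaryGroup_iff.1 g.2).2, Matrix.det_one,
      one_mul]
  have h : (Matrix.of fun i j => ext n g (e j) i) =
      M.submatrix finSumFinEquiv.symm finSumFinEquiv.symm * Matrix.of fun i j => e j i := by
    ext i j
    rw [Matrix.mul_apply, ← finSumFinEquiv.sum_comp, Fintype.sum_sum_type]
    obtain ⟨i, rfl⟩ := finSumFinEquiv.surjective i
    simp only [Matrix.submatrix_apply, Equiv.symm_apply_apply, Matrix.of_apply]
    rcases i with i | i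
    · have h1 : ext n g (e j) (finSumFinEquiv (Sum.inl i)) = gop g (head (e j)) i :=
        congrArg (fun w : C n => w i) (head_ext g (e j))
      rw [h1, gop_apply, Fin.sum_univ_one]
      change _ = ∑ x, g.1 i x * head (e j) x + 0 * _
      rw [zero_mul, add_zero]
    · obtain rfl : i = 0 := Subsingleton.elim _ _
      have h1 : ext n g (e j) (finSumFinEquiv (Sum.inr 0)) = e j (Fin.last n) := ext_last g (e j)
      rw [h1, Fin.sum_univ_one]
      change _ = ∑ x : Fin n, 0 * _ + 1 * e j (Fin.last n)
      simp
  rw [holVol, holVol, h, Matrix.det_mul, Matrix.det_submatrix_equiv_self, hM, one_mul]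

/-- A symmetry in `SU(n)` preserves the Lagrangian angle. -/
theorem angle_of_symmetry {F : LagrangianImmersion (n + 1)} {τ : F.carrier → F.carrier}
    (hτ : Continuous τ) (g : SU n) (h : ∀ q, F.toFun (τ q) = ext n g (F.toFun q)) (q : F.carrier)
    {θ : ℝ} (hθ : IsLagrangianAngle (F.tangentPlane q) θ) :
    IsLagrangianAngle (F.tangentPlane (τ q)) θ := by
  obtain ⟨e, he, ho, hv⟩ := hθ
  refine ⟨fun i => ext n g (e i), fun i => ?_, ?_, by rw [holVol_ext, hv]⟩
  · exact LagrangianImmersion.map_tangentPlane_le hτ ((extL g).restrictScalars ℝ) h q (he i)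
  · rw [orthonormal_iff_ite] at ho ⊢
    intro i j
    rw [← ho i j, real_inner_eq, real_inner_eq, inner_ext]

end

section

variable {N : ℕ} {F F' : LagrangianImmersion N}

/-- A homeomorphism which is compatible with immersions is a diffeomorphism. -/
def LagrangianImmersion.diffeomorphOfHomeomorph (h : F.carrier ≃ₜ F'.carrier)
    (hh : ∀ q, F'.toFun (h q) = F.toFun q) : Diffeomorph (𝓡 N) (𝓡 N) F.carrier F'.carrier ∞ where
  toEquiv := h.toEquiv
  contMDiff_toFun := LagrangianImmersion.contMDiff_of_comp_eq h.continuous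
    (ContinuousLinearMap.id ℝ _) hh
  contMDiff_invFun := LagrangianImmersion.contMDiff_of_comp_eq h.symm.continuous
    (ContinuousLinearMap.id ℝ _) fun q => by
      have := hh (h.symm q)
      rw [h.apply_symm_apply] at this
      exact this.symm

instance {n : ℕ} (G : Subgroup (SU n)) : ContinuousInv G where
  continuous_inv := by
    have h1 : Continuous fun g : G => star (g : SU n).1 :=
      continuous_star.comp (continuous_subtype_val.comp continuous_subtype_val)
    exact (h1.subtype_mk _).subtype_mk _

/-- The orbit map of a closed subset under a compact group is closed. -/
theorem isClosedMap_smul {Γ X A : Type*} [Group Γ] [TopologicalSpace Γ] [ContinuousInv Γ]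
    [CompactSpace Γ] [TopologicalSpace X] [TopologicalSpace A] [MulAction Γ X] [ContinuousSMul Γ X] {ι : A → X}
    (hι : IsClosedEmbedding ι) : IsClosedMap fun y : Γ × A => y.1 • ι y.2 := by
  -- After the shear (g, x) ↦ (g, gx) the action is the projection along the compact factor, which
  -- is closed.
  let s : Γ × X ≃ₜ Γ × X :=
    { toFun := fun y => (y.1, y.1 • y.2)
      invFun := fun y => (y.1, y.1⁻¹ • y.2)
      left_inv := fun y => by simp
      right_inv := fun y => by simp
      continuous_toFun := by fun_prop
      continuous_invFun := by fun_prop }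
  have h1 : IsClosedMap fun y : Γ × A => (y.1, ι y.2) :=
    (IsClosedEmbedding.id.prodMap hι).isClosedMap
  exact (isClosedMap_snd_of_compactSpace.comp s.isClosedMap).comp h1

end

/-! ### The profile plane -/

variable {k : ℕ} {G : Subgroup (SU (k + 1))}

/-- The standing assumptions on the group, the zero set `Z` of the moment map, and the
identification `Φ` of the profile line with `ℂ`. -/
structure Setup (G : Subgroup (SU (k + 1))) (Z : Set (C (k + 1))) {z : C (k + 1)}
    (Φ : line z ≃ₗᵢ[ℂ] ℂ) (p : C (k + 1)) : Prop where
  compact : IsCompact (G : Set (SU (k + 1)))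
  reg : Reg G p
  mem_iff : ∀ w, w ∈ Z ↔ MZero G w
  symm_apply : ∀ a, (Φ.symm a : C (k + 1)) = a • p
  frame : ∃ e : Fin k → C (k + 1), (∀ i, e i ∈ tang G p) ∧
    Orthonormal ℂ (Fin.snoc e p : Fin (k + 1) → C (k + 1)) ∧
    holVol (orbitFrame e p 1 fun j => EuclideanSpace.single j 1) = 1

namespace Setup

variable {Z : Set (C (k + 1))} {z : C (k + 1)} {Φ : line z ≃ₗᵢ[ℂ] ℂ} {p : C (k + 1)}

theorem embed_eq (h : Setup G Z Φ p) (x : C 2) : embed Φ x = emb p x := by rw [embed, h.symm_apply, emb_apply]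

theorem mem_line (h : Setup G Z Φ p) {w : C (k + 1)} : w ∈ line z ↔ ∃ c : ℂ, w = c • p := by
  constructor
  · intro hw
    refine ⟨Φ ⟨w, hw⟩, ?_⟩
    rw [← h.symm_apply, Φ.symm_apply_apply]
  · rintro ⟨c, rfl⟩
    rw [← h.symm_apply]
    exact (Φ.symm c).2

theorem exists_eq_smul (h : Setup G Z Φ p) : (∃ c : ℂ, z = c • p) ∧ ∃ a : ℂ, p = a • z := by
  refine ⟨h.mem_line.1 (Submodule.mem_span_singleton_self z), ?_⟩
  obtain ⟨a, ha⟩ := Submodule.mem_span_singleton.1 (h.mem_line.2 ⟨1, (one_smul ℂ p).symm⟩)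
  exact ⟨a, ha.symm⟩

theorem gop_fix_iff (h : Setup G Z Φ p) {g : SU (k + 1)} : gop g z = z ↔ gop g p = p := by
  obtain ⟨⟨c, hc⟩, a, ha⟩ := h.exists_eq_smul
  constructor
  · intro hz
    rw [ha, map_smul, hz]
  · intro hp
    rw [hc, map_smul, hp]

theorem mem_stabLine (h : Setup G Z Φ p) {g : G} : g ∈ stabLine G z ↔ ∃ c : ℂ, gop (g : SU (k + 1)) p = c • p := by
  constructor
  · intro hg
    exact h.mem_line.1 ((hg p).2 (h.mem_line.2 ⟨1, (one_smul ℂ p).symm⟩))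
  · rintro ⟨c, hc⟩ v
    rw [std_eq, h.mem_line, h.mem_line]
    have hc0 : c ≠ 0 := by
      rintro rfl
      have := h.reg.pow_eq_one g.2 hc
      simp at this
    constructor
    · rintro ⟨a, ha⟩
      refine ⟨a * c⁻¹, gop_injective (g : SU (k + 1)) ?_⟩
      rw [ha, map_smul, hc, smul_smul, inv_mul_cancel_right₀ hc0]
    · rintro ⟨a, rfl⟩
      exact ⟨a * c, by rw [map_smul, hc, smul_smul]⟩

/-- C_k acts faithfully on P, so its elements can be compared through their effect on p. -/
theorem mk_eq_iff (h : Setup G Z Φ p) {g g' : stabLine G z} : (g : Ck G z) = g' ↔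
    gop ((g : G) : SU (k + 1)) p = gop ((g' : G) : SU (k + 1)) p := by
  rw [QuotientGroup.eq]
  change gop (((g : G) : SU (k + 1))⁻¹ * ((g' : G) : SU (k + 1))) z = z ↔ _
  rw [h.gop_fix_iff, gop_mul, mul_apply_eq_comp]
  constructor
  · intro h1
    conv_lhs => rw [← h1]
    rw [gop_apply_inv]
  · intro h1
    rw [← h1, gop_inv_apply]

/-- Sending g to the scalar c with gp = cp embeds C_k in the roots of unity of order dividing 2(k +
1). -/
theorem finite_Ck (h : Setup G Z Φ p) : Finite (Ck G z) := by
  have hf : Set.Finite {c : ℂ | c ^ (2 * (k + 1)) = 1} := finite_pow_eq_one (by simp)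
  choose χ hχ using fun g : stabLine G z => h.mem_stabLine.1 g.2
  have : Finite {c : ℂ | c ^ (2 * (k + 1)) = 1} := hf
  refine Finite.of_injective (fun c : Ck G z => (⟨χ c.out, h.reg.pow_eq_one (c.out : G).2
    (hχ _)⟩ : {c : ℂ | c ^ (2 * (k + 1)) = 1})) fun c c' hcc => ?_
  have h1 : χ c.out = χ c'.out := congrArg Subtype.val hcc
  rw [← QuotientGroup.out_eq' c, ← QuotientGroup.out_eq' c', h.mk_eq_iff, hχ, hχ, h1]

/-- Group elements that map a point of the profile plane to the profile plane. -/
theorem mem_stabLine_of_ext (h : Setup G Z Φ p) {g : G} {x : C 2} (hx : k = 0 ∨ x 0 ≠ 0) {w : C (k + 2)}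
    (hw : w = ext (k + 1) (g : SU (k + 1)) (emb p x)) (hl : head w ∈ line z) :
    g ∈ stabLine G z := by
  by_cases hk : k = 0
  · subst hk
    have : g = 1 := Subtype.ext (SU.eq_one _)
    rw [this]
    exact (stabLine G z).one_mem
  · have hx0 := hx.resolve_left hk
    obtain ⟨c, hc⟩ := h.mem_line.1 hl
    rw [hw, head_ext, head_emb, map_smul] at hc
    refine h.mem_stabLine.2 ⟨(x 0)⁻¹ * c, ?_⟩
    rw [mul_smul, ← hc, smul_smul, inv_mul_cancel₀ hx0, one_smul]

theorem head_emb_mem (h : Setup G Z Φ p) (x : C 2) : head (emb p x) ∈ line z := by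
  rw [head_emb]
  exact h.mem_line.2 ⟨_, rfl⟩

theorem exists_ext_emb (h : Setup G Z Φ p) {w : C (k + 2)} (hw : w ∈ timesC Z) :
    ∃ (g : G) (x : C 2), w = ext (k + 1) (g : SU (k + 1)) (emb p x) := by
  obtain ⟨g, hg, c, hc⟩ := h.reg.exists_gop_smul h.compact ((h.mem_iff _).1 hw)
  refine ⟨⟨g, hg⟩, WithLp.toLp 2 ![c, w (Fin.last (k + 1))], ?_⟩
  rw [emb_apply, ext_pair]
  conv_lhs => rw [← pair_head w, hc]
  rfl

theorem ext_emb_mem (h : Setup G Z Φ p) (g : G) (x : C 2) : ext (k + 1) (g : SU (k + 1)) (emb p x) ∈ timesC Z := by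
  change head _ ∈ Z
  rw [h.mem_iff, head_ext, head_emb]
  exact (h.reg.mzero.smul _).gop g.2

/-! ### Cohomogeneity -/

theorem mem_isotropy_ext {w : C (k + 2)} {g : G} :
    g ∈ isotropy G (ext (k + 1)) w ↔ gop (g : SU (k + 1)) (head w) = head w := by
  change ext (k + 1) (g : SU (k + 1)) w = w ↔ _
  constructor
  · intro h1
    rw [← head_ext, h1]
  · intro h1
    rw [ext_apply, h1, pair_head]

/-- Over the origin of P the isotropy group is all of G, so dim (G/H) = 0, while cohomogeneity two
in dimension k + 2 requires k. -/
theorem ne_zero_of_isCohomogeneity {L : Set (C (k + 2))}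
    (hL : IsCohomogeneity G (ext (k + 1)) L (k + 2) 2) {w : C (k + 2)} (hw : w ∈ L) {c : ℂ}
    (hc : head w = c • p) : k = 0 ∨ c ≠ 0 := by
  by_contra! hne
  obtain ⟨hk, rfl⟩ := hne
  obtain ⟨H, h1, h2⟩ := hL
  obtain ⟨g, hg⟩ := h1 w hw
  have htop : isotropy G (ext (k + 1)) w = ⊤ := by
    rw [eq_top_iff]
    intro g _
    rw [mem_isotropy_ext, hc, zero_smul, map_zero]
  have hH : H = ⊤ := by
    rw [htop] at hg
    exact Subgroup.map_injective (MulAut.conj g).injective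
      (hg.symm.trans (Subgroup.map_top_of_surjective _ (MulAut.conj g).surjective).symm)
  have h3 : H.map G.subtype = G := by
    rw [hH, ← MonoidHom.range_eq_map, Subgroup.range_subtype]
  rw [h3] at h2
  omega

/-- A nonzero scalar does not change the stabiliser, so all isotropy groups are conjugate to
Stab(p), whose codimension in G is dim 𝔤p = k. For k = 0 the group is trivial. -/
theorem isCohomogeneity (h : Setup G Z Φ p) {S : Set (C 2)} (hS : ∀ x ∈ S, k = 0 ∨ x 0 ≠ 0) {L : Set (C (k + 2))}
    (hL : ∀ w ∈ L, ∃ g : G, ∃ x ∈ S, w = ext (k + 1) (g : SU (k + 1)) (emb p x)) :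
    IsCohomogeneity G (ext (k + 1)) L (k + 2) 2 := by
  refine ⟨isotropy G (std (k + 1)) p, fun w hw => ?_, ?_⟩
  · obtain ⟨g, x, hx, rfl⟩ := hL w hw
    refine ⟨g, ?_⟩
    ext γ
    rw [mem_isotropy_ext, Subgroup.mem_map]
    have hx' : ∀ γ : G, gop (γ : SU (k + 1)) (x 0 • p) = x 0 • p ↔
        γ ∈ isotropy G (std (k + 1)) p := fun γ => by
      change _ ↔ gop (γ : SU (k + 1)) p = p
      rcases hS x hx with hk | h0
      · subst hk
        rw [SU.eq_one (γ : SU 1)]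
        simp
      · rw [map_smul]
        exact (smul_right_injective _ h0).eq_iff
    rw [head_ext, head_emb]
    have e : gop (γ : SU (k + 1)) (gop (g : SU (k + 1)) (x 0 • p)) = gop (g : SU (k + 1)) (x 0 • p)
        ↔ gop ((g⁻¹ * γ * g : G) : SU (k + 1)) (x 0 • p) = x 0 • p := by
      rw [← (gop_injective (g : SU (k + 1))).eq_iff (b := x 0 • p)]
      simp only [Subgroup.coe_mul, Subgroup.coe_inv, gop_mul, mul_apply_eq_comp, gop_apply_inv]
    rw [e, hx']
    constructor
    · intro hγ
      exact ⟨_, hγ, by simp [mul_assoc]⟩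
    · rintro ⟨δ, hδ, rfl⟩
      simpa [mul_assoc] using hδ
  · have := finrank_lieAlg_eq h.compact (z := p)
    rw [h.reg.finrank_tang] at this
    omega

end Setup

end

/-! ### Dividing a surface by C_k, and recovering it as the slice of its orbit. -/

section

variable {k : ℕ} {G : Subgroup (SU (k + 1))} {Z : Set (C (k + 1))} {z : C (k + 1)}
  {Φ : line z ≃ₗᵢ[ℂ] ℂ} {p : C (k + 1)}

namespace Setup

/-! ### The orbit of an equivariant surface -/

theorem equivariant (h : Setup G Z Φ p) (f : CkImmersion G Φ) (g : stabLine G z) (x : f.carrier) :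
    emb p (f.toFun ((g : Ck G z) • x)) = ext (k + 1) ((g : G) : SU (k + 1)) (emb p (f.toFun x)) := by
  rw [← h.embed_eq, ← h.embed_eq]
  exact f.equivariant g x

theorem mk_eq_one (h : Setup G Z Φ p) {g : stabLine G z} {x : C 2} (hx : k = 0 ∨ x 0 ≠ 0)
    (hg : ext (k + 1) ((g : G) : SU (k + 1)) (emb p x) = emb p x) : (g : Ck G z) = 1 := by
  change (g : Ck G z) = ((1 : stabLine G z) : Ck G z)
  rw [h.mk_eq_iff]
  have h1 := (ext_emb_eq.1 hg.symm).1
  change _ = gop (1 : SU (k + 1)) p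
  rw [gop_one]
  rcases hx with hk | h0
  · subst hk
    rw [SU.eq_one ((g : G) : SU 1), gop_one]
  · rw [map_smul] at h1
    exact (smul_right_injective _ h0 h1).symm

/-- An element fixing a point of the surface fixes its position, hence p. Freeness of this finite
action makes the quotient map a covering. -/
theorem isCancelSMul (h : Setup G Z Φ p) (f : CkImmersion G Φ)
    (hf : ∀ x, k = 0 ∨ f.toFun x 0 ≠ 0) : IsCancelSMul (Ck G z) f.carrier where
  right_cancel' c c' x hx := by
    have h1 : (c'⁻¹ * c) • x = x := by rw [mul_smul, hx, inv_smul_smul]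
    obtain ⟨g, hg⟩ := QuotientGroup.mk_surjective (c'⁻¹ * c)
    rw [← hg] at h1
    have h2 := h.mk_eq_one (hf x) (g := g) (by rw [← h.equivariant, h1])
    rw [hg, inv_mul_eq_one] at h2
    exact h2.symm

/-- The quotient of an equivariant surface by `C_k`. -/
def orbitData (h : Setup G Z Φ p) (f : CkImmersion G Φ) (hf : ∀ x, k = 0 ∨ f.toFun x 0 ≠ 0) :
    OrbitData G p :=
  have := h.finite_Ck
  have : LocallyCompactSpace f.carrier :=
    ChartedSpace.locallyCompactSpace (EuclideanSpace ℝ (Fin 2)) f.carrier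
  have := h.isCancelSMul f hf
  { f := f.toLagrangianImmersion
    Q := Quotient (MulAction.orbitRel (Ck G z) f.carrier)
    t2 := t2Space_of_properlyDiscontinuousSMul_of_t2Space
    secondCountable := ContinuousConstSMul.secondCountableTopology
    proj := Quotient.mk _
    isLocalHomeomorph :=
      (IsQuotientCoveringMap.isCoveringMap _ (Ck G z)
        isQuotientCoveringMap_quotientMk_of_properlyDiscontinuousSMul).isLocalHomeomorph
    exists_of_eq := fun x x' hx => by
      obtain ⟨c, hc⟩ := MulAction.orbitRel_apply.1 (Quotient.exact hx.symm)
      obtain ⟨g, rfl⟩ := QuotientGroup.mk_surjective c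
      refine ⟨(g : G), (g : G).2, ?_⟩
      rw [← h.equivariant]
      exact congrArg (fun y => emb p (f.toFun y)) hc.symm
    ne_zero := hf }

/-- The projection of an equivariant surface to its quotient by `C_k`. -/
def proj (h : Setup G Z Φ p) (f : CkImmersion G Φ) (hf : ∀ x, k = 0 ∨ f.toFun x 0 ≠ 0)
    (x : f.carrier) : (h.orbitData f hf).Q := (h.orbitData f hf).proj x

theorem proj_eq_iff (h : Setup G Z Φ p) (f : CkImmersion G Φ)
    (hf : ∀ x, k = 0 ∨ f.toFun x 0 ≠ 0) {x x' : f.carrier} :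
    h.proj f hf x = h.proj f hf x' ↔ ∃ g : stabLine G z, (g : Ck G z) • x' = x := by
  constructor
  · intro hx
    obtain ⟨c, hc⟩ := MulAction.orbitRel_apply.1 (Quotient.exact hx)
    obtain ⟨g, rfl⟩ := QuotientGroup.mk_surjective c
    exact ⟨g, hc⟩
  · rintro ⟨g, hg⟩
    exact Quotient.sound (MulAction.orbitRel_apply.2 ⟨(g : Ck G z), hg⟩)

/-- The inclusion of an equivariant surface in its orbit. -/
def incl (h : Setup G Z Φ p) (f : CkImmersion G Φ) (hf : ∀ x, k = 0 ∨ f.toFun x 0 ≠ 0)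
    (x : f.carrier) : (h.orbitData f hf).Space := (h.orbitData f hf).incl x

/-- The saturation of a set is the union of its finitely many translates, so closed sets have closed
images and fibres are finite. -/
theorem isProperMap_proj (h : Setup G Z Φ p) (f : CkImmersion G Φ)
    (hf : ∀ x, k = 0 ∨ f.toFun x 0 ≠ 0) : IsProperMap (h.proj f hf) := by
  have := h.finite_Ck
  have hpre : ∀ A : Set f.carrier, h.proj f hf ⁻¹' (h.proj f hf '' A) =
      ⋃ c : Ck G z, (fun x : f.carrier => c • x) '' A := fun A => by
    ext x
    rw [Set.mem_preimage, Set.mem_iUnion]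
    constructor
    · rintro ⟨a, ha, hax⟩
      obtain ⟨g, hg⟩ := (h.proj_eq_iff f hf).1 hax.symm
      exact ⟨g, a, ha, hg⟩
    · rintro ⟨c, a, ha, hc⟩
      obtain ⟨g, rfl⟩ := QuotientGroup.mk_surjective c
      exact ⟨a, ha, ((h.proj_eq_iff f hf).2 ⟨g, hc⟩).symm⟩
  have hq : Topology.IsQuotientMap (h.proj f hf) := isQuotientMap_quotient_mk'
  rw [isProperMap_iff_isClosedMap_and_compact_fibers]
  refine ⟨hq.continuous, fun A hA => ?_, fun y => ?_⟩
  · rw [← hq.isClosed_preimage, hpre]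
    exact isClosed_iUnion_of_finite fun c => (Homeomorph.smul c).isClosedMap A hA
  · obtain ⟨x, rfl⟩ := hq.surjective y
    rw [← Set.image_singleton, hpre]
    exact isCompact_iUnion fun c => isCompact_singleton.image (continuous_const_smul c)

/-- Followed by `base`, the inclusion becomes the proper quotient map, so it is proper itself. It is
injective because two points in one class with one position differ by an element of C_k with a fixed
point. -/
theorem isClosedEmbedding_incl (h : Setup G Z Φ p) (f : CkImmersion G Φ)
    (hf : ∀ x, k = 0 ∨ f.toFun x 0 ≠ 0) : IsClosedEmbedding (h.incl f hf) := by
  refine IsClosedEmbedding.of_continuous_injective_isClosedMap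
    (h.orbitData f hf).continuous_incl ?_ ?_
  · intro x x' hx
    have h1 : emb p (f.toFun x) = emb p (f.toFun x') := congrArg (h.orbitData f hf).pos hx
    have h2 : h.proj f hf x = h.proj f hf x' := congrArg (h.orbitData f hf).base hx
    obtain ⟨g, hg⟩ := (h.proj_eq_iff f hf).1 h2
    rw [h.mk_eq_one (hf x') (g := g) (by rw [← h.equivariant, hg, h1]), one_smul] at hg
    exact hg.symm
  · exact (isProperMap_of_comp_of_t2 (h.orbitData f hf).continuous_incl
      (h.orbitData f hf).continuous_base (h.isProperMap_proj f hf)).isClosedMap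

/-- The surface `f` is the slice of `F`, through the map `ι`. -/
structure IsSliceMap (p : C (k + 1)) (f : CkImmersion G Φ) (F : GImmersion G)
    (ι : f.carrier → F.carrier) : Prop where
  isClosedEmbedding : IsClosedEmbedding ι
  mem_range : ∀ q, head (F.toFun q) ∈ line z → ∃ x, ι x = q
  toFun_eq : ∀ x, F.toFun (ι x) = emb p (f.toFun x)
  smul_eq : ∀ (g : stabLine G z) x, ι ((g : Ck G z) • x) = (g : G) • ι x

/-- Smoothness of ι comes for free from that of F ∘ ι, and closedness from that of P × ℂ, so slices
can be handled topologically. -/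
theorem isSliceOf_iff (h : Setup G Z Φ p) {f : CkImmersion G Φ} {F : GImmersion G} :
    IsSliceOf f F ↔ ∃ ι, IsSliceMap p f F ι := by
  constructor
  · rintro ⟨ι, -, h2, h3, h4, h5⟩
    refine ⟨ι, ⟨h2, ?_⟩, fun q hq => ?_, fun x => ?_, h5⟩
    · rw [h3]
      have hcl : IsClosed (timesC (line z : Set (C (k + 1)))) :=
        (Submodule.closed_of_finiteDimensional _).preimage (headL (k + 1)).continuous
      exact hcl.preimage F.smooth.continuous
    · have : q ∈ Set.range ι := by rw [h3]; exact hq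
      exact this
    · rw [h4, h.embed_eq]
  · rintro ⟨ι, h1⟩
    refine ⟨ι, ?_, h1.isClosedEmbedding.isEmbedding, ?_, fun x => ?_, h1.smul_eq⟩
    · exact LagrangianImmersion.contMDiff_of_comp_eq (F := f.toLagrangianImmersion)
        (F' := F.toLagrangianImmersion) h1.isClosedEmbedding.continuous
        ((embL p).restrictScalars ℝ) h1.toFun_eq
    · ext q
      constructor
      · rintro ⟨x, rfl⟩
        change head (F.toFun (ι x)) ∈ line z
        rw [h1.toFun_eq]
        exact h.head_emb_mem _
      · exact h1.mem_range q
    · rw [h1.toFun_eq, h.embed_eq]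

/-- An equivariant surface is the slice of its orbit. -/
theorem isSliceMap_incl (h : Setup G Z Φ p) (f : CkImmersion G Φ)
    (hf : ∀ x, k = 0 ∨ f.toFun x 0 ≠ 0) :
    IsSliceMap p f ((h.orbitData f hf).toGImmersion h.compact h.reg) (h.incl f hf) := by
  have hs : ∀ (g : stabLine G z) (x : f.carrier),
      h.incl f hf ((g : Ck G z) • x) = (g : G) • h.incl f hf x := fun g x => by
    refine (h.orbitData f hf).ext_pos_base (h.equivariant f g x) ?_
    exact (h.proj_eq_iff f hf).2 ⟨g, rfl⟩
  refine ⟨h.isClosedEmbedding_incl f hf, fun q hq => ?_, fun x => rfl, hs⟩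
  obtain ⟨g, x, rfl⟩ : ∃ (g : G) (x : f.carrier), q = g • h.incl f hf x :=
    (h.orbitData f hf).exists_smul_incl q
  have hg : g ∈ stabLine G z := h.mem_stabLine_of_ext (hf x) rfl hq
  exact ⟨((⟨g, hg⟩ : stabLine G z) : Ck G z) • x, hs ⟨g, hg⟩ x⟩

end Setup

namespace Setup.IsSliceMap

variable {f : CkImmersion G Φ} {F : GImmersion G} {ι : f.carrier → F.carrier}

theorem exists_smul (h : Setup G Z Φ p) (hι : IsSliceMap p f F ι)
    (hF : ∀ q, F.toFun q ∈ timesC Z) (q : F.carrier) : ∃ (g : G) (x : f.carrier), g • ι x = q := by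
  obtain ⟨g, y, hy⟩ := h.exists_ext_emb (hF q)
  obtain ⟨x, hx⟩ := hι.mem_range (g⁻¹ • q) (by
    rw [F.equivariant, hy]
    simp only [Subgroup.coe_inv, ext_inv_apply]
    exact h.head_emb_mem y)
  exact ⟨g, x, by rw [hx, smul_inv_smul]⟩

/-- Points of the slice which lie in the same orbit of `G` lie in the same orbit of `C_k`. -/
theorem exists_eq_smul (h : Setup G Z Φ p) (hf : ∀ x, k = 0 ∨ f.toFun x 0 ≠ 0) {g : G}
    {x x' : f.carrier}
    (hg : emb p (f.toFun x') = ext (k + 1) (g : SU (k + 1)) (emb p (f.toFun x))) :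
    ∃ g' : stabLine G z, (g' : G) = g ∧ f.toFun x' = f.toFun ((g' : Ck G z) • x) := by
  have hg' : g ∈ stabLine G z :=
    h.mem_stabLine_of_ext (hf x) hg (h.head_emb_mem _)
  refine ⟨⟨g, hg'⟩, rfl, emb_injective h.reg.norm_eq ?_⟩
  rw [hg, h.equivariant]

/-- Compactness of G makes this surjection closed. Continuity of a map on L can therefore be tested
on G × Ľ. -/
theorem isQuotientMap (h : Setup G Z Φ p) (hι : IsSliceMap p f F ι)
    (hF : ∀ q, F.toFun q ∈ timesC Z) :
    Topology.IsQuotientMap fun y : G × f.carrier => y.1 • ι y.2 := by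
  have : CompactSpace G := isCompact_iff_compactSpace.1 h.compact
  refine (isClosedMap_smul hι.isClosedEmbedding).isQuotientMap ?_ fun q => ?_
  · exact continuous_fst.smul (hι.isClosedEmbedding.continuous.comp continuous_snd)
  · obtain ⟨g, x, hq⟩ := hι.exists_smul h hF q
    exact ⟨(g, x), hq⟩

end Setup.IsSliceMap

end

/-! ### Reparametrisations, images and embeddedness under slicing. -/

section

variable {k : ℕ} {G : Subgroup (SU (k + 1))} {Z : Set (C (k + 1))} {z : C (k + 1)}
  {Φ : line z ≃ₗᵢ[ℂ] ℂ} {p : C (k + 1)}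

namespace Setup.IsSliceMap

variable {f f' : CkImmersion G Φ} {F F' : GImmersion G} {ι : f.carrier → F.carrier}
  {ι' : f'.carrier → F'.carrier}

/-! ### Equivalences of slices and of orbits -/

theorem toFun_smul (hι : IsSliceMap p f F ι) (g : G) (x : f.carrier) :
    F.toFun (g • ι x) = ext (k + 1) (g : SU (k + 1)) (emb p (f.toFun x)) := by
  rw [F.equivariant, hι.toFun_eq]

/-- An equivariant map of slices extends to the orbits. -/
theorem exists_extension (h : Setup G Z Φ p) (hι : IsSliceMap p f F ι)
    (hι' : IsSliceMap p f' F' ι') (hF : ∀ q, F.toFun q ∈ timesC Z)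
    (hf : ∀ x, k = 0 ∨ f.toFun x 0 ≠ 0) {ψ : f.carrier → f'.carrier} (hψ : Continuous ψ)
    (hψc : ∀ (c : Ck G z) x, ψ (c • x) = c • ψ x) :
    ∃ φ : F.carrier → F'.carrier, Continuous φ ∧ ∀ (g : G) x, φ (g • ι x) = g • ι' (ψ x) := by
  -- Two ways of writing q as g • ι x differ by an element of Stab(P). Equivariance of ψ under C_k
  -- makes the value independent of the choice, which is `key`.
  choose a b hab using hι.exists_smul h hF
  have key : ∀ (g : G) x, a (g • ι x) • ι' (ψ (b (g • ι x))) = g • ι' (ψ x) := fun g x => by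
    have h1 := hab (g • ι x)
    set q := g • ι x
    have h2 : ι (b q) = ((a q)⁻¹ * g) • ι x := by
      rw [mul_smul]; exact eq_inv_smul_iff.2 h1
    obtain ⟨g', hg', -⟩ := exists_eq_smul h hf (g := (a q)⁻¹ * g) (x := x) (x' := b q) (by
      rw [← hι.toFun_eq, h2, hι.toFun_smul])
    have h3 : b q = (g' : Ck G z) • x := hι.isClosedEmbedding.injective (by
      rw [hι.smul_eq, hg', h2])
    rw [h3, hψc, hι'.smul_eq, hg', mul_smul, smul_inv_smul]
  refine ⟨fun q => a q • ι' (ψ (b q)), ?_, key⟩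
  rw [(hι.isQuotientMap h hF).continuous_iff]
  have h1 : Continuous fun y : G × f.carrier => y.1 • ι' (ψ y.2) :=
    continuous_fst.smul (hι'.isClosedEmbedding.continuous.comp (hψ.comp continuous_snd))
  exact h1.congr fun y => (key y.1 y.2).symm

theorem equivalent_of_equivalent (h : Setup G Z Φ p) (hι : IsSliceMap p f F ι)
    (hι' : IsSliceMap p f' F' ι') (hF : ∀ q, F.toFun q ∈ timesC Z)
    (hF' : ∀ q, F'.toFun q ∈ timesC Z) (hf : ∀ x, k = 0 ∨ f.toFun x 0 ≠ 0)
    (hf' : ∀ x, k = 0 ∨ f'.toFun x 0 ≠ 0) (hff : f.Equivalent f') : F.Equivalent F' := by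
  obtain ⟨ψ, h1, h2⟩ := hff
  have h3 : ∀ (c : Ck G z) x, ψ.symm (c • x) = c • ψ.symm x := fun c x => by
    have := h2 c (ψ.symm x)
    rw [ψ.apply_symm_apply] at this
    rw [← this, ψ.symm_apply_apply]
  obtain ⟨φ, hφc, hφ⟩ := exists_extension h hι hι' hF hf ψ.continuous h2
  obtain ⟨φ', hφc', hφ'⟩ := exists_extension h hι' hι hF' hf' ψ.symm.continuous h3
  let Ψ : F.carrier ≃ₜ F'.carrier :=
    { toFun := φ
      invFun := φ'
      left_inv := fun q => by
        obtain ⟨g, x, rfl⟩ := hι.exists_smul h hF q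
        rw [hφ, hφ', ψ.symm_apply_apply]
      right_inv := fun q => by
        obtain ⟨g, x, rfl⟩ := hι'.exists_smul h hF' q
        rw [hφ', hφ, ψ.apply_symm_apply]
      continuous_toFun := hφc
      continuous_invFun := hφc' }
  refine ⟨LagrangianImmersion.diffeomorphOfHomeomorph (F := F.toLagrangianImmersion)
    (F' := F'.toLagrangianImmersion) Ψ fun q => ?_, fun q => ?_, fun g q => ?_⟩
  · obtain ⟨g, x, rfl⟩ := hι.exists_smul h hF q
    change F'.toFun (φ _) = _
    rw [hφ, hι'.toFun_smul, hι.toFun_smul, h1]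
  · obtain ⟨g, x, rfl⟩ := hι.exists_smul h hF q
    change F'.toFun (φ _) = _
    rw [hφ, hι'.toFun_smul, hι.toFun_smul, h1]
  · obtain ⟨g', x, rfl⟩ := hι.exists_smul h hF q
    change φ _ = g • φ _
    rw [← mul_smul, hφ, hφ, mul_smul]

/-- An equivariant map of orbits restricts to the slices. -/
theorem exists_restriction (h : Setup G Z Φ p) (hι : IsSliceMap p f F ι)
    (hι' : IsSliceMap p f' F' ι') {φ : F.carrier → F'.carrier} (hφ : Continuous φ)
    (h1 : ∀ q, F'.toFun (φ q) = F.toFun q) :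
    ∃ ψ : f.carrier → f'.carrier, Continuous ψ ∧ ∀ x, ι' (ψ x) = φ (ι x) := by
  choose ψ hψ using fun x => hι'.mem_range (φ (ι x)) (by
    rw [h1, hι.toFun_eq]; exact h.head_emb_mem _)
  refine ⟨ψ, ?_, hψ⟩
  rw [hι'.isClosedEmbedding.isEmbedding.continuous_iff]
  exact (hφ.comp hι.isClosedEmbedding.continuous).congr fun x => (hψ x).symm

theorem slice_equivalent (h : Setup G Z Φ p) (hι : IsSliceMap p f F ι)
    (hι' : IsSliceMap p f' F' ι') (hFF : F.Equivalent F') : f.Equivalent f' := by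
  obtain ⟨φ, h1, h2⟩ := hFF
  obtain ⟨ψ, hψc, hψ⟩ := exists_restriction h hι hι' φ.continuous h1
  obtain ⟨ψ', hψc', hψ'⟩ := exists_restriction h hι' hι φ.symm.continuous fun q => by
    rw [← h1, φ.apply_symm_apply]
  have hf : ∀ x, f'.toFun (ψ x) = f.toFun x := fun x => emb_injective h.reg.norm_eq (by
    rw [← hι'.toFun_eq, hψ, h1, hι.toFun_eq])
  let Ψ : f.carrier ≃ₜ f'.carrier :=
    { toFun := ψ
      invFun := ψ'
      left_inv := fun x => hι.isClosedEmbedding.injective (by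
        rw [hψ', hψ, φ.symm_apply_apply])
      right_inv := fun x => hι'.isClosedEmbedding.injective (by
        rw [hψ, hψ', φ.apply_symm_apply])
      continuous_toFun := hψc
      continuous_invFun := hψc' }
  refine ⟨LagrangianImmersion.diffeomorphOfHomeomorph (F := f.toLagrangianImmersion)
    (F' := f'.toLagrangianImmersion) Ψ hf, hf, fun c x => ?_⟩
  obtain ⟨g, rfl⟩ := QuotientGroup.mk_surjective c
  refine hι'.isClosedEmbedding.injective ?_
  change ι' (ψ ((g : Ck G z) • x)) = ι' ((g : Ck G z) • ψ x)
  rw [hψ, hι.smul_eq, h2, hι'.smul_eq, hψ]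

/-! ### Ranges and embeddings -/

theorem range_eq (h : Setup G Z Φ p) (hι : IsSliceMap p f F ι) :
    Set.range f.toFun = slice Φ (Set.range F.toFun) := by
  ext x
  change _ ↔ embed Φ x ∈ Set.range F.toFun
  rw [h.embed_eq]
  constructor
  · rintro ⟨y, rfl⟩
    exact ⟨ι y, hι.toFun_eq y⟩
  · rintro ⟨q, hq⟩
    obtain ⟨y, rfl⟩ := hι.mem_range q (by rw [hq]; exact h.head_emb_mem x)
    exact ⟨y, emb_injective h.reg.norm_eq (by rw [← hq, hι.toFun_eq])⟩

theorem range_eq_orbitOf (h : Setup G Z Φ p) (hι : IsSliceMap p f F ι)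
    (hF : ∀ q, F.toFun q ∈ timesC Z) :
    Set.range F.toFun = orbitOf G Φ (Set.range f.toFun) := by
  ext w
  constructor
  · rintro ⟨q, rfl⟩
    obtain ⟨g, x, rfl⟩ := hι.exists_smul h hF q
    exact ⟨g, _, ⟨x, rfl⟩, by rw [h.embed_eq, hι.toFun_smul]⟩
  · rintro ⟨g, _, ⟨x, rfl⟩, rfl⟩
    exact ⟨g • ι x, by rw [h.embed_eq, hι.toFun_smul]⟩

/-- The action on the image of an equivariant immersion. -/
@[reducible]
def rangeAction (F : GImmersion G) : MulAction G (Set.range F.toFun) where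
  smul g y := ⟨ext (k + 1) (g : SU (k + 1)) y.1, by
    obtain ⟨q, hq⟩ := y.2
    exact ⟨g • q, by rw [F.equivariant, hq]⟩⟩
  one_smul y := Subtype.ext (ext_one_apply _)
  mul_smul g g' y := Subtype.ext (ext_mul_apply (g : SU (k + 1)) g' _)

/-- The orbit of an embedded surface is embedded. -/
theorem isEmbedding (h : Setup G Z Φ p) (hι : IsSliceMap p f F ι)
    (hF : ∀ q, F.toFun q ∈ timesC Z) (hf : ∀ x, k = 0 ∨ f.toFun x 0 ≠ 0)
    (he : IsEmbedding f.toFun) : IsEmbedding F.toFun := by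
  have : CompactSpace G := isCompact_iff_compactSpace.1 h.compact
  let _ := rangeAction F
  have hcs : ContinuousSMul G (Set.range F.toFun) := ⟨by
    have h1 : Continuous fun y : G × Set.range F.toFun => ((y.1 : SU (k + 1)), (y.2 : C (k + 2))) :=
      (continuous_subtype_val.comp continuous_fst).prodMk
        (continuous_subtype_val.comp continuous_snd)
    exact ((continuous_ext (n := k + 1)).comp h1).subtype_mk _⟩
  let j : f.carrier → Set.range F.toFun := fun x => ⟨F.toFun (ι x), _, rfl⟩
  have hemb : IsEmbedding (emb p) := Topology.IsEmbedding.of_leftInverse (f := coproj p)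
    (coproj_emb h.reg.norm_eq) (coproj p).continuous (embL p).continuous
  -- Inside the image of F the surface is the closed subset cut out by P × ℂ, so the compactness
  -- argument for orbit maps applies within the image.
  have hj : IsClosedEmbedding j := by
    refine ⟨Topology.IsEmbedding.of_comp ?_ continuous_subtype_val ?_, ?_⟩
    · exact (F.smooth.continuous.comp hι.isClosedEmbedding.continuous).subtype_mk _
    · have e : Subtype.val ∘ j = emb p ∘ f.toFun := funext hι.toFun_eq
      rw [e]
      exact hemb.comp he
    · have e : Set.range j = Subtype.val ⁻¹' timesC (line z : Set (C (k + 1))) := by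
        ext ⟨w, q, rfl⟩
        constructor
        · rintro ⟨x, hx⟩
          have hx' : F.toFun (ι x) = F.toFun q := congrArg Subtype.val hx
          change head (F.toFun q) ∈ line z
          rw [← hx', hι.toFun_eq]
          exact h.head_emb_mem _
        · intro hq
          obtain ⟨x, rfl⟩ := hι.mem_range q hq
          exact ⟨x, rfl⟩
      rw [e]
      exact ((Submodule.closed_of_finiteDimensional _).preimage
        (headL (k + 1)).continuous).preimage continuous_subtype_val
  have hinj : Function.Injective F.toFun := fun q q' hq => by
    obtain ⟨g, x, rfl⟩ := hι.exists_smul h hF q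
    obtain ⟨g', x', rfl⟩ := hι.exists_smul h hF q'
    rw [hι.toFun_smul, hι.toFun_smul] at hq
    obtain ⟨γ, hγ, hx⟩ := exists_eq_smul h hf (g := g'⁻¹ * g) (x := x) (x' := x') (by
      rw [Subgroup.coe_mul, Subgroup.coe_inv, ext_mul_apply, hq, ext_inv_apply])
    rw [he.injective hx, hι.smul_eq, hγ, mul_smul, smul_inv_smul]
  let F₀ : F.carrier → Set.range F.toFun := Set.rangeFactorization F.toFun
  -- The image of K is also the image, under the closed map (g, x) ↦ g • j x, of the preimage of K
  -- in G × Ľ.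
  have hF₀ : IsClosedMap F₀ := fun K hK => by
    have h1 := isClosedMap_smul hj _ (hK.preimage (hι.isQuotientMap h hF).continuous)
    convert h1 using 1
    ext w
    constructor
    · rintro ⟨q, hq, rfl⟩
      obtain ⟨g, x, rfl⟩ := hι.exists_smul h hF q
      exact ⟨(g, x), hq, Subtype.ext (F.equivariant g (ι x)).symm⟩
    · rintro ⟨⟨g, x⟩, hq, rfl⟩
      exact ⟨g • ι x, hq, Subtype.ext (F.equivariant g (ι x))⟩
  have hcl : IsClosedEmbedding F₀ := IsClosedEmbedding.of_continuous_injective_isClosedMap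
    (F.smooth.continuous.subtype_mk _) (fun q q' hq => hinj (congrArg Subtype.val hq)) hF₀
  exact IsEmbedding.subtypeVal.comp hcl.isEmbedding

end Setup.IsSliceMap

end

/-! ### The slice as a surface with an action of C_k. -/

section

variable {k : ℕ} {G : Subgroup (SU (k + 1))} {Z : Set (C (k + 1))} {z : C (k + 1)}
  {Φ : line z ≃ₗᵢ[ℂ] ℂ} {p : C (k + 1)}

namespace Setup

/-! ### Slices of invariant Lagrangians -/

/-- The intersection of a Lagrangian with `P × ℂ`. -/
def sliceImmersion (h : Setup G Z Φ p) (F : LagrangianImmersion (k + 2))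
    (hF : ∀ q, F.toFun q ∈ timesC Z)
    (hreg : ∀ q (c : ℂ), head (F.toFun q) = c • p → k = 0 ∨ c ≠ 0) : LagrangianImmersion 2 :=
  LagrangianImmersion.ofCharts
    (hasChart_slice h.reg F (fun q => (h.mem_iff _).1 (hF q)) hreg)

section

variable (h : Setup G Z Φ p) (F : LagrangianImmersion (k + 2))
    (hF : ∀ q, F.toFun q ∈ timesC Z)
    (hreg : ∀ q (c : ℂ), head (F.toFun q) = c • p → k = 0 ∨ c ≠ 0)

/-- The inclusion of the intersection with `P × ℂ`. -/
def sliceIncl (x : (h.sliceImmersion F hF hreg).carrier) : F.carrier := x.1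

theorem emb_sliceImmersion (x : (h.sliceImmersion F hF hreg).carrier) :
    emb p ((h.sliceImmersion F hF hreg).toFun x) = F.toFun (h.sliceIncl F hF hreg x) := by
  obtain ⟨c, hc⟩ := x.2
  exact emb_coproj h.reg.norm_eq hc

theorem isClosedEmbedding_sliceIncl : IsClosedEmbedding (h.sliceIncl F hF hreg) := by
  have hcl : IsClosed {q : F.carrier | ∃ c : ℂ, head (F.toFun q) = c • p} := by
    have h1 : IsClosed ((fun q => head (F.toFun q)) ⁻¹' (line z : Set (C (k + 1)))) :=
      (Submodule.closed_of_finiteDimensional _).preimage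
        ((headL (k + 1)).continuous.comp F.smooth.continuous)
    convert h1 using 1
    ext q
    exact h.mem_line.symm
  exact hcl.isClosedEmbedding_subtypeVal

theorem exists_sliceIncl_eq {q : F.carrier} (hq : head (F.toFun q) ∈ line z) :
    ∃ x, h.sliceIncl F hF hreg x = q := ⟨⟨q, h.mem_line.1 hq⟩, rfl⟩

theorem sliceImmersion_ne_zero (x : (h.sliceImmersion F hF hreg).carrier) :
    k = 0 ∨ (h.sliceImmersion F hF hreg).toFun x 0 ≠ 0 := by
  refine hreg (h.sliceIncl F hF hreg x) _ ?_
  rw [← h.emb_sliceImmersion, head_emb]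

theorem range_sliceImmersion :
    Set.range (h.sliceImmersion F hF hreg).toFun = slice Φ (Set.range F.toFun) := by
  ext x
  change _ ↔ embed Φ x ∈ Set.range F.toFun
  rw [h.embed_eq]
  constructor
  · rintro ⟨y, rfl⟩
    exact ⟨_, (h.emb_sliceImmersion F hF hreg y).symm⟩
  · rintro ⟨q, hq⟩
    obtain ⟨y, rfl⟩ := h.exists_sliceIncl_eq F hF hreg (q := q) (by
      rw [hq]; exact h.head_emb_mem x)
    exact ⟨y, emb_injective h.reg.norm_eq (by rw [h.emb_sliceImmersion, hq])⟩

theorem isEmbedding_sliceImmersion (he : IsEmbedding F.toFun) :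
    IsEmbedding (h.sliceImmersion F hF hreg).toFun := by
  have e : emb p ∘ (h.sliceImmersion F hF hreg).toFun = F.toFun ∘ h.sliceIncl F hF hreg :=
    funext (h.emb_sliceImmersion F hF hreg)
  refine IsEmbedding.of_comp (h.sliceImmersion F hF hreg).smooth.continuous
    (embL p).continuous ?_
  change IsEmbedding (emb p ∘ _)
  rw [e]
  exact he.comp (h.isClosedEmbedding_sliceIncl F hF hreg).isEmbedding

end

section

variable (h : Setup G Z Φ p) (F : GImmersion G) (hF : ∀ q, F.toFun q ∈ timesC Z)
    (hreg : ∀ q (c : ℂ), head (F.toFun q) = c • p → k = 0 ∨ c ≠ 0)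

theorem head_smul_mem (g : stabLine G z) {q : F.carrier} (hq : head (F.toFun q) ∈ line z) :
    head (F.toFun ((g : G) • q)) ∈ line z := by
  rw [F.equivariant, head_ext]
  exact (g.2 _).2 hq

/-- The action of `C_k` on the intersection with `P × ℂ`. -/
@[reducible]
def sliceAction : MulAction (Ck G z) (h.sliceImmersion F.toLagrangianImmersion hF hreg).carrier where
  smul c x := Quotient.liftOn' c
    (fun g => (⟨(g : G) • x.1, h.mem_line.1 (head_smul_mem F g (h.mem_line.2 x.2))⟩ :
      (h.sliceImmersion F.toLagrangianImmersion hF hreg).carrier)) fun g g' hgg => by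
    have h1 : (g : Ck G z) = (g' : Ck G z) := Quotient.sound' hgg
    rw [h.mk_eq_iff] at h1
    obtain ⟨c, hc⟩ := x.2
    refine Subtype.ext ?_
    change (g : G) • x.1 = (g' : G) • x.1
    rw [← inv_smul_eq_iff, ← mul_smul]
    -- Representatives of one class move the position in the same way; the isotropy condition lifts
    -- this to the points of the immersed manifold.
    refine F.isotropy_eq _ _ ?_
    rw [ext_apply, hc, map_smul, Subgroup.coe_mul, Subgroup.coe_inv, gop_mul, mul_apply_eq_comp,
      h1, gop_inv_apply, ← hc, pair_head]
  one_smul x := Subtype.ext (one_smul G x.1)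
  mul_smul c c' x := by
    obtain ⟨g, rfl⟩ := QuotientGroup.mk_surjective c
    obtain ⟨g', rfl⟩ := QuotientGroup.mk_surjective c'
    exact Subtype.ext (mul_smul (g : G) (g' : G) x.1)

/-- The intersection of an equivariant immersion with `P × ℂ`. -/
def ckSlice : CkImmersion G Φ where
  toLagrangianImmersion := h.sliceImmersion F.toLagrangianImmersion hF hreg
  action := h.sliceAction F hF hreg
  continuous_action := by
    let _ := h.sliceAction F hF hreg
    refine ⟨fun c => ?_⟩
    obtain ⟨g, rfl⟩ := QuotientGroup.mk_surjective c
    have h1 : Continuous fun x : (h.sliceImmersion F.toLagrangianImmersion hF hreg).carrier =>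
        (g : G) • x.1 :=
      (continuous_const_smul (g : G)).comp continuous_subtype_val
    exact h1.subtype_mk _
  equivariant g x := by
    let _ := h.sliceAction F hF hreg
    rw [h.embed_eq, h.embed_eq, h.emb_sliceImmersion, h.emb_sliceImmersion]
    exact F.equivariant (g : G) x.1

theorem isSliceMap_ckSlice : IsSliceMap p (h.ckSlice F hF hreg) F
    (h.sliceIncl F.toLagrangianImmersion hF hreg) where
  isClosedEmbedding := h.isClosedEmbedding_sliceIncl _ hF hreg
  mem_range _ hq := h.exists_sliceIncl_eq _ hF hreg hq
  toFun_eq x := (h.emb_sliceImmersion _ hF hreg x).symm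
  smul_eq _ _ := rfl

end

end Setup

end

/-! ### Angle equations, and assembly of the correspondences. -/

section

/-! ### The weighted equations -/

/-- The angles of a plane form one class modulo π, so a congruence for all of them amounts to one
explicit angle. With n = k + 1 the weight n - 1 is k. -/
theorem angle_weight_iff {k : ℕ} {T : Submodule ℝ (C 2)} (hT : IsLagPlane T) (c : ℂ) (t : ℝ) :
    IsLagrangianAngle T (-t - k * Complex.arg c) ↔ ∀ θ, IsLagrangianAngle T θ →
      θ + (((k + 1 : ℕ) : ℝ) - 1) * Complex.arg c + t ≡ 0 [PMOD Real.pi] := by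
  push_cast
  rw [add_sub_cancel_right]
  constructor
  · intro h θ hθ
    have h1 := ((hT.angle_iff_modEq h θ).1 hθ).add_right (k * Complex.arg c + t)
    have e : -t - k * Complex.arg c + (k * Complex.arg c + t) = 0 := by ring
    rw [e, ← add_assoc] at h1
    exact h1
  · intro h
    obtain ⟨θ, hθ⟩ := hT.exists_angle
    rw [hT.angle_iff_modEq hθ]
    have h1 := (h θ hθ).symm.add_right (-t - k * Complex.arg c)
    have e : θ + k * Complex.arg c + t + (-t - k * Complex.arg c) = θ := by ring
    rwa [e, zero_add] at h1

theorem isWeightedTranslator_iff {k : ℕ} (f : LagrangianImmersion 2) :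
    IsWeightedTranslator (k + 1) f ↔ ∀ x, (k = 0 ∨ f.toFun x 0 ≠ 0) ∧
      IsLagrangianAngle (f.tangentPlane x)
        (-(f.toFun x 1).im - k * Complex.arg (f.toFun x 0)) := by
  refine forall_congr' fun x => ?_
  rw [angle_weight_iff (f.isLagPlane_tangentPlane x), Nat.add_eq_right]

theorem isWeightedSpecialLagrangian_iff {k : ℕ} (f : LagrangianImmersion 2) :
    IsWeightedSpecialLagrangian (k + 1) f ↔ ∀ x, (k = 0 ∨ f.toFun x 0 ≠ 0) ∧
      IsLagrangianAngle (f.tangentPlane x) (-(k * Complex.arg (f.toFun x 0))) := by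
  refine forall_congr' fun x => ?_
  rw [Nat.add_eq_right]
  refine and_congr_right fun _ => ?_
  push_cast
  rw [add_sub_cancel_right]
  constructor
  · rintro ⟨θ, hθ, h⟩
    rwa [← eq_neg_of_add_eq_zero_left h]
  · intro h
    exact ⟨_, h, neg_add_cancel _⟩

variable {k : ℕ} {G : Subgroup (SU (k + 1))} {Z : Set (C (k + 1))} {z : C (k + 1)}
  {Φ : line z ≃ₗᵢ[ℂ] ℂ} {p : C (k + 1)}

/-- Corresponding equations for the Lagrangian angles of Lagrangians and of surfaces. -/
structure AnglePair (k : ℕ) (Q : LagrangianImmersion (k + 2) → Prop)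
    (R : LagrangianImmersion 2 → Prop) (s : ℝ) : Prop where
  left_iff : ∀ F, Q F ↔
    ∀ q, IsLagrangianAngle (F.tangentPlane q) (-(s * (F.toFun q (Fin.last (k + 1))).im))
  right_iff : ∀ f, R f ↔ ∀ x, (k = 0 ∨ f.toFun x 0 ≠ 0) ∧
    IsLagrangianAngle (f.tangentPlane x)
      (-(s * (f.toFun x 1).im) - k * Complex.arg (f.toFun x 0))

theorem anglePair_translator (k : ℕ) : AnglePair k IsTranslator (IsWeightedTranslator (k + 1)) 1 :=
  ⟨fun F => by simpa only [one_mul] using isTranslator_iff F,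
    fun f => by simpa only [one_mul] using isWeightedTranslator_iff f⟩

theorem anglePair_specialLagrangian (k : ℕ) :
    AnglePair k IsSpecialLagrangian (IsWeightedSpecialLagrangian (k + 1)) 0 :=
  ⟨fun F => by simpa only [zero_mul, neg_zero] using isSpecialLagrangian_iff F,
    fun f => by
      simpa only [zero_mul, neg_zero, zero_sub] using isWeightedSpecialLagrangian_iff f⟩

namespace Setup

variable {Q : LagrangianImmersion (k + 2) → Prop} {R : LagrangianImmersion 2 → Prop} {s : ℝ}

theorem angle_iff (h : Setup G Z Φ p) {F : LagrangianImmersion (k + 2)}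
    {f : LagrangianImmersion 2} {ι : f.carrier → F.carrier} (hι : Continuous ι)
    (hFι : ∀ x, F.toFun (ι x) = emb p (f.toFun x)) (hF : ∀ q, F.toFun q ∈ timesC Z)
    {x : f.carrier} (hx : k = 0 ∨ f.toFun x 0 ≠ 0) :
    IsLagrangianAngle (F.tangentPlane (ι x)) (-(s * (F.toFun (ι x) (Fin.last (k + 1))).im)) ↔
      IsLagrangianAngle (f.tangentPlane x)
        (-(s * (f.toFun x 1).im) - k * Complex.arg (f.toFun x 0)) := by
  obtain ⟨e, he, ho, h1⟩ := h.frame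
  rw [angle_slice_iff he ho h1 hι hFι (fun q => (h.mem_iff _).1 (hF q)) hx, hFι, emb_last]

theorem right_of_left (h : Setup G Z Φ p) (hQR : AnglePair k Q R s)
    {F : LagrangianImmersion (k + 2)}
    {f : LagrangianImmersion 2} {ι : f.carrier → F.carrier} (hι : Continuous ι)
    (hFι : ∀ x, F.toFun (ι x) = emb p (f.toFun x)) (hF : ∀ q, F.toFun q ∈ timesC Z)
    (hf : ∀ x, k = 0 ∨ f.toFun x 0 ≠ 0) (hQ : Q F) : R f := by
  rw [hQR.right_iff]
  exact fun x => ⟨hf x, (h.angle_iff hι hFι hF (hf x)).1 ((hQR.left_iff F).1 hQ (ι x))⟩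

/-- The angle equation has to be checked only along the slice: G preserves Lagrangian angles and the
last coordinate, and it moves every point into the slice. -/
theorem left_of_right (h : Setup G Z Φ p) (hQR : AnglePair k Q R s) {F : GImmersion G}
    {f : LagrangianImmersion 2} {ι : f.carrier → F.carrier} (hι : Continuous ι)
    (hFι : ∀ x, F.toFun (ι x) = emb p (f.toFun x)) (hF : ∀ q, F.toFun q ∈ timesC Z)
    (hs : ∀ q, ∃ (g : G) (x : f.carrier), g • ι x = q) (hR : R f) : Q F.toLagrangianImmersion := by
  rw [hQR.left_iff]
  rw [hQR.right_iff] at hR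
  intro q
  obtain ⟨g, x, rfl⟩ := hs q
  have h1 := (h.angle_iff (F := F.toLagrangianImmersion) hι hFι hF (hR x).1).2 (hR x).2
  have h2 := angle_of_symmetry (F := F.toLagrangianImmersion) (continuous_const_smul g)
    (g : SU (k + 1)) (F.equivariant g) (ι x) h1
  rw [F.equivariant, ext_last]
  exact h2

/-! ### The correspondence for equivariant immersions -/

theorem immersedCorrespondence (h : Setup G Z Φ p) (hQR : AnglePair k Q R s) :
    ImmersedCorrespondence (leftImmersions G Z Q) (rightImmersions G Φ R) := by
  have hnz : ∀ f ∈ rightImmersions G Φ R, ∀ x, k = 0 ∨ f.toFun x 0 ≠ 0 := fun f hf x =>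
    ((hQR.right_iff _).1 hf x).1
  have hleft : ∀ F ∈ leftImmersions G Z Q, ∀ q, F.toFun q ∈ timesC Z := fun F hF q =>
    hF.2.1 ⟨q, rfl⟩
  refine ⟨fun F hF => ?_, fun f hf => ?_, fun F hF F' hF' f hf f' hf' hs hs' => ?_,
    fun F hF f hf hs => ?_⟩
  · have hreg : ∀ q (c : ℂ), head (F.toFun q) = c • p → k = 0 ∨ c ≠ 0 := fun q c hc =>
      ne_zero_of_isCohomogeneity hF.2.2 ⟨q, rfl⟩ hc
    have hι := h.isSliceMap_ckSlice F (hleft F hF) hreg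
    exact ⟨h.ckSlice F (hleft F hF) hreg, h.right_of_left hQR hι.isClosedEmbedding.continuous
      hι.toFun_eq (hleft F hF) (h.sliceImmersion_ne_zero _ (hleft F hF) hreg) hF.1, h.isSliceOf_iff.2 ⟨_, hι⟩⟩
  · have hι := h.isSliceMap_incl f (hnz f hf)
    set D := h.orbitData f (hnz f hf)
    have hr : ∀ w ∈ Set.range (D.toGImmersion h.compact h.reg).toFun, ∃ g : G,
        ∃ x ∈ Set.range f.toFun, w = ext (k + 1) (g : SU (k + 1)) (emb p x) := by
      rw [D.range_toFun h.compact h.reg]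
      rintro _ ⟨g, hg, x, rfl⟩
      exact ⟨⟨g, hg⟩, _, ⟨x, rfl⟩, rfl⟩
    have hZ : ∀ w ∈ Set.range (D.toGImmersion h.compact h.reg).toFun, w ∈ timesC Z := fun w hw => by
      obtain ⟨g, x, -, rfl⟩ := hr w hw
      exact h.ext_emb_mem g x
    refine ⟨_, ⟨?_, hZ, ?_⟩, h.isSliceOf_iff.2 ⟨_, hι⟩⟩
    · exact h.left_of_right hQR hι.isClosedEmbedding.continuous hι.toFun_eq
        (fun q => hZ _ ⟨q, rfl⟩) (hι.exists_smul h fun q => hZ _ ⟨q, rfl⟩) hf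
    · refine h.isCohomogeneity (S := Set.range f.toFun) ?_ hr
      rintro _ ⟨x, rfl⟩
      exact hnz f hf x
  · obtain ⟨ι, hι⟩ := h.isSliceOf_iff.1 hs
    obtain ⟨ι', hι'⟩ := h.isSliceOf_iff.1 hs'
    exact ⟨hι.slice_equivalent h hι', hι.equivalent_of_equivalent h hι' (hleft F hF)
      (hleft F' hF') (hnz f hf) (hnz f' hf')⟩
  · obtain ⟨ι, hι⟩ := h.isSliceOf_iff.1 hs
    exact ⟨hι.range_eq h, hι.range_eq_orbitOf h (hleft F hF)⟩

/-! ### The correspondence for subsets -/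

theorem orbitOf_eq (h : Setup G Z Φ p) (S : Set (C 2)) : orbitOf G Φ S =
    {w | ∃ g : G, ∃ x ∈ S, w = ext (k + 1) (g : SU (k + 1)) (emb p x)} := by
  simp only [orbitOf, h.embed_eq]

theorem isCkInvariant_iff (h : Setup G Z Φ p) {S : Set (C 2)} : IsCkInvariant G Φ S ↔
    ∀ g : stabLine G z, ∀ x ∈ S, ∃ x' ∈ S,
      emb p x' = ext (k + 1) ((g : G) : SU (k + 1)) (emb p x) := by
  simp only [IsCkInvariant, h.embed_eq, Set.mem_image]

theorem slice_orbitOf (h : Setup G Z Φ p) {S : Set (C 2)} (hS : IsCkInvariant G Φ S)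
    (hnz : ∀ x ∈ S, k = 0 ∨ x 0 ≠ 0) : slice Φ (orbitOf G Φ S) = S := by
  rw [h.isCkInvariant_iff] at hS
  ext x
  change embed Φ x ∈ orbitOf G Φ S ↔ _
  rw [h.embed_eq, h.orbitOf_eq]
  constructor
  · rintro ⟨g, y, hy, hxy⟩
    have hg := h.mem_stabLine_of_ext (hnz y hy) hxy (h.head_emb_mem x)
    obtain ⟨x', hx', he⟩ := hS ⟨g, hg⟩ y hy
    rwa [emb_injective h.reg.norm_eq (hxy.trans he.symm)]
  · intro hx
    exact ⟨1, x, hx, by simp⟩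

theorem orbitOf_slice (h : Setup G Z Φ p) {L : Set (C (k + 2))} (hL : L ⊆ timesC Z)
    (hinv : IsInvariant G (ext (k + 1)) L) : orbitOf G Φ (slice Φ L) = L := by
  rw [h.orbitOf_eq]
  ext w
  constructor
  · rintro ⟨g, x, hx, rfl⟩
    change embed Φ x ∈ L at hx
    rw [h.embed_eq] at hx
    exact hinv g g.2 _ hx
  · intro hw
    obtain ⟨g, x, rfl⟩ := h.exists_ext_emb (hL hw)
    refine ⟨g, x, ?_, rfl⟩
    change embed Φ x ∈ L
    rw [h.embed_eq]
    have := hinv _ (G.inv_mem g.2) _ hw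
    rwa [ext_inv_apply] at this

theorem isCkInvariant_slice (h : Setup G Z Φ p) {L : Set (C (k + 2))}
    (hinv : IsInvariant G (ext (k + 1)) L) : IsCkInvariant G Φ (slice Φ L) := by
  rw [h.isCkInvariant_iff]
  intro g x hx
  change embed Φ x ∈ L at hx
  rw [h.embed_eq] at hx
  obtain ⟨c, hc⟩ := h.mem_line.1 ((g.2 _).2 (h.head_emb_mem x))
  have he := emb_coproj (w := ext (k + 1) ((g : G) : SU (k + 1)) (emb p x)) h.reg.norm_eq
    ((head_ext _ _).trans hc)
  refine ⟨_, ?_, he⟩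
  change embed Φ _ ∈ L
  rw [h.embed_eq, he]
  exact hinv _ (g : G).2 _ hx

theorem isInvariant_orbitOf (h : Setup G Z Φ p) (S : Set (C 2)) :
    IsInvariant G (ext (k + 1)) (orbitOf G Φ S) := by
  rw [h.orbitOf_eq]
  intro g hg w hw
  obtain ⟨g', x, hx, hw⟩ := hw
  refine ⟨⟨g, hg⟩ * g', x, hx, ?_⟩
  rw [hw, Subgroup.coe_mul, ext_mul_apply]

/-- The correspondence for subsets, given that surfaces have orbits of the right kind. -/
theorem setCorrespondence (h : Setup G Z Φ p) (hQR : AnglePair k Q R s)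
    {E : LagrangianImmersion (k + 2) → Prop} {E' : LagrangianImmersion 2 → Prop}
    (hE : ∀ F hF hreg, E F → E' (h.sliceImmersion F hF hreg))
    (hE' : ∀ f, E' f → (∀ x, k = 0 ∨ f.toFun x 0 ≠ 0) → IsCkInvariant G Φ (Set.range f.toFun) →
      ∃ (F : GImmersion G) (ι : f.carrier → F.carrier), E F.toLagrangianImmersion ∧ Continuous ι ∧
        (∀ x, F.toFun (ι x) = emb p (f.toFun x)) ∧
        ∀ q, ∃ (g : G) (x : f.carrier), g • ι x = q) :
    SetCorrespondence G Φ (leftSets G Z E Q) (rightSets G Φ E' R) := by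
  have h1 : Set.MapsTo (slice Φ) (leftSets G Z E Q) (rightSets G Φ E' R) := by
    rintro _ ⟨⟨F, hEF, hQ, rfl⟩, hZ, hinv, hcoh⟩
    have hF : ∀ q, F.toFun q ∈ timesC Z := fun q => hZ ⟨q, rfl⟩
    have hreg : ∀ q (c : ℂ), head (F.toFun q) = c • p → k = 0 ∨ c ≠ 0 := fun q c hc =>
      ne_zero_of_isCohomogeneity hcoh ⟨q, rfl⟩ hc
    refine ⟨⟨h.sliceImmersion F hF hreg, hE F hF hreg hEF, ?_,
      h.range_sliceImmersion F hF hreg⟩, h.isCkInvariant_slice hinv⟩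
    exact h.right_of_left hQR (h.isClosedEmbedding_sliceIncl F hF hreg).continuous
      (fun x => (h.emb_sliceImmersion F hF hreg x).symm) hF (h.sliceImmersion_ne_zero F hF hreg) hQ
  have hnz : ∀ S ∈ rightSets G Φ E' R, ∀ x ∈ S, k = 0 ∨ x 0 ≠ 0 := by
    rintro _ ⟨⟨f, -, hR, rfl⟩, -⟩ _ ⟨x, rfl⟩
    exact ((hQR.right_iff _).1 hR x).1
  have h2 : Set.MapsTo (orbitOf G Φ) (rightSets G Φ E' R) (leftSets G Z E Q) := by
    intro S hS
    have hnzS := hnz S hS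
    obtain ⟨⟨f, hEf, hR, rfl⟩, hinv⟩ := hS
    obtain ⟨F, ι, hEF, hι, hFι, hs⟩ := hE' f hEf (fun x => hnzS _ ⟨x, rfl⟩) hinv
    have hr : Set.range F.toFun = orbitOf G Φ (Set.range f.toFun) := by
      rw [h.orbitOf_eq]
      ext w
      constructor
      · rintro ⟨q, rfl⟩
        obtain ⟨g, x, rfl⟩ := hs q
        exact ⟨g, _, ⟨x, rfl⟩, by rw [F.equivariant, hFι]⟩
      · rintro ⟨g, _, ⟨x, rfl⟩, rfl⟩
        exact ⟨g • ι x, by rw [F.equivariant, hFι]⟩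
    have hZ : orbitOf G Φ (Set.range f.toFun) ⊆ timesC Z := by
      rw [h.orbitOf_eq]
      rintro _ ⟨g, x, -, rfl⟩
      exact h.ext_emb_mem g x
    refine ⟨⟨F.toLagrangianImmersion, hEF, ?_, hr⟩, hZ, h.isInvariant_orbitOf _, ?_⟩
    · exact h.left_of_right hQR hι hFι (fun q => hZ (hr ▸ ⟨q, rfl⟩)) hs hR
    · refine h.isCohomogeneity hnzS fun w hw => ?_
      rwa [h.orbitOf_eq] at hw
  have h3 : Set.InvOn (orbitOf G Φ) (slice Φ) (leftSets G Z E Q) (rightSets G Φ E' R) :=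
    ⟨fun L hL => h.orbitOf_slice hL.2.1 hL.2.2.1, fun S hS => h.slice_orbitOf hS.2 (hnz S hS)⟩
  exact ⟨h3.bijOn h1 h2, h3.symm.bijOn h2 h1, h3⟩

/-- An immersed surface in `P × ℂ` has an orbit. -/
theorem exists_orbit (h : Setup G Z Φ p) (f : LagrangianImmersion 2)
    (hf : ∀ x, k = 0 ∨ f.toFun x 0 ≠ 0) :
    ∃ (F : GImmersion G) (ι : f.carrier → F.carrier), Continuous ι ∧
      (∀ x, F.toFun (ι x) = emb p (f.toFun x)) ∧
      ∀ q, ∃ (g : G) (x : f.carrier), g • ι x = q := by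
  let D : OrbitData G p :=
    { f := f
      -- Invariance of the image alone need not lift to an action on the surface, so no quotient is
      -- taken. The resulting immersion may cover its image several times, which is harmless for
      -- subsets.
      Q := f.carrier
      proj := id
      isLocalHomeomorph := (Homeomorph.refl f.carrier).isLocalHomeomorph
      exists_of_eq := fun x x' hx => ⟨1, G.one_mem, by
        have hx' : x = x' := hx
        rw [ext_one_apply, hx']⟩
      ne_zero := hf }
  refine ⟨D.toGImmersion h.compact h.reg, D.incl, D.continuous_incl, fun x => rfl, fun q => ?_⟩
  obtain ⟨g, x, hq⟩ := D.exists_smul_incl q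
  exact ⟨g, x, hq.symm⟩

/-- An embedded surface with invariant image carries an action of `C_k`. -/
theorem exists_ckImmersion (h : Setup G Z Φ p) (f : LagrangianImmersion 2)
    (he : IsEmbedding f.toFun) (hinv : IsCkInvariant G Φ (Set.range f.toFun)) :
    ∃ f' : CkImmersion G Φ, f'.toLagrangianImmersion = f := by
  rw [h.isCkInvariant_iff] at hinv
  have hex : ∀ (g : stabLine G z) (x : f.carrier), ∃ x' : f.carrier,
      emb p (f.toFun x') = ext (k + 1) ((g : G) : SU (k + 1)) (emb p (f.toFun x)) := fun g x => by
    obtain ⟨_, ⟨x', rfl⟩, hx'⟩ := hinv g _ ⟨x, rfl⟩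
    exact ⟨x', hx'⟩
  choose a ha using hex
  have hinj : Function.Injective fun x => emb p (f.toFun x) :=
    (emb_injective h.reg.norm_eq).comp he.injective
  have hemb : IsEmbedding fun x => emb p (f.toFun x) :=
    (Topology.IsEmbedding.of_leftInverse (f := coproj p)
      (coproj_emb h.reg.norm_eq) (coproj p).continuous (embL p).continuous).comp he
  have hwd : ∀ g g' : stabLine G z, (g : Ck G z) = g' → a g = a g' := fun g g' hgg => by
    funext x
    rw [h.mk_eq_iff] at hgg
    refine hinj ?_
    beta_reduce
    rw [ha, ha, ext_apply, ext_apply, head_emb, map_smul, map_smul, hgg]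
  let act : MulAction (Ck G z) f.carrier :=
    { smul := fun c x => Quotient.liftOn' c (fun g => a g x) fun g g' hgg =>
        congrFun (hwd g g' (Quotient.sound' hgg)) x
      one_smul := fun x => hinj (by
        change emb p (f.toFun (a 1 x)) = _
        rw [ha]; exact ext_one_apply _)
      mul_smul := fun c c' x => by
        obtain ⟨g, rfl⟩ := QuotientGroup.mk_surjective c
        obtain ⟨g', rfl⟩ := QuotientGroup.mk_surjective c'
        refine hinj ?_
        change emb p (f.toFun (a (g * g') x)) = emb p (f.toFun (a g (a g' x)))
        rw [ha, ha, ha]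
        exact ext_mul_apply _ _ _ }
  refine ⟨{ toLagrangianImmersion := f
            action := act
            continuous_action := ⟨fun c => ?_⟩
            equivariant := fun g x => ?_ }, rfl⟩
  · obtain ⟨g, rfl⟩ := QuotientGroup.mk_surjective c
    rw [hemb.continuous_iff]
    have h1 : Continuous fun x => extL ((g : G) : SU (k + 1)) (emb p (f.toFun x)) :=
      (extL _).continuous.comp hemb.continuous
    exact h1.congr fun x => (ha g x).symm
  · rw [h.embed_eq, h.embed_eq]
    exact ha g x

theorem correspondence (h : Setup G Z Φ p) (hQR : AnglePair k Q R s) :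
    Correspondence G Z Φ Q R := by
  refine ⟨?_, ?_, h.immersedCorrespondence hQR⟩
  · refine h.setCorrespondence hQR (h.isEmbedding_sliceImmersion) fun f he hf hinv => ?_
    -- For an embedded surface the action does lift, and dividing by C_k is what makes the immersion
    -- of the orbit injective.
    obtain ⟨f, rfl⟩ := h.exists_ckImmersion f he hinv
    have hι := h.isSliceMap_incl f hf
    have hZ : ∀ q, ((h.orbitData f hf).toGImmersion h.compact h.reg).toFun q ∈ timesC Z :=
      fun q => by
      obtain ⟨g, x, rfl⟩ := (h.orbitData f hf).exists_smul_incl q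
      exact h.ext_emb_mem g _
    exact ⟨_, _, hι.isEmbedding h hZ hf he, hι.isClosedEmbedding.continuous, hι.toFun_eq,
      hι.exists_smul h hZ⟩
  · refine h.setCorrespondence hQR (fun _ _ _ _ => trivial) fun f _ hf _ => ?_
    obtain ⟨F, ι, h1, h2, h3⟩ := h.exists_orbit f hf
    exact ⟨F, ι, trivial, h1, h2, h3⟩

end Setup

end

/-! ### Existence of regular points and the choice of Φ. -/

section

/-! ### Regular points of the zero set of the moment map -/

/-- The zero set is star-convex about 0, hence connected, so a component is all of it. -/
theorem connectedComponentIn_momentMap {n : ℕ} (G : Subgroup (SU n)) {z₀ : C n}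
    (hz₀ : z₀ ∈ momentMap G ⁻¹' {0}) :
    connectedComponentIn (momentMap G ⁻¹' {0}) z₀ = {w | MZero G w} := by
  have hS : momentMap G ⁻¹' {0} = {w | MZero G w} := by
    ext w
    exact momentMap_eq_zero_iff
  rw [hS] at hz₀ ⊢
  have hstar : StarConvex ℝ 0 {w | MZero G w} := by
    rw [starConvex_zero_iff]
    intro x hx a _ _
    have : MZero G ((a : ℂ) • x) := hx.smul _
    rwa [Complex.coe_smul] at this
  exact (hstar.isPathConnected fun X _ => inner_zero_right _).isConnected.isPreconnected.connectedComponentIn hz₀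

variable {k : ℕ} {G : Subgroup (SU (k + 1))}

theorem Reg.of_rank_zero {G : Subgroup (SU (0 + 1))} {p : C (0 + 1)} (hp : ‖p‖ = 1) : Reg G p := by
  have h0 : ∀ X ∈ lieAlg G, op X = 0 := fun X hX => by
    obtain ⟨γ, -, -, h⟩ := exists_curve hX
    have e : (fun t => CohomTwo.gop (γ t)) = fun _ => 1 :=
      funext fun t => by rw [SU.eq_one (γ t), gop_one]
    rw [e] at h
    exact h.unique (hasDerivAt_const _ _)
  refine ⟨hp, fun X hX => by rw [h0 X hX]; simp, ?_⟩
  have : tang G p = ⊥ := by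
    rw [eq_bot_iff]
    rintro _ ⟨X, hX, rfl⟩
    rw [evalOp_apply, h0 X hX]
    rfl
  rw [this, finrank_bot]

theorem Reg.of_ne_zero {p : C (k + 1)} (hp : p ≠ 0) (hm : MZero G p)
    (hf : Module.finrank ℝ (tang G p) = k) : Reg G (((‖p‖⁻¹ : ℝ) : ℂ) • p) where
  norm_eq := by
    rw [norm_smul, Complex.norm_real, norm_inv, norm_norm, inv_mul_cancel₀ (norm_ne_zero_iff.2 hp)]
  mzero := hm.smul _
  finrank_tang := by
    rw [finrank_tang_smul (by simpa using hp), hf]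

/-- Translating a point of the Lagrangian makes its isotropy group equal to H, and cohomogeneity one
in dimension k + 1 then gives dim 𝔤w = k. The point can be 0 only if k = 0, where any unit vector is
regular. -/
theorem AdmitsCohomOneLagrangian.exists_reg {Z : Set (C (k + 1))}
    (hG : IsCompact (G : Set (SU (k + 1)))) (hZ : ∀ w ∈ Z, MZero G w)
    (h : AdmitsCohomOneLagrangian G Z) : ∃ p, Reg G p := by
  obtain ⟨F, ⟨q⟩, hF, -, H, h1, h2⟩ := h
  obtain ⟨g, hg⟩ := h1 (F.toFun q) ⟨q, rfl⟩
  set w := CohomTwo.gop (g⁻¹ : SU (k + 1)) (F.toFun q) with hw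
  have hwm : MZero G w := (hZ _ (hF ⟨q, rfl⟩)).gop (G.inv_mem g.2)
  have hH : isotropy G (std (k + 1)) w = H := by
    ext γ
    have e : γ ∈ isotropy G (std (k + 1)) w ↔
        g * γ * g⁻¹ ∈ isotropy G (std (k + 1)) (F.toFun q) := by
      change CohomTwo.gop (γ : SU (k + 1)) w = w ↔
        CohomTwo.gop ((g * γ * g⁻¹ : G) : SU (k + 1)) (F.toFun q) = F.toFun q
      simp only [Subgroup.coe_mul, Subgroup.coe_inv, gop_mul, mul_apply_eq_comp]
      rw [← hw, ← (gop_injective (g : SU (k + 1))).eq_iff (b := w), hw, gop_apply_inv]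
    rw [e, hg, Subgroup.mem_map]
    constructor
    · rintro ⟨δ, hδ, hδ'⟩
      have : g * δ * g⁻¹ = g * γ * g⁻¹ := hδ'
      rwa [← mul_left_cancel (mul_right_cancel this)]
    · exact fun hγ => ⟨γ, hγ, rfl⟩
  have h3 := finrank_lieAlg_eq hG (z := w)
  rw [hH] at h3
  have h4 : Module.finrank ℝ (tang G w) = k := by omega
  by_cases hw0 : w = 0
  · have h5 : tang G w = ⊥ := by
      rw [hw0, eq_bot_iff]
      rintro _ ⟨X, hX, rfl⟩
      rw [evalOp_apply, map_zero]
      exact Submodule.zero_mem _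
    rw [h5, finrank_bot] at h4
    subst h4
    exact ⟨EuclideanSpace.single 0 1, Reg.of_rank_zero (by simp)⟩
  · exact ⟨_, Reg.of_ne_zero hw0 hwm h4⟩

/-- All nonzero zeros of μ lie in G · ℂ*p, along which the orbit dimension is constant. Hence any
nonzero z' can serve to define the profile line. -/
theorem Reg.of_mzero (hG : IsCompact (G : Set (SU (k + 1)))) {p z : C (k + 1)} (hp : Reg G p)
    (hz : MZero G z) (hz0 : z ≠ 0) : Reg G (((‖z‖⁻¹ : ℝ) : ℂ) • z) := by
  refine Reg.of_ne_zero hz0 hz ?_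
  obtain ⟨g, hg, c, rfl⟩ := hp.exists_gop_smul hG hz
  have hc : c ≠ 0 := by
    rintro rfl
    exact hz0 (by simp)
  rw [finrank_tang_gop hg, finrank_tang_smul hc, hp.finrank_tang]

/-- Φ⁻¹(1) is z'/|z'| rotated by the phase β that makes the holomorphic volume of the base frame
equal to 1. -/
theorem exists_setup (hG : IsCompact (G : Set (SU (k + 1)))) {Z : Set (C (k + 1))}
    (hZ : ∀ w, w ∈ Z ↔ MZero G w) (hL : AdmitsCohomOneLagrangian G Z) {z : C (k + 1)}
    (hz : z ∈ Z) (hz0 : z ≠ 0) : ∃ (Φ : line z ≃ₗᵢ[ℂ] ℂ) (p : C (k + 1)), Setup G Z Φ p := by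
  obtain ⟨p₁, hp₁⟩ := hL.exists_reg hG fun w hw => (hZ w).1 hw
  have hp₀ := hp₁.of_mzero hG ((hZ z).1 hz) hz0
  obtain ⟨β, hβ, hframe⟩ := hp₀.exists_normalised
  have hp := hp₀.smul hβ
  have hβ0 : β ≠ 0 := by rintro rfl; simp at hβ
  have hr0 : ((‖z‖⁻¹ : ℝ) : ℂ) ≠ 0 := by simpa using hz0
  have hspan : Submodule.span ℂ {β • ((‖z‖⁻¹ : ℝ) : ℂ) • z} = line z := by
    rw [smul_smul]
    exact Submodule.span_singleton_smul_eq (mul_ne_zero hβ0 hr0).isUnit z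
  let Ψ := (LinearIsometryEquiv.toSpanUnitSingleton (𝕜 := ℂ) _ hp.norm_eq).trans
    (LinearIsometryEquiv.ofEq _ _ hspan)
  exact ⟨Ψ.symm, _, hG, hp, hZ, fun a => rfl, hframe⟩

end

end CohomTwo

end

theorem mainTheorem2 (n : ℕ) (G : Subgroup (CohomTwo.SU n))
    (hcompact : IsCompact (G : Set (CohomTwo.SU n)))
    (hconnected : IsConnected (G : Set (CohomTwo.SU n)))
    (Z : Set (CohomTwo.C n))
    (hZ : ∃ z₀ ∈ CohomTwo.momentMap G ⁻¹' {0},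
      Z = connectedComponentIn (CohomTwo.momentMap G ⁻¹' {0}) z₀)
    (hL : CohomTwo.AdmitsCohomOneLagrangian G Z)
    (z' : CohomTwo.C n) (hz' : z' ∈ Z) (hz'0 : z' ≠ 0) :
    ∃ Φ : CohomTwo.line z' ≃ₗᵢ[ℂ] ℂ,
      CohomTwo.Correspondence G Z Φ CohomTwo.IsTranslator (CohomTwo.IsWeightedTranslator n) ∧
      CohomTwo.Correspondence G Z Φ CohomTwo.IsSpecialLagrangian
        (CohomTwo.IsWeightedSpecialLagrangian n) := by
  obtain ⟨z₀, hz₀, rfl⟩ := hZ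
  rcases n with _ | k
  · exact absurd (Subsingleton.elim z' 0) hz'0
  · obtain ⟨Φ, p, h⟩ := CohomTwo.exists_setup hcompact
      (fun w => by rw [CohomTwo.connectedComponentIn_momentMap G hz₀]; rfl) hL hz' hz'0
    exact ⟨Φ, h.correspondence (CohomTwo.anglePair_translator k),
      h.correspondence (CohomTwo.anglePair_specialLagrangian k)⟩
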